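/- Let $m>5/2$ be an integer, $c_0>0$ and $T>0$. Write $\mathbb P$ for the Leray projection of $L^2(\mathbb R^3;\mathbb R^3)$ onto the divergence-free fields. For each $c\ge c_0$ let $u^c_0,E^c_0,B^c_0\in H^m(\mathbb R^3)$ be divergence-free vector fields with $\sup_{c\ge c_0}\|E^c_0\|_{H^1}<\infty$, and suppose that $u^c_0\to u_0$ and $B^c_0\to B_0$ in $L^2(\mathbb R^3)$ as $c\to\infty$, with $u_0,B_0\in H^m(\mathbb R^3)$. For each $c\ge c_0$ let $(u^c,E^c,B^c)\in C([0,T];H^m(\mathbb R^3))$ be a solution of the Euler–Maxwell system $$\partial_t u+(u\cdot\nabla)u+\nabla p=j\times B,\quad \tfrac1c\partial_tE-\nabla\times B=-j,\quad \tfrac1c\partial_tB+\nabla\times E=0,\quad j=cE+\mathbb P(u\times B),$$ $$\operatorname{div}u=\operatorname{div}E=\operatorname{div}B=\operatorname{div}j=0,$$ with initial data $(u^c_0,E^c_0,B^c_0)$ and current $j^c$, and let $(\bar u,\bar B)\in C([0,T];H^m(\mathbb R^3))$ be a solution of the MHD system $$\partial_tu+(u\cdot\nabla)u+\nabla p=(\nabla\times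 B)\times B,\quad \partial_tB-\Delta B=\nabla\times(u\times B),\quad \operatorname{div}u=\operatorname{div}B=0,$$ with initial data $(u_0,B_0)$. Assume that there are constants $M,\overline M>0$, independent of $c$, such that for all $c\ge c_0$ $$\int_0^T\|B^c(t)\|_{L^\infty}^2\,dt+\int_0^T\|j^c(t)\|_{L^\infty}\,dt\le M,$$ $$\sup_{t\in[0,T]}\big(\|\bar u(t)\|_{H^m}+\|\bar B(t)\|_{H^m}\big)+\Big(\int_0^T\|\nabla\bar B(t)\|_{H^m}^2\,dt\Big)^{1/2}\le\overline M .$$ Put $\bar E=\mathbb P(\nabla\times\bar B-\bar u\times\bar B)$ and $\bar j=\nabla\times\bar B$. All limits are taken as $c\to\infty$. (i) For every $1\le p<2$: $cE^c\to\bar E$ and $j^c\to\bar j$ in $L^p(0,T;L^2(\mathbb R^3))$. (ii) If $\|E^c_0\|_{L^2}\to0$, then $cE^c\to\bar E$ and $j^c\to\bar j$ in $L^2(0,T;L^2(\mathbb R^3))$. If $\|E^c_0\|_{L^2}$ does not tend to $0$, then neither $cE^c$ nor $j^c$ converges to any limit in $L^2(0,T;L^2(\mathbb R^3))$. (iii)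 Let $2<p<\infty$. If $$\lim_{c\to\infty}c^{1-2/p}\big(\|E^c_0\|_{L^2}+\|u^c_0-u_0\|_{L^2}+\|B^c_0-B_0\|_{L^2}\big)=0,$$ then $cE^c\to\bar E$ in $L^p(0,T;L^2(\mathbb R^3))$, and, provided in addition that $\sup_{c\ge c_0}\|B^c\|_{L^p(0,T;L^\infty(\mathbb R^3))}<\infty$, also $j^c\to\bar j$ in $L^p(0,T;L^2(\mathbb R^3))$. If $$\limsup_{c\to\infty}c^{1-2/p}\big(\|E^c_0\|_{L^2}-\|u^c_0-u_0\|_{L^2}-\|B^c_0-B_0\|_{L^2}\big)>0,$$ then neither $cE^c$ nor $j^c$ converges to any limit in $L^p(0,T;L^2(\mathbb R^3))$. -/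

import Mathlib

open MeasureTheory Filter Set
open scoped Topology ENNReal

noncomputable section

namespace EulerMaxwell

/-- Physical space `ℝ³` with its Euclidean norm; also the space of values of vector fields. -/
abbrev R3 : Type := EuclideanSpace ℝ (Fin 3)

/-- The Hilbert space `L²(ℝ³; ℝ³)` of square integrable vector fields (Lebesgue measure). -/
abbrev L2Field : Type := Lp R3 2 (volume : Measure R3)

/-- The `i`-th standard basis vector of `ℝ³`. -/
def basisVec (i : Fin 3) : R3 := EuclideanSpace.single i (1 : ℝ)

/-- Real valued test functions on `ℝ³`: smooth with compact support. -/
def IsTest (φ : R3 → ℝ) : Prop := ContDiff ℝ (⊤ : ℕ∞) φ ∧ HasCompactSupport φ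

/-- The class in `L²` of a square integrable function. It is only ever applied to functions that are
square integrable for the fields under consideration; the value `0` otherwise is a convention. -/
def toL2 (f : R3 → R3) : L2Field :=
  open Classical in if h : MemLp f 2 (volume : Measure R3) then h.toLp f else 0

/-! ### Weak derivatives and the Sobolev spaces `H^m(ℝ³; ℝ³)` -/

/-- `g ∈ L²` is the weak partial derivative `∂ᵢ f` of `f ∈ L²`. -/
def IsWeakPartial (i : Fin 3) (f g : L2Field) : Prop :=
  ∀ φ : R3 → ℝ, IsTest φ →
    ∫ x, (fderiv ℝ φ x (basisVec i)) • f x = - ∫ x, φ x • g x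

/-- The weak partial derivative `∂ᵢ f` as an element of `L²` (it is unique when it exists;
`0` if there is none). -/
def weakPartial (i : Fin 3) (f : L2Field) : L2Field :=
  open Classical in if h : ∃ g, IsWeakPartial i f g then h.choose else 0

/-- `f ∈ H^m`: all weak derivatives of order at most `m` exist in `L²`. -/
def MemH : ℕ → L2Field → Prop
  | 0, _ => True
  | m + 1, f => ∀ i, ∃ g, IsWeakPartial i f g ∧ MemH m g

/-- `∑_{k ≤ m} ‖∇ᵏ f‖²_{L²}`, the squared `H^m` norm. -/
def sobolevNormSq : ℕ → L2Field → ℝ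
  | 0, f => ‖f‖ ^ 2
  | m + 1, f => ‖f‖ ^ 2 + ∑ i, sobolevNormSq m (weakPartial i f)

/-- The norm of `H^m`. -/
def sobolevNorm (m : ℕ) (f : L2Field) : ℝ := Real.sqrt (sobolevNormSq m f)

/-- `f ∈ C([0,T]; H^m)`. -/
def ContinuousInH (m : ℕ) (T : ℝ) (f : ℝ → L2Field) : Prop :=
  (∀ t ∈ Icc 0 T, MemH m (f t)) ∧
    ∀ t ∈ Icc 0 T, Tendsto (fun s => sobolevNorm m (f s - f t)) (𝓝[Icc 0 T] t) (𝓝 0)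

/-! ### Vector calculus -/

/-- The vector product of `ℝ³`. -/
def cross (a b : R3) : R3 := WithLp.toLp 2 (crossProduct (WithLp.ofLp a) (WithLp.ofLp b))

/-- The pointwise vector product `f × g` of two fields. -/
def crossField (f g : L2Field) : L2Field := toL2 (fun x => cross (f x) (g x))

/-- `∇ × f = ∑ᵢ eᵢ × ∂ᵢ f`. -/
def curl (f : L2Field) : L2Field :=
  ∑ i, toL2 (fun x => cross (basisVec i) (weakPartial i f x))

/-- `Δ f = ∑ᵢ ∂ᵢ ∂ᵢ f`. -/
def laplacian (f : L2Field) : L2Field := ∑ i, weakPartial i (weakPartial i f)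

/-- `(f · ∇) g = ∑ᵢ fᵢ ∂ᵢ g`. -/
def convection (f g : L2Field) : L2Field :=
  toL2 (fun x => ∑ i, (f x i) • weakPartial i g x)

/-- The gradients of test functions, as elements of `L²`. -/
def testGradients : Set L2Field :=
  {g | ∃ φ : R3 → ℝ, IsTest φ ∧ g =ᵐ[volume] fun x => gradient φ x}

/-- The closed subspace of divergence free fields of `L²`: those `f` with `∫ f · ∇φ = 0` for every
test function `φ`. -/
def solenoidal : Submodule ℝ L2Field := (Submodule.span ℝ testGradients)ᗮ

instance : solenoidal.HasOrthogonalProjection := by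
  have : CompleteSpace solenoidal :=
    (Submodule.isClosed_orthogonal (Submodule.span ℝ testGradients)).completeSpace_coe
  exact Submodule.HasOrthogonalProjection.ofCompleteSpace solenoidal

/-- The Leray projection `ℙ = I + ∇ (-Δ)⁻¹ div`: the orthogonal projection of `L²` onto the
divergence free fields. -/
def leray : L2Field →L[ℝ] L2Field := solenoidal.starProjection

/-- `G ∈ L²` is the (distributional) gradient of a locally integrable scalar pressure `p`. -/
def IsPressureGradient (G : L2Field) : Prop :=
  ∃ p : R3 → ℝ, LocallyIntegrable p volume ∧ ∀ i : Fin 3, ∀ φ : R3 → ℝ, IsTest φ →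
    ∫ x, fderiv ℝ φ x (basisVec i) * p x = - ∫ x, φ x * G x i

/-! ### The two systems -/

/-- Ohm's law (conductivity `1`): `j = c E + ℙ (u × B)`. -/
def current (c : ℝ) (u E B : L2Field) : L2Field := c • E + leray (crossField u B)

/-- The family `c, t ↦ c E^c(t)`. -/
def scaledE (E : ℝ → ℝ → L2Field) : ℝ → ℝ → L2Field := fun c t => c • E c t

/-- The family `c, t ↦ j^c(t)`. -/
def currents (u E B : ℝ → ℝ → L2Field) : ℝ → ℝ → L2Field :=
  fun c t => current c (u c t) (E c t) (B c t)

/-- `(u, E, B) ∈ C([0,T]; H^m)` solves the incompressible Euler–Maxwell system with speed of light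
`c` and initial data `(u₀, E₀, B₀)`. Time derivatives are taken in `L²`. -/
structure IsEulerMaxwellSolution (m : ℕ) (c T : ℝ) (u E B : ℝ → L2Field) (u₀ E₀ B₀ : L2Field) :
    Prop where
  continuous_u : ContinuousInH m T u
  continuous_E : ContinuousInH m T E
  continuous_B : ContinuousInH m T B
  initial_u : u 0 = u₀
  initial_E : E 0 = E₀
  initial_B : B 0 = B₀
  div_u : ∀ t ∈ Icc 0 T, u t ∈ solenoidal
  div_E : ∀ t ∈ Icc 0 T, E t ∈ solenoidal
  div_B : ∀ t ∈ Icc 0 T, B t ∈ solenoidal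
  div_j : ∀ t ∈ Icc 0 T, current c (u t) (E t) (B t) ∈ solenoidal
  euler : ∀ t ∈ Ioo 0 T, ∃ u' gradp : L2Field, HasDerivAt u u' t ∧ IsPressureGradient gradp ∧
    u' + convection (u t) (u t) + gradp = crossField (current c (u t) (E t) (B t)) (B t)
  ampere : ∀ t ∈ Ioo 0 T, ∃ E' : L2Field, HasDerivAt E E' t ∧
    (1 / c) • E' - curl (B t) = - current c (u t) (E t) (B t)
  faraday : ∀ t ∈ Ioo 0 T, ∃ B' : L2Field, HasDerivAt B B' t ∧
    (1 / c) • B' + curl (E t) = 0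

/-- `(u, B) ∈ C([0,T]; H^m)` solves the incompressible inviscid resistive MHD system with initial
data `(u₀, B₀)`. Time derivatives are taken in `L²`. -/
structure IsMHDSolution (m : ℕ) (T : ℝ) (u B : ℝ → L2Field) (u₀ B₀ : L2Field) : Prop where
  continuous_u : ContinuousInH m T u
  continuous_B : ContinuousInH m T B
  initial_u : u 0 = u₀
  initial_B : B 0 = B₀
  div_u : ∀ t ∈ Icc 0 T, u t ∈ solenoidal
  div_B : ∀ t ∈ Icc 0 T, B t ∈ solenoidal
  momentum : ∀ t ∈ Ioo 0 T, ∃ u' gradp : L2Field, HasDerivAt u u' t ∧ IsPressureGradient gradp ∧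
    u' + convection (u t) (u t) + gradp = crossField (curl (B t)) (B t)
  induction : ∀ t ∈ Ioo 0 T, ∃ B' : L2Field, HasDerivAt B B' t ∧
    B' - laplacian (B t) = curl (crossField (u t) (B t))

/-- `Ē = ℙ (∇ × B̄ - ū × B̄)` as a function of time. -/
def limitE (u B : ℝ → L2Field) : ℝ → L2Field :=
  fun t => leray (curl (B t) - crossField (u t) (B t))

/-- `j̄ = ∇ × B̄` as a function of time. -/
def limitJ (B : ℝ → L2Field) : ℝ → L2Field := fun t => curl (B t)

/-! ### Norms on space-time and convergence -/

/-- Lebesgue measure on the time interval `(0,T)`. -/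
def timeMeasure (T : ℝ) : Measure ℝ := volume.restrict (Ioo 0 T)

/-- `‖f‖_{L^∞(ℝ³)}`. -/
def supNorm (f : L2Field) : ℝ≥0∞ := eLpNorm f ∞ (volume : Measure R3)

/-- `‖∇f‖²_{H^m}`. -/
def gradSobolevNormSq (m : ℕ) (f : L2Field) : ℝ := ∑ i, sobolevNormSq m (weakPartial i f)

/-- `f c → F` in `L^p(0,T; L²(ℝ³))` as `c → ∞`. -/
def ConvergesInLpL2 (p T : ℝ) (f : ℝ → ℝ → L2Field) (F : ℝ → L2Field) : Prop :=
  Tendsto (fun c => eLpNorm (fun t => f c t - F t) (ENNReal.ofReal p) (timeMeasure T)) atTop (𝓝 0)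

/-- `f c` converges, as `c → ∞`, to some element of `L^p(0,T; L²(ℝ³))` in that space. -/
def HasLimitInLpL2 (p T : ℝ) (f : ℝ → ℝ → L2Field) : Prop :=
  ∃ F : ℝ → L2Field, MemLp F (ENNReal.ofReal p) (timeMeasure T) ∧ ConvergesInLpL2 p T f F

end EulerMaxwell

end

open EulerMaxwell

open MeasureTheory Filter Set
open scoped Topology ENNReal

noncomputable section

/-! The proof is a relative energy argument combined with the analysis of an initial layer. Ampère's
law reads `∂ₜ(cE) = -c² (cE) + c² (...)`, so `cE` relaxes to `Ē` on the time scale `c⁻²` and carries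
the layer `c exp(-c² t) E₀`. Its norm in `L^p(0,T; L²)` is of size `c^(1-2/p) ‖E₀‖`. It vanishes in
the limit for `p < 2`, is comparable to `‖E₀‖` for `p = 2`, and for `p > 2` vanishes only if `‖E₀‖`
is small enough. This is the origin of the three regimes.

Upper bounds. The energy of the differences is `½(‖u-ū‖² + ‖B-B̄‖² + c⁻²‖cE-Ē-Λ‖²)`, with `Λ` the
layer of a field `F`. In its time derivative (`energy_balance`) the pressures drop out against
divergence free fields, transport by `u` is antisymmetric, the two curl couplings cancel since the
curl is symmetric, and the Lorentz force cancels against `ℙ((u-ū)×B)` in Ohm's law. What remains is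
the dissipation `-‖j-j̄-Λ‖²` and terms controlled by norms of the MHD solution and of `F`. No norm
of `B^c` in `L^∞` is needed here. `Ē` is only Lipschitz in time, so Grönwall's lemma is run with
functions touching the energy from above (`le_of_touching_above`, `energy_estimate`). The outcome is
a size `S` bounding `u-ū` and `B-B̄` uniformly in time, `j-j̄-Λ` in `L²` in time, and `cE-Ē-Λ` by
`cS` uniformly in time. Ohm's law and the bound of `B^c` in `L²(0,T; L^∞)` transfer the `L²` bound
from the current to the electric field.

For `p < 2`, `E₀` need not be small; `F` is a mollification of `E₀`, close to it in `L²` and bounded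
in `L^∞`, uniformly in `c` by the `H¹` bound. The terms it creates carry the factor `c exp(-c² t)`,
whose time integral is at most `1/c`. For `p ≥ 2` one takes `F = 0`; for `p = 2` the energy bounds
conclude, and for `p > 2` the electric error is interpolated between `cS` in `L^∞` and a multiple of
`S` in `L²`.

Absence of limits. A family converging in `L^p` has small norm on the window `(0, q²/c²)`. Ampère's
law tested with `E₀` (`norm_initial_le`) shows that `E` stays near `E₀` there unless the current is
large. Since `cE` and `j` differ by `ℙ(u×B)`, whose integral over the window is of order `q‖E₀‖/c`
up to smaller terms, a small `q` gives a lower bound for `cE` and a large `q` one for `j`. Both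
contradict smallness when `c^(1-2/p) ‖E₀‖` does not tend to zero and dominates the other data
(`not_hasLimitInLpL2`).

The calculus rests on translations: a weak derivative is the strong derivative of `s ↦ f(· + s v)`
in `L²`, which yields integration by parts and the product rule. Gaussian averages yield the
embedding `H² ⊂ L^∞`, and with it a div-curl uniqueness theorem that handles pressures known only to
be locally integrable. -/

namespace EulerMaxwell

/-! ### Translations on L² -/

/-- The translation `f ↦ f(· + y)` on `L²`. -/
def shift (y : R3) : L2Field →ₗᵢ[ℝ] L2Field :=
  Lp.compMeasurePreservingₗᵢ ℝ (fun x => x + y) (measurePreserving_add_right volume y)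

theorem coeFn_shift (y : R3) (f : L2Field) : shift y f =ᵐ[volume] fun x => f (x + y) :=
  Lp.coeFn_compMeasurePreserving f (measurePreserving_add_right volume y)

theorem shift_zero (f : L2Field) : shift 0 f = f := by
  apply Lp.ext
  filter_upwards [coeFn_shift 0 f] with x hx
  simpa using hx

theorem shift_shift (y z : R3) (f : L2Field) : shift y (shift z f) = shift (y + z) f := by
  apply Lp.ext
  have h := (measurePreserving_add_right volume y).quasiMeasurePreserving.ae (coeFn_shift z f)
  filter_upwards [coeFn_shift y (shift z f), coeFn_shift (y + z) f, h] with x h1 h2 h3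
  rw [h1, h2, h3, add_assoc]

theorem continuous_shift (f : L2Field) : Continuous fun y => shift y f := by
  have hg : Continuous (fun y : R3 => (⟨fun x => x + y, by fun_prop⟩ : C(R3, R3))) := by
    refine ContinuousMap.continuous_of_continuous_uncurry _ ?_
    change Continuous fun p : R3 × R3 => p.2 + p.1
    fun_prop
  exact Continuous.compMeasurePreservingLp (f := fun _ : R3 => f) continuous_const hg
    (fun y => measurePreserving_add_right volume y) (by simp)

theorem inner_shift_shift (y : R3) (f g : L2Field) :
    inner ℝ (shift y f) (shift y g) = inner ℝ f g := (shift y).inner_map_map f g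

/-! ### Pairings with test functions -/

theorem IsTest.memLp {φ : R3 → ℝ} (hφ : IsTest φ) (p : ℝ≥0∞) : MemLp φ p volume :=
  hφ.1.continuous.memLp_of_hasCompactSupport hφ.2

theorem IsTest.fderiv {φ : R3 → ℝ} (hφ : IsTest φ) (v : R3) :
    IsTest fun x => fderiv ℝ φ x v :=
  ⟨(hφ.1.fderiv_right (m := (⊤ : ℕ∞)) (by simp)).clm_apply contDiff_const,
    hφ.2.fderiv_apply ℝ v⟩

theorem IsTest.fderiv_comm {φ : R3 → ℝ} (hφ : IsTest φ) (x v w : R3) :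
    _root_.fderiv ℝ (fun x => _root_.fderiv ℝ φ x v) x w =
      _root_.fderiv ℝ (fun x => _root_.fderiv ℝ φ x w) x v := by
  have hs : IsSymmSndFDerivAt ℝ φ x :=
    (hφ.1.contDiffAt (x := x)).isSymmSndFDerivAt
      (by simpa using WithTop.coe_le_coe.2 (le_top (a := (2 : ℕ∞))))
  have hd : DifferentiableAt ℝ (_root_.fderiv ℝ φ) x :=
    ((hφ.1.fderiv_right (m := (⊤ : ℕ∞)) (by simp)).differentiable (by simp)) x
  rw [fderiv_clm_apply hd (differentiableAt_const w),
    fderiv_clm_apply hd (differentiableAt_const v)]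
  simp [hs.eq v w]

theorem IsTest.comp_sub {φ : R3 → ℝ} (hφ : IsTest φ) (y : R3) : IsTest fun x => φ (x - y) :=
  ⟨hφ.1.comp (contDiff_id.sub contDiff_const),
    hφ.2.comp_homeomorph (Homeomorph.subRight y)⟩

/-- The pairing `f ↦ ∫ φ f` with a test function. -/
def pair (φ : R3 → ℝ) (hφ : IsTest φ) : L2Field →L[ℝ] R3 :=
  (ContinuousLinearMap.lsmul ℝ ℝ : ℝ →L[ℝ] R3 →L[ℝ] R3).lpPairing volume 2 2 ((hφ.memLp 2).toLp φ)

theorem pair_apply {φ : R3 → ℝ} (hφ : IsTest φ) (f : L2Field) : pair φ hφ f = ∫ x, φ x • f x := by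
  rw [pair, ContinuousLinearMap.lpPairing_eq_integral]
  refine integral_congr_ae ?_
  filter_upwards [(hφ.memLp 2).coeFn_toLp] with x hx
  simp [hx]

theorem ext_pair {f g : L2Field} (h : ∀ φ (hφ : IsTest φ), pair φ hφ f = pair φ hφ g) : f = g := by
  apply Lp.ext
  refine ae_eq_of_integral_contDiff_smul_eq ((Lp.memLp f).locallyIntegrable (by norm_num))
    ((Lp.memLp g).locallyIntegrable (by norm_num)) fun φ h1 h2 => ?_
  have hφ : IsTest φ := ⟨h1, h2⟩
  rw [← pair_apply hφ, ← pair_apply hφ, h φ hφ]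

theorem pair_shift {φ : R3 → ℝ} (hφ : IsTest φ) (y : R3) (f : L2Field) :
    pair φ hφ (shift y f) = pair _ (hφ.comp_sub y) f := by
  rw [pair_apply hφ, pair_apply (hφ.comp_sub y),
    ← integral_add_right_eq_self (μ := volume) (fun x => φ (x - y) • f x) y]
  refine integral_congr_ae ?_
  filter_upwards [coeFn_shift y f] with x hx
  simp [hx]

/-- As a function of `y` the pairing is the convolution of `f` with the reflected test function, so
the derivative falls on the smooth factor and `f` needs no regularity. -/
theorem hasFDerivAt_pair_shift {φ : R3 → ℝ} (hφ : IsTest φ) (f : L2Field) (y : R3) :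
    ∃ D : R3 →L[ℝ] R3, HasFDerivAt (fun y => pair φ hφ (shift y f)) D y ∧
      ∀ v, D v = - pair _ (hφ.fderiv v) (shift y f) := by
  set ψ : R3 → ℝ := fun z => φ (-z) with hψ
  have hψ1 : ContDiff ℝ 1 ψ := (hφ.1.of_le (by simp)).comp contDiff_neg
  have hψ2 : HasCompactSupport ψ := hφ.2.comp_homeomorph (Homeomorph.neg R3)
  have hloc : LocallyIntegrable f volume := (Lp.memLp f).locallyIntegrable (by norm_num)
  set L : R3 →L[ℝ] ℝ →L[ℝ] R3 := (ContinuousLinearMap.lsmul ℝ ℝ : ℝ →L[ℝ] R3 →L[ℝ] R3).flip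
  have hd := hψ2.hasFDerivAt_convolution_right L (μ := volume) hloc hψ1 y
  have heq : (fun y => pair φ hφ (shift y f)) = convolution f ψ L volume := by
    funext y
    rw [pair_shift, pair_apply]
    simp [convolution, L, hψ]
  rw [← heq] at hd
  refine ⟨_, hd, fun v => ?_⟩
  rw [convolution_precompR_apply L hloc (hψ2.fderiv ℝ) (hψ1.continuous_fderiv one_ne_zero),
    pair_shift, pair_apply, convolution, ← integral_neg]
  refine integral_congr_ae (Eventually.of_forall fun x => ?_)
  have : HasFDerivAt ψ ((fderiv ℝ φ (x - y)).comp (-ContinuousLinearMap.id ℝ R3)) (y - x) := by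
    have h1 : HasFDerivAt φ (fderiv ℝ φ (x - y)) (-(y - x)) := by
      rw [neg_sub]
      exact (hφ.1.differentiable (by simp) _).hasFDerivAt
    exact h1.comp (y - x) ((hasFDerivAt_id (y - x)).neg)
  simp [L, this.fderiv]

/-! ### Weak directional derivatives -/

/-- `g ∈ L²` is the weak derivative of `f ∈ L²` in the direction `v`. -/
def IsWeakDeriv (v : R3) (f g : L2Field) : Prop :=
  ∀ φ (hφ : IsTest φ), pair _ (hφ.fderiv v) f = - pair φ hφ g

theorem isWeakPartial_iff {i : Fin 3} {f g : L2Field} :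
    IsWeakPartial i f g ↔ IsWeakDeriv (basisVec i) f g := by
  simp only [IsWeakPartial, IsWeakDeriv, pair_apply]

variable {v w : R3} {f g f' g' : L2Field}

theorem IsWeakDeriv.unique (h : IsWeakDeriv v f g) (h' : IsWeakDeriv v f g') : g = g' :=
  ext_pair fun φ hφ => neg_injective ((h φ hφ).symm.trans (h' φ hφ))

theorem IsWeakDeriv.add (h : IsWeakDeriv v f g) (h' : IsWeakDeriv v f' g') :
    IsWeakDeriv v (f + f') (g + g') := fun φ hφ => by
  rw [map_add, map_add, h φ hφ, h' φ hφ, neg_add]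

theorem IsWeakDeriv.sub (h : IsWeakDeriv v f g) (h' : IsWeakDeriv v f' g') :
    IsWeakDeriv v (f - f') (g - g') := fun φ hφ => by
  rw [map_sub, map_sub, h φ hφ, h' φ hφ]; abel

theorem IsWeakDeriv.smul (h : IsWeakDeriv v f g) (a : ℝ) :
    IsWeakDeriv v (a • f) (a • g) := fun φ hφ => by
  rw [map_smul, map_smul, h φ hφ, smul_neg]

theorem isWeakDeriv_zero : IsWeakDeriv v 0 0 := fun φ hφ => by simp

theorem IsWeakDeriv.sum {ι : Type*} {s : Finset ι} {f g : ι → L2Field}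
    (h : ∀ k ∈ s, IsWeakDeriv v (f k) (g k)) : IsWeakDeriv v (∑ k ∈ s, f k) (∑ k ∈ s, g k) :=
  fun φ hφ => by
    rw [map_sum, map_sum, ← Finset.sum_neg_distrib]
    exact Finset.sum_congr rfl fun k hk => h k hk φ hφ

theorem pair_fderiv_sum {φ : R3 → ℝ} (hφ : IsTest φ) (a : R3) (f : L2Field) :
    pair _ (hφ.fderiv a) f = ∑ i, a i • pair _ (hφ.fderiv (basisVec i)) f := by
  have ha : a = ∑ i, a i • basisVec i := by
    ext j
    simp [basisVec, Fin.sum_univ_three, PiLp.single_apply]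
    fin_cases j <;> simp
  simp only [pair_apply]
  simp_rw [← integral_smul]
  rw [← integral_finsetSum]
  · refine integral_congr_ae (Eventually.of_forall fun x => ?_)
    conv_lhs => rw [ha]
    simp [Finset.sum_smul, smul_smul]
  · intro i _
    have : Integrable (fun x => (fderiv ℝ φ x (basisVec i)) • f x) volume :=
      memLp_one_iff_integrable.1 ((Lp.memLp f).smul ((hφ.fderiv _).memLp 2))
    exact this.smul (a i)

theorem IsWeakDeriv.of_partials {f : L2Field} {d : Fin 3 → L2Field}
    (h : ∀ i, IsWeakDeriv (basisVec i) f (d i)) (a : R3) : IsWeakDeriv a f (∑ i, a i • d i) := by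
  intro φ hφ
  rw [pair_fderiv_sum hφ, map_sum, ← Finset.sum_neg_distrib]
  refine Finset.sum_congr rfl fun i _ => ?_
  rw [h i φ hφ, map_smul, smul_neg]

theorem IsWeakDeriv.shift (h : IsWeakDeriv v f g) (y : R3) :
    IsWeakDeriv v (shift y f) (shift y g) := fun φ hφ => by
  rw [pair_shift, pair_shift, ← h _ (hφ.comp_sub y), pair_apply, pair_apply]
  refine integral_congr_ae (Eventually.of_forall fun x => ?_)
  simp [fderiv_comp_sub]

/-- Paired with a test function, this is the fundamental theorem of calculus in `r`. Holding as an
identity in `L²`, it upgrades the weak derivative to the strong generator of the translation group,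
which is how weak derivatives are used from here on. -/
theorem IsWeakDeriv.shift_sub (h : IsWeakDeriv v f g) (s : ℝ) :
    EulerMaxwell.shift (s • v) f - f = ∫ r in (0 : ℝ)..s, EulerMaxwell.shift (r • v) g := by
  have hcg : Continuous fun r : ℝ => EulerMaxwell.shift (r • v) g :=
    (continuous_shift g).comp (by fun_prop)
  refine ext_pair fun φ hφ => ?_
  have hder : ∀ r : ℝ, HasDerivAt (fun r : ℝ => pair φ hφ (EulerMaxwell.shift (r • v) f))
      (pair φ hφ (EulerMaxwell.shift (r • v) g)) r := by
    intro r
    obtain ⟨D, hD, hD'⟩ := hasFDerivAt_pair_shift hφ f (r • v)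
    have h1 : HasDerivAt (fun r : ℝ => r • v) v r := by
      simpa using (hasDerivAt_id r).smul_const v
    have h2 := hD.comp_hasDerivAt r h1
    rwa [hD', (h.shift _) φ hφ, neg_neg] at h2
  rw [map_sub, ← ContinuousLinearMap.intervalIntegral_comp_comm _ (hcg.intervalIntegrable _ _),
    intervalIntegral.integral_eq_sub_of_hasDerivAt (fun r _ => hder r)
      (((pair φ hφ).continuous.comp hcg).intervalIntegrable _ _)]
  simp [shift_zero]

theorem IsWeakDeriv.hasDerivAt (h : IsWeakDeriv v f g) (s : ℝ) :
    HasDerivAt (fun r : ℝ => EulerMaxwell.shift (r • v) f) (EulerMaxwell.shift (s • v) g) s := by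
  have hcg : Continuous fun r : ℝ => EulerMaxwell.shift (r • v) g :=
    (continuous_shift g).comp (by fun_prop)
  have h1 := intervalIntegral.integral_hasDerivAt_right (hcg.intervalIntegrable 0 s)
    (hcg.stronglyMeasurableAtFilter _ _) hcg.continuousAt
  have h2 := h1.add_const f
  refine h2.congr_of_eventuallyEq (Eventually.of_forall fun r => ?_)
  simp only
  rw [← h.shift_sub r, sub_add_cancel]

theorem IsWeakDeriv.hasDerivAt_zero (h : IsWeakDeriv v f g) :
    HasDerivAt (fun r : ℝ => EulerMaxwell.shift (r • v) f) g 0 := by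
  simpa [shift_zero] using h.hasDerivAt 0

/-- A converse that asks only for differentiability of the pairings at `r = 0`. It serves for
products, whose difference quotients are controlled in `L¹` but not a priori in `L²`. -/
theorem IsWeakDeriv.of_hasDerivAt
    (h : ∀ φ (hφ : IsTest φ), HasDerivAt (fun r : ℝ => pair φ hφ (EulerMaxwell.shift (r • v) f))
      (pair φ hφ g) 0) : IsWeakDeriv v f g := by
  intro φ hφ
  obtain ⟨D, hD, hD'⟩ := hasFDerivAt_pair_shift hφ f ((0 : ℝ) • v)
  have h1 : HasDerivAt (fun r : ℝ => r • v) v 0 := by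
    simpa using (hasDerivAt_id (0 : ℝ)).smul_const v
  have h2 := HasDerivAt.unique (f := fun r : ℝ => pair φ hφ (EulerMaxwell.shift (r • v) f))
    (HasFDerivAt.comp_hasDerivAt (l := fun y => pair φ hφ (EulerMaxwell.shift y f)) 0 hD h1)
    (h φ hφ)
  rw [hD'] at h2
  rw [← h2]
  simp [shift_zero]

theorem IsWeakDeriv.norm_shift_sub_le (h : IsWeakDeriv v f g) (s : ℝ) :
    ‖EulerMaxwell.shift (s • v) f - f‖ ≤ |s| * ‖g‖ := by
  rw [h.shift_sub s]
  have := intervalIntegral.norm_integral_le_of_norm_le_const (a := (0 : ℝ)) (b := s) (C := ‖g‖)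
    (f := fun r => EulerMaxwell.shift (r • v) g) fun r _ => by simp
  simpa [mul_comm] using this

/-- Integration by parts. -/
theorem IsWeakDeriv.inner_left (h : IsWeakDeriv v f g) (h' : IsWeakDeriv v f' g') :
    inner ℝ g f' = - inner ℝ f g' := by
  have h1 := h.hasDerivAt_zero.inner ℝ h'.hasDerivAt_zero
  -- Translations are isometries, so this inner product is constant in `r`; its derivative at `0`
  -- gives integration by parts.
  have h2 : (fun r : ℝ => inner ℝ (EulerMaxwell.shift (r • v) f) (EulerMaxwell.shift (r • v) f')) =
      fun _ => inner ℝ f f' := by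
    funext r
    exact inner_shift_shift _ _ _
  rw [h2] at h1
  have := h1.unique (hasDerivAt_const _ _)
  simp only [zero_smul, shift_zero] at this
  linarith

/-- Weak derivatives commute. -/
theorem IsWeakDeriv.comm {fv fw fvw : L2Field} (hv : IsWeakDeriv v f fv) (hw : IsWeakDeriv w f fw)
    (hvw : IsWeakDeriv v fw fvw) : IsWeakDeriv w fv fvw := by
  intro φ hφ
  have e1 := hv _ (hφ.fderiv w)
  have e2 := hw _ (hφ.fderiv v)
  have e3 := hvw φ hφ
  have e4 : pair _ ((hφ.fderiv w).fderiv v) f = pair _ ((hφ.fderiv v).fderiv w) f := by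
    rw [pair_apply, pair_apply]
    refine integral_congr_ae (Eventually.of_forall fun x => ?_)
    simp only [hφ.fderiv_comm x w v]
  rw [← e3, ← neg_eq_iff_eq_neg.mpr e2.symm.symm, ← e4, e1, neg_neg]

/-! ### Averages of translates -/

/-- The average `∫ k(z) f(· + δ z) dz`. -/
def avg (k : R3 → ℝ) (δ : ℝ) (f : L2Field) : L2Field := ∫ z, k z • shift (δ • z) f

section avg

variable {k : R3 → ℝ} {δ : ℝ} {f g : L2Field} {v : R3}

theorem continuous_shift_smul (δ : ℝ) (f : L2Field) : Continuous fun z : R3 => shift (δ • z) f :=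
  (continuous_shift f).comp (by fun_prop)

theorem integrable_smul_shift (hk : Integrable k) (δ : ℝ) (f : L2Field) :
    Integrable fun z => k z • shift (δ • z) f := by
  refine (hk.norm.mul_const ‖f‖).mono'
    (hk.1.smul (continuous_shift_smul δ f).aestronglyMeasurable) ?_
  exact Eventually.of_forall fun z => by simp [norm_smul]

theorem norm_avg_le (hk : Integrable k) (δ : ℝ) (f : L2Field) :
    ‖avg k δ f‖ ≤ (∫ z, ‖k z‖) * ‖f‖ := by
  rw [← integral_mul_const]
  exact norm_integral_le_of_norm_le (hk.norm.mul_const ‖f‖)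
    (Eventually.of_forall fun z => by simp [norm_smul])

theorem clm_avg {G : Type*} [NormedAddCommGroup G] [NormedSpace ℝ G] [CompleteSpace G]
    (L : L2Field →L[ℝ] G) (hk : Integrable k) (δ : ℝ) (f : L2Field) :
    L (avg k δ f) = ∫ z, k z • L (shift (δ • z) f) := by
  rw [avg, ← L.integral_comp_comm (integrable_smul_shift hk δ f)]
  simp

theorem IsWeakDeriv.avg (h : IsWeakDeriv v f g) (hk : Integrable k) (δ : ℝ) :
    IsWeakDeriv v (avg k δ f) (avg k δ g) := fun φ hφ => by
  rw [clm_avg _ hk, clm_avg _ hk, ← integral_neg]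
  refine integral_congr_ae (Eventually.of_forall fun z => ?_)
  simp [(h.shift (δ • z)) φ hφ]

theorem inner_avg_left (hk : Integrable k) (δ : ℝ) (f ψ : L2Field) :
    inner ℝ (EulerMaxwell.avg k δ f) ψ = ∫ z, k z * inner ℝ (shift (δ • z) f) ψ := by
  rw [real_inner_comm, ← innerSL_apply_apply ℝ, clm_avg _ hk]
  simp [real_inner_comm]

theorem lintegral_shift_sq (hδ : 0 < δ) (f : L2Field) (x : R3) :
    ∫⁻ z, ‖f (x + δ • z)‖ₑ ^ (2 : ℝ) = ENNReal.ofReal ((δ ^ 3)⁻¹) * ‖f‖ₑ ^ (2 : ℝ) := by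
  have hm : Measurable f := (Lp.stronglyMeasurable f).measurable
  have hg : Measurable fun y => ‖f (x + y)‖ₑ ^ (2 : ℝ) := by fun_prop
  have h1 := lintegral_map (μ := (volume : Measure R3)) hg (measurable_const_smul δ)
  rw [Measure.map_addHaar_smul _ hδ.ne', lintegral_smul_measure,
    lintegral_add_left_eq_self (fun y => ‖f y‖ₑ ^ (2 : ℝ)) x] at h1
  rw [← h1]
  have h2 : ‖f‖ₑ ^ (2 : ℝ) = ∫⁻ y, ‖f y‖ₑ ^ (2 : ℝ) := by
    rw [Lp.enorm_def, eLpNorm_eq_lintegral_rpow_enorm_toReal (by simp) (by simp)]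
    simp only [ENNReal.toReal_ofNat]
    rw [← ENNReal.rpow_mul]
    simp
  rw [h2, abs_of_pos (by positivity)]
  simp

/-- Averages against square integrable kernels are bounded functions, in dual form. -/
theorem abs_inner_avg_le (hk : Integrable k) (hk2 : MemLp k 2 volume) (hδ : 0 < δ) (f : L2Field)
    {ψ : L2Field} (hψ : Integrable ψ) :
    |inner ℝ (EulerMaxwell.avg k δ f) ψ| ≤
      (eLpNorm k 2 volume).toReal * (Real.sqrt (δ ^ 3))⁻¹ * ‖f‖ * ∫ x, ‖ψ x‖ := by
  have hmf : Measurable f := (Lp.stronglyMeasurable f).measurable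
  have hmψ : Measurable ψ := (Lp.stronglyMeasurable ψ).measurable
  have key : ‖inner ℝ (EulerMaxwell.avg k δ f) ψ‖ₑ ≤
      (eLpNorm k 2 volume * (ENNReal.ofReal ((Real.sqrt (δ ^ 3))⁻¹) * ‖f‖ₑ)) * ∫⁻ x, ‖ψ x‖ₑ := by
    rw [inner_avg_left hk]
    calc ‖∫ z, k z * inner ℝ (shift (δ • z) f) ψ‖ₑ
        ≤ ∫⁻ z, ‖k z * inner ℝ (shift (δ • z) f) ψ‖ₑ := enorm_integral_le_lintegral_enorm _
      _ ≤ ∫⁻ z, ∫⁻ x, ‖k z‖ₑ * (‖f (x + δ • z)‖ₑ * ‖ψ x‖ₑ) := by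
          refine lintegral_mono fun z => ?_
          rw [enorm_mul, lintegral_const_mul _ (by fun_prop)]
          gcongr
          rw [L2.inner_def]
          refine (enorm_integral_le_lintegral_enorm _).trans (lintegral_mono_ae ?_)
          filter_upwards [coeFn_shift (δ • z) f] with x hx
          rw [hx, ← enorm_norm (f _), ← enorm_norm (ψ _), ← enorm_mul]
          rw [← ofReal_norm, ← ofReal_norm, norm_mul, norm_norm, norm_norm]
          exact ENNReal.ofReal_le_ofReal (norm_inner_le_norm _ _)
      _ = ∫⁻ x, ∫⁻ z, ‖k z‖ₑ * (‖f (x + δ • z)‖ₑ * ‖ψ x‖ₑ) := by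
          refine lintegral_lintegral_swap ?_
          refine AEMeasurable.mul (hk.1.enorm.comp_fst) (Measurable.aemeasurable ?_)
          fun_prop
      _ ≤ ∫⁻ x, (eLpNorm k 2 volume * (ENNReal.ofReal ((Real.sqrt (δ ^ 3))⁻¹) * ‖f‖ₑ))
            * ‖ψ x‖ₑ := by
          refine lintegral_mono fun x => ?_
          simp only [← mul_assoc]
          have hm1 : AEMeasurable (fun z => ‖k z‖ₑ * ‖f (x + δ • z)‖ₑ) volume :=
            hk.1.enorm.mul (by fun_prop)
          rw [lintegral_mul_const'' _ hm1]
          gcongr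
          -- Cauchy–Schwarz in `z` at fixed `x`. Rescaling by `δ` in dimension three produces the
          -- factor `δ^(-3/2)`.
          refine (ENNReal.lintegral_mul_le_Lp_mul_Lq _ Real.HolderConjugate.two_two
            hk.1.enorm (by fun_prop)).trans ?_
          rw [lintegral_shift_sq hδ,
            eLpNorm_eq_lintegral_rpow_enorm_toReal (p := 2) (by simp) (by simp), mul_assoc]
          simp only [ENNReal.toReal_ofNat]
          gcongr
          rw [ENNReal.mul_rpow_of_nonneg _ _ (by positivity), ← ENNReal.rpow_mul,
            ENNReal.ofReal_rpow_of_nonneg (by positivity) (by positivity), ← Real.sqrt_eq_rpow,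
            Real.sqrt_inv]
          simp
      _ = _ := lintegral_const_mul _ (by fun_prop)
  have h2 := ENNReal.toReal_mono (by
    refine ENNReal.mul_ne_top (ENNReal.mul_ne_top hk2.2.ne (ENNReal.mul_ne_top (by simp) (by simp)))
      hψ.2.ne) key
  rw [toReal_enorm, Real.norm_eq_abs] at h2
  refine h2.trans (le_of_eq ?_)
  rw [ENNReal.toReal_mul, ENNReal.toReal_mul, ENNReal.toReal_mul,
    ENNReal.toReal_ofReal (by positivity), toReal_enorm, ← integral_norm_eq_lintegral_enorm hψ.1]
  ring

end avg

/-! ### Essentially bounded fields -/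

/-- The field `f` is bounded by `C` almost everywhere. -/
def EssBdd (f : L2Field) (C : ℝ) : Prop := ∀ᵐ x, ‖f x‖ ≤ C

theorem EssBdd.mono {f : L2Field} {C C' : ℝ} (h : EssBdd f C) (hC : C ≤ C') : EssBdd f C' :=
  Eventually.mono h fun _ hx => hx.trans hC

/-- Duality between `L^∞` and `L¹`: test with `f` restricted to `A = {‖f‖ ≥ C + ε}`, which has
finite measure because `f ∈ L²`. The hypothesis gives `∫_A ‖f‖² ≤ C ∫_A ‖f‖`, while `‖f‖² > C ‖f‖`
on `A`, so `A` is null. -/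
theorem essBdd_of_inner_le {f : L2Field} {C : ℝ} (hC : 0 ≤ C)
    (h : ∀ ψ : L2Field, Integrable ψ → inner ℝ f ψ ≤ C * ∫ x, ‖ψ x‖) : EssBdd f C := by
  have hmf : Measurable f := (Lp.stronglyMeasurable f).measurable
  have main : ∀ ε : ℝ, 0 < ε → ∀ᵐ x, ‖f x‖ < C + ε := by
    intro ε hε
    set A : Set R3 := {x | C + ε ≤ ‖f x‖} with hA
    have hAm : MeasurableSet A := measurableSet_le measurable_const hmf.norm
    have hAf : volume A < ∞ := by
      have := (Lp.memLp f).meas_ge_lt_top' (μ := volume) (by simp) (by simp)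
        (ε := ENNReal.ofReal (C + ε)) (by simp; linarith)
      refine lt_of_le_of_lt (measure_mono fun x hx => ?_) this
      simp only [mem_ofPred_eq]
      have hx' : C + ε ≤ ‖f x‖ := hx
      rw [← enorm_eq_nnnorm, ← ofReal_norm]
      exact ENNReal.ofReal_le_ofReal hx'
    have hmem : MemLp (A.indicator f) 2 volume := (Lp.memLp f).indicator hAm
    set ψ : L2Field := hmem.toLp _ with hψ
    have hψe : ψ =ᵐ[volume] A.indicator f := hmem.coeFn_toLp
    have hint : IntegrableOn f A := by
      have : MemLp f 1 (volume.restrict A) := by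
        have : IsFiniteMeasure (volume.restrict A) := ⟨by simpa using hAf⟩
        exact ((Lp.memLp f).restrict A).mono_exponent (by norm_num)
      exact memLp_one_iff_integrable.1 this
    have hψi : Integrable ψ := (integrable_congr hψe).2 (hint.integrable_indicator hAm)
    have h0 := h ψ hψi
    have e1 : ∫ x, ‖ψ x‖ = ∫ x in A, ‖f x‖ := by
      rw [← integral_indicator hAm]
      refine integral_congr_ae ?_
      filter_upwards [hψe] with x hx
      rw [hx, norm_indicator_eq_indicator_norm]
    have e2 : inner ℝ f ψ = ∫ x in A, ‖f x‖ ^ 2 := by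
      rw [L2.inner_def, ← integral_indicator hAm]
      refine integral_congr_ae ?_
      filter_upwards [hψe] with x hx
      rw [hx]
      by_cases hxA : x ∈ A <;> simp [hxA]
    have hsq : IntegrableOn (fun x => ‖f x‖ ^ 2) A :=
      ((Lp.memLp f).integrable_norm_pow (by norm_num)).integrableOn
    rw [e1, e2, ← integral_const_mul] at h0
    have h1 : ∫ x in A, (‖f x‖ ^ 2 - C * ‖f x‖) ≤ 0 := by
      rw [integral_sub hsq (hint.norm.const_mul C)]
      linarith
    have hpos : ∀ x ∈ A, 0 < ‖f x‖ ^ 2 - C * ‖f x‖ := fun x hx => by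
      have hx' : C + ε ≤ ‖f x‖ := hx
      nlinarith [norm_nonneg (f x)]
    have hnn : 0 ≤ᵐ[volume.restrict A] fun x => ‖f x‖ ^ 2 - C * ‖f x‖ :=
      (ae_restrict_iff' hAm).2 (Eventually.of_forall fun x hx => (hpos x hx).le)
    have h2 := (integral_eq_zero_iff_of_nonneg_ae hnn (hsq.sub (hint.norm.const_mul C))).1
      (le_antisymm h1 (integral_nonneg_of_ae hnn))
    filter_upwards [(ae_restrict_iff' hAm).1 h2] with x hx
    by_contra hcon
    exact (hpos x (not_lt.1 hcon)).ne' (hx (not_lt.1 hcon))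
  have hall : ∀ᵐ x, ∀ n : ℕ, ‖f x‖ < C + 1 / ((n : ℝ) + 1) :=
    ae_all_iff.2 fun n => main _ (by positivity)
  filter_upwards [hall] with x hx
  refine le_of_forall_pos_le_add fun ε hε => ?_
  obtain ⟨n, hn⟩ := exists_nat_one_div_lt hε
  exact ((hx n).trans (by linarith)).le

/-! ### Gaussian averages -/

/-- The Gaussian kernel `exp(-‖z‖²)`. -/
def gauss (z : R3) : ℝ := Real.exp (-‖z‖ ^ 2)

theorem gauss_pos (z : R3) : 0 < gauss z := Real.exp_pos _

theorem continuous_gauss : Continuous gauss := by unfold gauss; fun_prop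

theorem integral_exp_neg_mul_sq_pos {b : ℝ} (hb : 0 < b) :
    0 < ∫ z : R3, Real.exp (-b * ‖z‖ ^ 2) := by
  rw [GaussianFourier.integral_rexp_neg_mul_sq_norm hb]
  positivity

theorem integrable_exp_neg_mul_sq {b : ℝ} (hb : 0 < b) :
    Integrable fun z : R3 => Real.exp (-b * ‖z‖ ^ 2) :=
  .of_integral_ne_zero (integral_exp_neg_mul_sq_pos hb).ne'

theorem integrable_gauss : Integrable gauss := by
  refine (integrable_exp_neg_mul_sq one_pos).congr (Eventually.of_forall fun z => ?_)
  simp [gauss]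

/-- The total mass of the Gaussian kernel. -/
def gaussMass : ℝ := ∫ z, gauss z

theorem gaussMass_pos : 0 < gaussMass := by
  simpa [gauss, gaussMass] using integral_exp_neg_mul_sq_pos one_pos

theorem memLp_gauss : MemLp gauss 2 volume := by
  rw [memLp_two_iff_integrable_sq continuous_gauss.aestronglyMeasurable]
  refine (integrable_exp_neg_mul_sq two_pos).congr (Eventually.of_forall fun z => ?_)
  simp only [gauss]
  rw [← Real.exp_nat_mul]
  congr 1
  push_cast
  ring

theorem norm_mul_gauss_le (z : R3) : ‖z‖ * gauss z ≤ Real.exp (-(1 / 2) * ‖z‖ ^ 2) := by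
  have h1 : ‖z‖ ≤ Real.exp (1 / 2 * ‖z‖ ^ 2) := by
    have := Real.add_one_le_exp (1 / 2 * ‖z‖ ^ 2)
    nlinarith [sq_nonneg (‖z‖ - 1)]
  calc ‖z‖ * gauss z ≤ Real.exp (1 / 2 * ‖z‖ ^ 2) * gauss z := by
        gcongr; exact (gauss_pos z).le
    _ = _ := by rw [gauss, ← Real.exp_add]; congr 1; ring

theorem integrable_norm_mul_gauss : Integrable fun z => ‖z‖ * gauss z := by
  refine (integrable_exp_neg_mul_sq (b := 1 / 2) (by norm_num)).mono'
    (continuous_norm.mul continuous_gauss).aestronglyMeasurable (Eventually.of_forall fun z => ?_)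
  rw [Real.norm_of_nonneg (by have := gauss_pos z; positivity)]
  exact norm_mul_gauss_le z

theorem integrable_inner_mul_gauss (v : R3) : Integrable fun z => inner ℝ v z * gauss z := by
  refine (integrable_norm_mul_gauss.const_mul ‖v‖).mono'
    ((continuous_const.inner continuous_id).mul continuous_gauss).aestronglyMeasurable
    (Eventually.of_forall fun z => ?_)
  rw [norm_mul, Real.norm_of_nonneg (gauss_pos z).le, ← mul_assoc]
  gcongr
  · exact (gauss_pos z).le
  · exact norm_inner_le_norm v z

theorem hasLineDerivAt_gauss (z v : R3) :
    HasLineDerivAt ℝ gauss (-2 * (inner ℝ v z * gauss z)) z v := by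
  have h1 : HasDerivAt (fun t : ℝ => z + t • v) v 0 := by
    simpa using ((hasDerivAt_id (0 : ℝ)).smul_const v).const_add z
  have h2 := (h1.norm_sq.neg).exp
  unfold HasLineDerivAt gauss
  refine h2.congr_deriv ?_
  simp only [Pi.neg_apply, zero_smul, add_zero, real_inner_comm z v]
  ring

theorem hasLineDerivAt_shift {f g : L2Field} {v : R3} (h : IsWeakDeriv v f g) (δ : ℝ) (z : R3) :
    HasLineDerivAt ℝ (fun z => shift (δ • z) f) (δ • shift (δ • z) g) z v := by
  have h1 : HasDerivAt (fun t : ℝ => shift ((δ * t) • v) f) (δ • g) 0 := by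
    have := HasDerivAt.scomp (0 : ℝ) (g₁ := fun r : ℝ => shift (r • v) f) (h := fun t => δ * t)
      (h' := δ) (by simpa using h.hasDerivAt_zero) (by simpa using (hasDerivAt_id (0 : ℝ)).const_mul δ)
    simpa [Function.comp_def] using this
  have h2 := (shift (δ • z)).toContinuousLinearMap.hasFDerivAt.comp_hasDerivAt (0 : ℝ) h1
  unfold HasLineDerivAt
  convert h2 using 1
  · funext t
    simp [shift_shift, smul_add, smul_smul]
  · simp

/-- Integration by parts in `z`: `-2⟨v, z⟩ exp(-‖z‖²)` is the derivative of the Gaussian along `v`,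
and differentiating `f(x + δ z)` in `z` brings out one factor `δ`. -/
theorem avg_inner_mul_gauss {f g : L2Field} {v : R3} (h : IsWeakDeriv v f g) (δ : ℝ) :
    avg (fun z => inner ℝ v z * gauss z) δ f = (δ / 2) • avg gauss δ g := by
  have hk := integrable_inner_mul_gauss v
  have := integral_bilinear_hasLineDerivAt_right_eq_neg_left_of_integrable (μ := volume)
    (f := gauss) (f' := fun z => -2 * (inner ℝ v z * gauss z)) (v := v)
    (g := fun z => shift (δ • z) f) (g' := fun z => δ • shift (δ • z) g)
    (B := ContinuousLinearMap.lsmul ℝ ℝ)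
    (by simpa using integrable_smul_shift (hk.const_mul (-2)) δ f)
    (by simpa [smul_comm _ δ, Pi.smul_def] using (integrable_smul_shift integrable_gauss δ g).smul δ)
    (by simpa using integrable_smul_shift integrable_gauss δ f)
    (fun z _ => hasLineDerivAt_gauss z v) (fun z _ => hasLineDerivAt_shift h δ z)
  simp only [ContinuousLinearMap.lsmul_apply, smul_comm _ δ, mul_smul] at this
  rw [integral_smul, integral_smul] at this
  simp only [← mul_smul] at this
  change δ • avg gauss δ g = -((-2 : ℝ) • avg _ δ f) at this
  rw [div_eq_inv_mul, mul_smul, this]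
  simp [smul_smul]

/-- Gaussian averages are weakly differentiable. -/
theorem isWeakDeriv_avg_gauss {δ : ℝ} (hδ : δ ≠ 0) (f : L2Field) (v : R3) :
    IsWeakDeriv v (avg gauss δ f) ((2 / δ) • avg (fun z => inner ℝ v z * gauss z) δ f) := by
  intro φ hφ
  have hk := integrable_inner_mul_gauss v
  -- The integration by parts of `avg_inner_mul_gauss` read backwards, after pairing with `φ`: the
  -- derivative lands on the kernel, so `f` may be any field in `L²`.
  have hline : ∀ z, HasLineDerivAt ℝ (fun z => pair φ hφ (shift (δ • z) f))
      (-(δ • pair _ (hφ.fderiv v) (shift (δ • z) f))) z v := by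
    intro z
    obtain ⟨D, hD, hD'⟩ := hasFDerivAt_pair_shift hφ f (δ • z)
    have h1 : HasFDerivAt (fun z : R3 => δ • z) (δ • ContinuousLinearMap.id ℝ R3) z :=
      (hasFDerivAt_id z).const_smul δ
    have h2 := (HasFDerivAt.comp (g := fun y => pair φ hφ (shift y f)) z hD h1).hasLineDerivAt v
    simpa [hD', Function.comp_def] using h2
  have hint : ∀ {k : R3 → ℝ}, Integrable k → ∀ L : L2Field →L[ℝ] R3,
      Integrable fun z => k z • L (shift (δ • z) f) := fun hk L => by
    simpa using L.integrable_comp (integrable_smul_shift hk δ f)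
  have := integral_bilinear_hasLineDerivAt_right_eq_neg_left_of_integrable (μ := volume)
    (f := gauss) (f' := fun z => -2 * (inner ℝ v z * gauss z)) (v := v)
    (g := fun z => pair φ hφ (shift (δ • z) f))
    (g' := fun z => -(δ • pair _ (hφ.fderiv v) (shift (δ • z) f)))
    (B := ContinuousLinearMap.lsmul ℝ ℝ)
    (by simpa using hint (hk.const_mul (-2)) _)
    (by simpa [smul_comm _ δ, Pi.smul_def] using
      ((hint integrable_gauss (pair _ (hφ.fderiv v))).smul δ).neg)
    (by simpa using hint integrable_gauss _)
    (fun z _ => hasLineDerivAt_gauss z v) (fun z _ => hline z)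
  simp only [ContinuousLinearMap.lsmul_apply, smul_neg, smul_comm _ δ, mul_smul] at this
  rw [integral_neg, integral_smul, integral_smul] at this
  simp only [← mul_smul] at this
  rw [← clm_avg _ integrable_gauss, ← clm_avg _ hk] at this
  rw [map_smul, div_eq_inv_mul, mul_smul, ← smul_neg, ← smul_right_injective _ hδ |>.eq_iff,
    smul_smul, mul_inv_cancel₀ hδ, one_smul]
  have h2 := neg_injective this
  rw [h2]
  simp

/-- A form of the heat equation. Differentiating in `δ` produces `∑ zᵢ ∂ᵢf(x + δ z)`, and
`avg_inner_mul_gauss` trades each weight `zᵢ` for a further derivative `∂ᵢ` and a factor `δ/2`. Only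
the pure second derivatives occur. -/
theorem hasDerivAt_avg_gauss {f : L2Field} {d : Fin 3 → L2Field} {e : Fin 3 → L2Field}
    (hd : ∀ i, IsWeakDeriv (basisVec i) f (d i))
    (he : ∀ i, IsWeakDeriv (basisVec i) (d i) (e i)) (δ : ℝ) :
    HasDerivAt (fun δ => avg gauss δ f) ((δ / 2) • avg gauss δ (∑ i, e i)) δ := by
  have hnorm : ∀ (δ : ℝ) (z : R3), ‖gauss z • shift (δ • z) (∑ i, z i • d i)‖ ≤
      (‖z‖ * gauss z) * ∑ i, ‖d i‖ := by
    intro δ z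
    rw [norm_smul, Real.norm_of_nonneg (gauss_pos z).le, LinearIsometry.norm_map, mul_comm ‖z‖,
      mul_assoc, Finset.mul_sum]
    refine mul_le_mul_of_nonneg_left ?_ (gauss_pos z).le
    refine (norm_sum_le _ _).trans (Finset.sum_le_sum fun i _ => ?_)
    rw [norm_smul]
    gcongr
    exact PiLp.norm_apply_le z i
  have hcont : ∀ δ : ℝ, Continuous fun z : R3 => gauss z • shift (δ • z) (∑ i, z i • d i) := by
    intro δ
    simp only [map_sum, map_smul]
    refine continuous_gauss.smul (continuous_finsetSum _ fun i _ => ?_)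
    have hz : Continuous fun z : R3 => z i := by fun_prop
    exact hz.smul (continuous_shift_smul δ (d i))
  have h := (hasDerivAt_integral_of_dominated_loc_of_deriv_le (μ := (volume : Measure R3))
    (F := fun δ z => gauss z • shift (δ • z) f)
    (F' := fun δ z => gauss z • shift (δ • z) (∑ i, z i • d i))
    (bound := fun z => (‖z‖ * gauss z) * ∑ i, ‖d i‖) (x₀ := δ) univ_mem
    (Eventually.of_forall fun δ => (integrable_smul_shift integrable_gauss δ f).1)
    (integrable_smul_shift integrable_gauss δ f) (hcont δ).aestronglyMeasurable
    (Eventually.of_forall fun z δ _ => hnorm δ z)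
    (integrable_norm_mul_gauss.mul_const _)
    (Eventually.of_forall fun z δ _ =>
      ((IsWeakDeriv.of_partials hd z).hasDerivAt δ).const_smul (gauss z))).2
  refine HasDerivAt.congr_deriv h ?_
  have hi : ∀ i, Integrable fun z : R3 => gauss z • shift (δ • z) (z i • d i) := by
    intro i
    have := integrable_smul_shift (integrable_inner_mul_gauss (basisVec i)) δ (d i)
    refine this.congr (Eventually.of_forall fun z => ?_)
    simp [basisVec, EuclideanSpace.inner_single_left, smul_smul, mul_comm]
  simp only [map_sum, Finset.smul_sum]
  rw [integral_finsetSum _ fun i _ => hi i]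
  have : ∀ i, ∫ z : R3, gauss z • shift (δ • z) (z i • d i) = (δ / 2) • avg gauss δ (e i) := by
    intro i
    rw [← avg_inner_mul_gauss (he i), avg]
    refine integral_congr_ae (Eventually.of_forall fun z => ?_)
    simp [basisVec, EuclideanSpace.inner_single_left, smul_smul, mul_comm]
  rw [Finset.sum_congr rfl fun i _ => this i, ← Finset.smul_sum]
  congr 1
  simp only [avg, map_sum, Finset.smul_sum]
  rw [integral_finsetSum _ fun i _ => integrable_smul_shift integrable_gauss δ (e i)]

/-! ### The embedding of H² in L^∞, a Liouville theorem and approximation by averages -/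

theorem avg_zero (k : R3 → ℝ) (f : L2Field) : avg k 0 f = (∫ z, k z) • f := by
  simp [avg, shift_zero, integral_smul_const]

/-- The constant of the Sobolev embedding `H² ⊂ L^∞`. -/
def sobConst : ℝ := gaussMass⁻¹ * (eLpNorm gauss 2 volume).toReal

theorem sobConst_nonneg : 0 ≤ sobConst :=
  mul_nonneg (inv_nonneg.2 gaussMass_pos.le) ENNReal.toReal_nonneg

/-- The Sobolev embedding `H²(ℝ³) ⊂ L^∞(ℝ³)`. -/
theorem essBdd_of_laplacian {f : L2Field} {d : Fin 3 → L2Field} {e : Fin 3 → L2Field}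
    (hd : ∀ i, IsWeakDeriv (basisVec i) f (d i))
    (he : ∀ i, IsWeakDeriv (basisVec i) (d i) (e i)) :
    EssBdd f (sobConst * (‖f‖ + ‖∑ i, e i‖)) := by
  have hs := sobConst_nonneg
  refine essBdd_of_inner_le (by positivity) fun ψ hψ => ?_
  set N := (eLpNorm gauss 2 volume).toReal with hN
  have hN0 : 0 ≤ N := ENNReal.toReal_nonneg
  set I := ∫ x, ‖ψ x‖ with hI
  have hI0 : 0 ≤ I := integral_nonneg fun _ => norm_nonneg _
  set Δ := ∑ i, e i with hΔ
  set q : ℝ → ℝ := fun δ => inner ℝ (avg gauss δ f) ψ with hq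
  have hq' : ∀ δ, HasDerivAt q (δ / 2 * inner ℝ (avg gauss δ Δ) ψ) δ := fun δ => by
    have := (hasDerivAt_avg_gauss hd he δ).inner ℝ (hasDerivAt_const δ ψ)
    simpa [real_inner_smul_left] using this
  -- The bound `δ^(-3/2)` on the average times `δ/2` is the derivative of a multiple of `√δ`, hence
  -- integrable at `0`: this is why two derivatives suffice in dimension three. Integrating `q'`
  -- compares `δ = 0`, where `q` is a multiple of `⟨f, ψ⟩`, with `δ = 1`, where only `‖f‖` is
  -- needed.
  have hbound : ∀ δ : ℝ, 0 < δ → |δ / 2 * inner ℝ (avg gauss δ Δ) ψ| ≤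
      (N * ‖Δ‖ * I) * (1 / (2 * Real.sqrt δ)) := by
    intro δ hδ
    have h1 := abs_inner_avg_le integrable_gauss memLp_gauss hδ Δ hψ
    have hsq : Real.sqrt (δ ^ 3) = δ * Real.sqrt δ := by
      rw [show δ ^ 3 = δ ^ 2 * δ by ring, Real.sqrt_mul (by positivity), Real.sqrt_sq hδ.le]
    rw [hsq] at h1
    have hsp : 0 < Real.sqrt δ := Real.sqrt_pos.2 hδ
    rw [abs_mul, abs_of_pos (by positivity)]
    calc δ / 2 * |inner ℝ (avg gauss δ Δ) ψ|
        ≤ δ / 2 * (N * (δ * Real.sqrt δ)⁻¹ * ‖Δ‖ * I) := by gcongr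
      _ = _ := by field_simp
  have h01 : ∀ s : ℝ, 0 < s → s < 1 → ‖q 1 - q s‖ ≤ N * ‖Δ‖ * I := by
    intro s hs0 hs1
    have := image_norm_le_of_norm_deriv_right_le_deriv_boundary' (a := s) (b := 1)
      (f := fun x => q x - q s) (f' := fun δ => δ / 2 * inner ℝ (avg gauss δ Δ) ψ)
      (B := fun x => (N * ‖Δ‖ * I) * (Real.sqrt x - Real.sqrt s))
      (B' := fun δ => (N * ‖Δ‖ * I) * (1 / (2 * Real.sqrt δ)))
      (fun x _ => ((hq' x).continuousAt.sub continuousAt_const).continuousWithinAt)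
      (fun x _ => ((hq' x).sub_const _).hasDerivWithinAt) (by simp) (by fun_prop)
      (fun x hx => (((Real.hasDerivAt_sqrt (hs0.trans_le hx.1).ne').sub_const _).const_mul
        _).hasDerivWithinAt)
      (fun x hx => hbound x (hs0.trans_le hx.1)) (right_mem_Icc.2 hs1.le)
    refine this.trans ?_
    have : Real.sqrt 1 - Real.sqrt s ≤ 1 := by simp [Real.sqrt_nonneg]
    exact mul_le_of_le_one_right (by positivity) this
  have hlim : ‖q 1 - q 0‖ ≤ N * ‖Δ‖ * I := by
    have hc : Tendsto (fun s => ‖q 1 - q s‖) (𝓝[>] 0) (𝓝 ‖q 1 - q 0‖) :=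
      ((continuousAt_const.sub (hq' 0).continuousAt).norm.tendsto).mono_left nhdsWithin_le_nhds
    refine le_of_tendsto hc ?_
    filter_upwards [Ioo_mem_nhdsGT (zero_lt_one' ℝ)] with s hs
    exact h01 s hs.1 hs.2
  have h1 : |q 1| ≤ N * ‖f‖ * I := by
    simpa using abs_inner_avg_le integrable_gauss memLp_gauss one_pos f hψ
  have h0 : q 0 = gaussMass * inner ℝ f ψ := by
    simp only [hq, avg_zero, real_inner_smul_left]; rfl
  have h2 : gaussMass * inner ℝ f ψ ≤ N * (‖f‖ + ‖Δ‖) * I := by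
    rw [← h0]
    rw [Real.norm_eq_abs, abs_le] at hlim
    rw [abs_le] at h1
    linarith [hlim.1, h1.2]
  have hm := gaussMass_pos
  calc inner ℝ f ψ = gaussMass⁻¹ * (gaussMass * inner ℝ f ψ) := by field_simp
    _ ≤ gaussMass⁻¹ * (N * (‖f‖ + ‖Δ‖) * I) := by gcongr
    _ = _ := by rw [sobConst]; ring

/-- A translation invariant square integrable field vanishes. -/
theorem eq_zero_of_weakDeriv_zero {f : L2Field} (h : ∀ i, IsWeakDeriv (basisVec i) f 0) :
    f = 0 := by
  have hinv : ∀ y, shift y f = f := by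
    intro y
    have h1 : IsWeakDeriv y f 0 := by simpa using IsWeakDeriv.of_partials h y
    have := h1.norm_shift_sub_le 1
    rw [one_smul, norm_zero, mul_zero] at this
    exact sub_eq_zero.1 (norm_le_zero_iff.1 this)
  have havg : ∀ δ, avg gauss δ f = gaussMass • f := fun δ => by
    simp [avg, hinv, integral_smul_const, gaussMass]
  have hm := gaussMass_pos
  have hb : EssBdd f 0 := by
    refine essBdd_of_inner_le le_rfl fun ψ hψ => ?_
    -- For a translation invariant field the average does not depend on `δ`, whereas its bound
    -- decays like `δ^(-3/2)`; let `δ = n + 1` tend to infinity.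
    have hδ : ∀ n : ℕ, gaussMass * |inner ℝ f ψ| ≤
        ((eLpNorm gauss 2 volume).toReal * ‖f‖ * ∫ x, ‖ψ x‖) *
          (Real.sqrt (((n : ℝ) + 1) ^ 3))⁻¹ := by
      intro n
      have := abs_inner_avg_le integrable_gauss memLp_gauss (δ := (n : ℝ) + 1) (by positivity) f hψ
      rw [havg, real_inner_smul_left, abs_mul, abs_of_pos hm] at this
      linarith
    have hlim : Tendsto (fun n : ℕ => ((eLpNorm gauss 2 volume).toReal * ‖f‖ * ∫ x, ‖ψ x‖) *
          (Real.sqrt (((n : ℝ) + 1) ^ 3))⁻¹) atTop (𝓝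
          (((eLpNorm gauss 2 volume).toReal * ‖f‖ * ∫ x, ‖ψ x‖) * 0)) := by
      refine Tendsto.const_mul _ (Tendsto.inv_tendsto_atTop ?_)
      refine Real.tendsto_sqrt_atTop.comp ((tendsto_pow_atTop (by norm_num)).comp ?_)
      exact tendsto_atTop_add_const_right _ _ tendsto_natCast_atTop_atTop
    have h3 := ge_of_tendsto' hlim hδ
    rw [mul_zero] at h3
    have h4 : |inner ℝ f ψ| ≤ 0 := by
      by_contra hcon
      have := mul_pos hm (not_le.1 hcon)
      linarith
    simpa using (le_abs_self _).trans h4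
  apply Lp.ext
  filter_upwards [hb, Lp.coeFn_zero R3 2 (volume : Measure R3)] with x hx h0
  rw [h0]
  simpa using hx

/-- The error is linear in `δ` with a constant depending only on first derivatives, so one `δ`
serves a whole bounded subset of `H¹`. -/
theorem norm_avg_gauss_sub_le {f : L2Field} {d : Fin 3 → L2Field}
    (hd : ∀ i, IsWeakDeriv (basisVec i) f (d i)) {δ : ℝ} (hδ : 0 ≤ δ) :
    ‖avg gauss δ f - gaussMass • f‖ ≤ δ * (∫ z, ‖z‖ * gauss z) * ∑ i, ‖d i‖ := by
  have h1 : avg gauss δ f - gaussMass • f = ∫ z, gauss z • (shift (δ • z) f - f) := by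
    simp only [smul_sub]
    rw [integral_sub (integrable_smul_shift integrable_gauss δ f)
      (integrable_gauss.smul_const f), integral_smul_const]
    rfl
  rw [h1, mul_assoc, ← integral_mul_const, ← integral_const_mul]
  refine norm_integral_le_of_norm_le ((integrable_norm_mul_gauss.mul_const _).const_mul δ)
    (Eventually.of_forall fun z => ?_)
  have h2 := (IsWeakDeriv.of_partials hd z).norm_shift_sub_le δ
  have h3 : ‖∑ i, z i • d i‖ ≤ ‖z‖ * ∑ i, ‖d i‖ := by
    rw [Finset.mul_sum]
    refine (norm_sum_le _ _).trans (Finset.sum_le_sum fun i _ => ?_)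
    rw [norm_smul]
    gcongr
    exact PiLp.norm_apply_le z i
  rw [norm_smul, Real.norm_of_nonneg (gauss_pos z).le]
  rw [abs_of_nonneg hδ] at h2
  calc gauss z * ‖shift (δ • z) f - f‖ ≤ gauss z * (δ * (‖z‖ * ∑ i, ‖d i‖)) := by
        refine mul_le_mul_of_nonneg_left (h2.trans ?_) (gauss_pos z).le
        gcongr
    _ = _ := by ring

theorem tendsto_avg_gauss (f : L2Field) :
    Tendsto (fun δ => avg gauss δ f) (𝓝 0) (𝓝 (gaussMass • f)) := by
  rw [show gaussMass • f = avg gauss 0 f from (avg_zero gauss f).symm]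
  refine tendsto_integral_filter_of_dominated_convergence (fun z => gauss z * ‖f‖)
    (Eventually.of_forall fun δ => (integrable_smul_shift integrable_gauss δ f).1)
    (Eventually.of_forall fun δ => Eventually.of_forall fun z => by
      simp [norm_smul, abs_of_pos (gauss_pos z)])
    (integrable_gauss.mul_const _) (Eventually.of_forall fun z => ?_)
  have : Continuous fun δ : ℝ => gauss z • shift (δ • z) f :=
    ((continuous_shift f).comp (by fun_prop)).const_smul (gauss z)
  exact this.tendsto 0

theorem essBdd_avg_gauss {δ : ℝ} (hδ : 0 < δ) (f : L2Field) :
    EssBdd (avg gauss δ f) ((eLpNorm gauss 2 volume).toReal * (Real.sqrt (δ ^ 3))⁻¹ * ‖f‖) :=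
  essBdd_of_inner_le (by positivity) fun _ hψ =>
    (le_abs_self _).trans (abs_inner_avg_le integrable_gauss memLp_gauss hδ f hψ)

/-! ### The Sobolev scale -/

theorem weakPartial_eq {i : Fin 3} {f g : L2Field} (h : IsWeakDeriv (basisVec i) f g) :
    weakPartial i f = g := by
  have hex : ∃ g, IsWeakPartial i f g := ⟨g, isWeakPartial_iff.2 h⟩
  rw [weakPartial, dif_pos hex]
  exact (isWeakPartial_iff.1 hex.choose_spec).unique h

theorem MemH.isWeakDeriv {m : ℕ} {f : L2Field} (h : MemH (m + 1) f) (i : Fin 3) :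
    IsWeakDeriv (basisVec i) f (weakPartial i f) := by
  obtain ⟨g, hg, -⟩ := h i
  rw [isWeakPartial_iff] at hg
  rwa [weakPartial_eq hg]

theorem MemH.weakPartial {m : ℕ} {f : L2Field} (h : MemH (m + 1) f) (i : Fin 3) :
    MemH m (weakPartial i f) := by
  obtain ⟨g, hg, hg'⟩ := h i
  rwa [weakPartial_eq (isWeakPartial_iff.1 hg)]

theorem memH_succ_of {m : ℕ} {f : L2Field} {d : Fin 3 → L2Field}
    (h : ∀ i, IsWeakDeriv (basisVec i) f (d i)) (h' : ∀ i, MemH m (d i)) : MemH (m + 1) f :=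
  fun i => ⟨d i, isWeakPartial_iff.2 (h i), h' i⟩

theorem MemH.of_succ {m : ℕ} {f : L2Field} (h : MemH (m + 1) f) : MemH m f := by
  induction m generalizing f with
  | zero => trivial
  | succ m ih => exact memH_succ_of h.isWeakDeriv fun i => ih (h.weakPartial i)

theorem MemH.mono {m n : ℕ} {f : L2Field} (h : MemH n f) (hmn : m ≤ n) : MemH m f := by
  induction n, hmn using Nat.le_induction with
  | base => exact h
  | succ n _ ih => exact ih h.of_succ

theorem MemH.sub {m : ℕ} {f g : L2Field} (hf : MemH m f) (hg : MemH m g) : MemH m (f - g) := by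
  induction m generalizing f g with
  | zero => trivial
  | succ m ih =>
    exact memH_succ_of (fun i => (hf.isWeakDeriv i).sub (hg.isWeakDeriv i))
      fun i => ih (hf.weakPartial i) (hg.weakPartial i)

theorem MemH.add {m : ℕ} {f g : L2Field} (hf : MemH m f) (hg : MemH m g) : MemH m (f + g) := by
  induction m generalizing f g with
  | zero => trivial
  | succ m ih =>
    exact memH_succ_of (fun i => (hf.isWeakDeriv i).add (hg.isWeakDeriv i))
      fun i => ih (hf.weakPartial i) (hg.weakPartial i)

theorem MemH.smul {m : ℕ} {f : L2Field} (hf : MemH m f) (a : ℝ) : MemH m (a • f) := by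
  induction m generalizing f with
  | zero => trivial
  | succ m ih =>
    exact memH_succ_of (fun i => (hf.isWeakDeriv i).smul a) fun i => ih (hf.weakPartial i)

theorem weakPartial_sub {f g : L2Field} (hf : MemH 1 f) (hg : MemH 1 g) (i : Fin 3) :
    weakPartial i (f - g) = weakPartial i f - weakPartial i g :=
  weakPartial_eq ((hf.isWeakDeriv i).sub (hg.isWeakDeriv i))

theorem weakPartial_smul {f : L2Field} (hf : MemH 1 f) (a : ℝ) (i : Fin 3) :
    weakPartial i (a • f) = a • weakPartial i f :=
  weakPartial_eq ((hf.isWeakDeriv i).smul a)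

theorem sobolevNormSq_nonneg (m : ℕ) (f : L2Field) : 0 ≤ sobolevNormSq m f := by
  induction m generalizing f with
  | zero => exact sq_nonneg _
  | succ m ih => exact add_nonneg (sq_nonneg _) (Finset.sum_nonneg fun i _ => ih _)

theorem sobolevNorm_nonneg (m : ℕ) (f : L2Field) : 0 ≤ sobolevNorm m f := Real.sqrt_nonneg _

theorem sobolevNormSq_le_succ (m : ℕ) (f : L2Field) :
    sobolevNormSq m f ≤ sobolevNormSq (m + 1) f := by
  induction m generalizing f with
  | zero => exact le_add_of_nonneg_right (Finset.sum_nonneg fun i _ => sobolevNormSq_nonneg _ _)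
  | succ m ih => exact add_le_add le_rfl (Finset.sum_le_sum fun i _ => ih _)

theorem sobolevNorm_mono {m n : ℕ} (hmn : m ≤ n) (f : L2Field) :
    sobolevNorm m f ≤ sobolevNorm n f := by
  refine Real.sqrt_le_sqrt ?_
  induction n, hmn using Nat.le_induction with
  | base => exact le_rfl
  | succ n _ ih => exact ih.trans (sobolevNormSq_le_succ n f)

theorem norm_le_sobolevNorm (m : ℕ) (f : L2Field) : ‖f‖ ≤ sobolevNorm m f := by
  refine le_trans ?_ (sobolevNorm_mono (Nat.zero_le m) f)
  simp [sobolevNorm, sobolevNormSq]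

theorem sobolevNorm_weakPartial_le (m : ℕ) (i : Fin 3) (f : L2Field) :
    sobolevNorm m (weakPartial i f) ≤ sobolevNorm (m + 1) f := by
  refine Real.sqrt_le_sqrt ?_
  change _ ≤ ‖f‖ ^ 2 + ∑ i, sobolevNormSq m (weakPartial i f)
  have := Finset.single_le_sum (f := fun i => sobolevNormSq m (weakPartial i f))
    (fun i _ => sobolevNormSq_nonneg m _) (Finset.mem_univ i)
  nlinarith [sq_nonneg ‖f‖]

theorem norm_weakPartial_le (i : Fin 3) (f : L2Field) :
    ‖weakPartial i f‖ ≤ sobolevNorm 1 f :=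
  (norm_le_sobolevNorm 0 _).trans (sobolevNorm_weakPartial_le 0 i f)

theorem norm_weakPartial_weakPartial_le (i j : Fin 3) (f : L2Field) :
    ‖weakPartial i (weakPartial j f)‖ ≤ sobolevNorm 2 f :=
  (norm_weakPartial_le i _).trans (sobolevNorm_weakPartial_le 1 j f)

/-- The constant of the embedding `H² ⊂ L^∞` in terms of the Sobolev norm. -/
def embConst : ℝ := 4 * sobConst

theorem embConst_nonneg : 0 ≤ embConst := mul_nonneg (by norm_num) sobConst_nonneg

theorem MemH.essBdd {f : L2Field} (h : MemH 2 f) : EssBdd f (embConst * sobolevNorm 2 f) := by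
  refine (essBdd_of_laplacian h.isWeakDeriv fun i => (h.weakPartial i).isWeakDeriv i).mono ?_
  rw [embConst, mul_comm 4, mul_assoc]
  refine mul_le_mul_of_nonneg_left ?_ sobConst_nonneg
  have h1 := norm_le_sobolevNorm 2 f
  have h2 : ‖∑ i, EulerMaxwell.weakPartial i (EulerMaxwell.weakPartial i f)‖ ≤
      ∑ _i : Fin 3, sobolevNorm 2 f :=
    (norm_sum_le _ _).trans (Finset.sum_le_sum fun i _ => norm_weakPartial_weakPartial_le i i f)
  simp at h2
  linarith

theorem MemH.essBdd_of_le {f : L2Field} {K : ℝ} (h : MemH 2 f) (hK : sobolevNorm 2 f ≤ K) :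
    EssBdd f (embConst * K) :=
  h.essBdd.mono (mul_le_mul_of_nonneg_left hK embConst_nonneg)

/-! ### Pointwise linear maps and products -/

/-- Composition of a field with a linear map of the values. -/
def mapField (L : R3 →L[ℝ] R3) : L2Field →L[ℝ] L2Field := L.compLpL 2 volume

theorem coeFn_mapField (L : R3 →L[ℝ] R3) (f : L2Field) :
    mapField L f =ᵐ[volume] fun x => L (f x) := L.coeFn_compLpL f

theorem pair_mapField (L : R3 →L[ℝ] R3) {φ : R3 → ℝ} (hφ : IsTest φ) (f : L2Field) :
    pair φ hφ (mapField L f) = L (pair φ hφ f) := by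
  rw [pair_apply, pair_apply, ← L.integral_comp_comm]
  · refine integral_congr_ae ?_
    filter_upwards [coeFn_mapField L f] with x hx
    simp [hx]
  · exact memLp_one_iff_integrable.1 ((Lp.memLp f).smul (hφ.memLp 2))

theorem IsWeakDeriv.mapField {v : R3} {f g : L2Field} (h : IsWeakDeriv v f g)
    (L : R3 →L[ℝ] R3) : IsWeakDeriv v (mapField L f) (mapField L g) := fun φ hφ => by
  rw [pair_mapField, pair_mapField, h φ hφ, map_neg]

theorem toL2_eq {F : R3 → R3} {f : L2Field} (h : f =ᵐ[volume] F) : toL2 F = f := by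
  have hF : MemLp F 2 volume := (memLp_congr_ae h).1 (Lp.memLp f)
  rw [toL2, dif_pos hF]
  exact Lp.ext (hF.coeFn_toLp.trans h.symm)

theorem coeFn_toL2 {F : R3 → R3} (h : MemLp F 2 volume) : toL2 F =ᵐ[volume] F := by
  rw [toL2, dif_pos h]
  exact h.coeFn_toLp

section mulField

variable (β : R3 →L[ℝ] R3 →L[ℝ] R3) {f g f' g' h : L2Field} {v : R3} {C : ℝ}

/-- The pointwise product of two fields with respect to a bilinear map of the values. -/
def mulField (f g : L2Field) : L2Field := toL2 fun x => β (f x) (g x)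

/-- The pointwise product of the fields is square integrable. -/
def MulMem (f g : L2Field) : Prop := MemLp (fun x => β (f x) (g x)) 2 volume

variable {β}

theorem EssBdd.mulMem_left (hf : EssBdd f C) (g : L2Field) : MulMem β f g :=
  ContinuousLinearMap.memLp_of_bilin (p := ∞) (q := 2) 2 β
    (memLp_top_of_bound (Lp.memLp f).1 C hf) (Lp.memLp g)

theorem EssBdd.mulMem_right (hg : EssBdd g C) (f : L2Field) : MulMem β f g :=
  ContinuousLinearMap.memLp_of_bilin (p := 2) (q := ∞) 2 β
    (Lp.memLp f) (memLp_top_of_bound (Lp.memLp g).1 C hg)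

theorem MulMem.coeFn (h : MulMem β f g) : mulField β f g =ᵐ[volume] fun x => β (f x) (g x) :=
  coeFn_toL2 h

theorem norm_mulField_le_left (hβ : ∀ a b, ‖β a b‖ ≤ ‖a‖ * ‖b‖) (hf : EssBdd f C) (g : L2Field) :
    ‖mulField β f g‖ ≤ C * ‖g‖ := by
  have hm : MulMem β f g := hf.mulMem_left g
  refine Lp.norm_le_mul_norm_of_ae_le_mul ?_
  filter_upwards [hm.coeFn, hf] with x hx hfx
  rw [hx]
  exact (hβ _ _).trans (mul_le_mul_of_nonneg_right hfx (norm_nonneg _))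

theorem norm_mulField_le_right (hβ : ∀ a b, ‖β a b‖ ≤ ‖a‖ * ‖b‖) (hg : EssBdd g C) (f : L2Field) :
    ‖mulField β f g‖ ≤ C * ‖f‖ := by
  have hm : MulMem β f g := hg.mulMem_right f
  refine Lp.norm_le_mul_norm_of_ae_le_mul ?_
  filter_upwards [hm.coeFn, hg] with x hx hgx
  rw [hx, mul_comm C]
  exact (hβ _ _).trans (mul_le_mul_of_nonneg_left hgx (norm_nonneg _))

/-- Each product must be known to be square integrable: `toL2` returns `0` otherwise, and additivity
would fail. -/
theorem mulField_sub_left (h1 : MulMem β f h) (h2 : MulMem β g h) :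
    mulField β (f - g) h = mulField β f h - mulField β g h := by
  refine toL2_eq ?_
  filter_upwards [h1.coeFn, h2.coeFn, Lp.coeFn_sub f g,
    Lp.coeFn_sub (mulField β f h) (mulField β g h)] with x e1 e2 e3 e4
  rw [e4, Pi.sub_apply, e1, e2, e3]
  simp

theorem mulField_sub_right (h1 : MulMem β h f) (h2 : MulMem β h g) :
    mulField β h (f - g) = mulField β h f - mulField β h g := by
  refine toL2_eq ?_
  filter_upwards [h1.coeFn, h2.coeFn, Lp.coeFn_sub f g,
    Lp.coeFn_sub (mulField β h f) (mulField β h g)] with x e1 e2 e3 e4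
  rw [e4, Pi.sub_apply, e1, e2, e3]
  simp

theorem mulField_smul_left (a : ℝ) (h1 : MulMem β f h) :
    mulField β (a • f) h = a • mulField β f h := by
  refine toL2_eq ?_
  filter_upwards [h1.coeFn, Lp.coeFn_smul a f, Lp.coeFn_smul a (mulField β f h)] with x e1 e3 e4
  rw [e4, Pi.smul_apply, e1, e3]
  simp

theorem mulField_shift (h1 : MulMem β f g) (y : R3) :
    mulField β (shift y f) (shift y g) = shift y (mulField β f g) := by
  refine toL2_eq ?_
  have h2 := (measurePreserving_add_right volume y).quasiMeasurePreserving.ae h1.coeFn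
  filter_upwards [coeFn_shift y f, coeFn_shift y g, coeFn_shift y (mulField β f g), h2]
    with x e1 e2 e3 e4
  rw [e1, e2, e3, e4]

/-- The product rule. -/
theorem IsWeakDeriv.mulField (hf : IsWeakDeriv v f f') (hg : IsWeakDeriv v g g')
    (h0 : MulMem β f g) (h1 : MulMem β f' g) (h2 : MulMem β f g') :
    IsWeakDeriv v (mulField β f g) (mulField β f' g + mulField β f g') := by
  refine IsWeakDeriv.of_hasDerivAt fun φ hφ => ?_
  -- The product as a bounded bilinear map from `L² × L²` to `L¹`. It can be differentiated along
  -- translations there, and `of_hasDerivAt` needs nothing stronger.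
  set H := β.holderL (volume : Measure R3) 2 2 1
  set L : Lp R3 1 (volume : Measure R3) →L[ℝ] R3 :=
    (ContinuousLinearMap.lsmul ℝ ℝ : ℝ →L[ℝ] R3 →L[ℝ] R3).lpPairing volume ∞ 1
      ((hφ.memLp ∞).toLp φ) with hL
  have key : ∀ {F G : L2Field}, MulMem β F G →
      pair φ hφ (EulerMaxwell.mulField β F G) = L (H F G) := by
    intro F G hFG
    rw [pair_apply, hL, ContinuousLinearMap.lpPairing_eq_integral]
    refine integral_congr_ae (μ := volume) ?_
    filter_upwards [hFG.coeFn, (hφ.memLp ∞).coeFn_toLp, β.coeFn_holder (r := 1) F G]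
      with x e1 e2 e3
    rw [e1, e2]
    rw [← e3]
    rfl
  have hd1 : HasDerivAt (fun r : ℝ => H (EulerMaxwell.shift (r • v) f)) (H f') 0 :=
    H.hasFDerivAt.comp_hasDerivAt (0 : ℝ) hf.hasDerivAt_zero
  have hd2 := L.hasFDerivAt.comp_hasDerivAt (0 : ℝ) (hd1.clm_apply hg.hasDerivAt_zero)
  simp only [zero_smul, shift_zero, map_add] at hd2
  rw [map_add, key h1, key h2]
  refine hd2.congr_of_eventuallyEq (Eventually.of_forall fun r => ?_)
  have hm : MulMem β (EulerMaxwell.shift (r • v) f) (EulerMaxwell.shift (r • v) g) := by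
    have hq := (measurePreserving_add_right volume (r • v)).quasiMeasurePreserving.ae h0.coeFn
    refine (memLp_congr_ae ?_).1 (Lp.memLp (EulerMaxwell.shift (r • v) (EulerMaxwell.mulField β f g)))
    filter_upwards [coeFn_shift (r • v) f, coeFn_shift (r • v) g,
      coeFn_shift (r • v) (EulerMaxwell.mulField β f g), hq] with x e1 e2 e3 e4
    rw [e1, e2, e3, e4]
  simp only [Function.comp_apply]
  rw [← key hm, mulField_shift h0]

end mulField

/-! ### The vector product -/

theorem norm_sq_eq_three (a : R3) : ‖a‖ ^ 2 = a 0 ^ 2 + a 1 ^ 2 + a 2 ^ 2 := by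
  simp [EuclideanSpace.norm_sq_eq, Fin.sum_univ_three]

theorem inner_eq_three (a b : R3) : inner ℝ a b = a 0 * b 0 + a 1 * b 1 + a 2 * b 2 := by
  simp [PiLp.inner_apply, Fin.sum_univ_three, mul_comm]

@[simp] theorem cross_zero_apply (a b : R3) : cross a b 0 = a 1 * b 2 - a 2 * b 1 := by
  simp [cross, cross_apply]

@[simp] theorem cross_one_apply (a b : R3) : cross a b 1 = a 2 * b 0 - a 0 * b 2 := by
  simp [cross, cross_apply]

@[simp] theorem cross_two_apply (a b : R3) : cross a b 2 = a 0 * b 1 - a 1 * b 0 := by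
  simp [cross, cross_apply]

theorem ext_three {a b : R3} (h0 : a 0 = b 0) (h1 : a 1 = b 1) (h2 : a 2 = b 2) : a = b := by
  ext i
  fin_cases i
  · exact h0
  · exact h1
  · exact h2

theorem norm_cross_le (a b : R3) : ‖cross a b‖ ≤ ‖a‖ * ‖b‖ := by
  refine le_of_sq_le_sq ?_ (by positivity)
  rw [mul_pow, norm_sq_eq_three, norm_sq_eq_three, norm_sq_eq_three]
  simp only [cross_zero_apply, cross_one_apply, cross_two_apply]
  -- Lagrange's identity: the difference of the two sides is the square of the inner product.
  nlinarith [sq_nonneg (a 0 * b 0 + a 1 * b 1 + a 2 * b 2)]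

/-- The vector product as a continuous bilinear map. -/
def crossL : R3 →L[ℝ] R3 →L[ℝ] R3 :=
  LinearMap.mkContinuous₂ (LinearMap.mk₂ ℝ cross
    (fun _ _ _ => ext_three (by simp; ring) (by simp; ring) (by simp; ring))
    (fun _ _ _ => ext_three (by simp; ring) (by simp; ring) (by simp; ring))
    (fun _ _ _ => ext_three (by simp; ring) (by simp; ring) (by simp; ring))
    (fun _ _ _ => ext_three (by simp; ring) (by simp; ring) (by simp; ring))) 1
    fun a b => by simpa using norm_cross_le a b

@[simp] theorem crossL_apply (a b : R3) : crossL a b = cross a b := rfl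

theorem norm_crossL_le (a b : R3) : ‖crossL a b‖ ≤ ‖a‖ * ‖b‖ := norm_cross_le a b

theorem crossField_eq (f g : L2Field) : crossField f g = mulField crossL f g := rfl

theorem inner_crossField_cyclic {f g h : L2Field} (h1 : MulMem crossL g h)
    (h2 : MulMem crossL h f) :
    inner ℝ f (crossField g h) = inner ℝ g (crossField h f) := by
  rw [L2.inner_def, L2.inner_def]
  refine integral_congr_ae ?_
  filter_upwards [h1.coeFn, h2.coeFn] with x e1 e2
  rw [crossField_eq, crossField_eq, e1, e2]
  simp only [inner_eq_three, crossL_apply, cross_zero_apply, cross_one_apply, cross_two_apply]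
  ring

theorem crossField_swap {f g : L2Field} (h1 : MulMem crossL f g) :
    crossField g f = - crossField f g := by
  refine toL2_eq ?_
  filter_upwards [h1.coeFn, Lp.coeFn_neg (crossField f g)] with x e1 e2
  rw [e2, Pi.neg_apply, crossField_eq, e1]
  exact ext_three (by simp; ring) (by simp; ring) (by simp; ring)

/-! ### The curl -/

theorem curl_eq (f : L2Field) :
    curl f = ∑ i, mapField (crossL (basisVec i)) (weakPartial i f) :=
  Finset.sum_congr rfl fun _ _ => toL2_eq (coeFn_mapField _ _)

theorem norm_basisVec (i : Fin 3) : ‖basisVec i‖ = 1 := by simp [basisVec]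

theorem norm_mapField_cross_le (i : Fin 3) (f : L2Field) :
    ‖mapField (crossL (basisVec i)) f‖ ≤ ‖f‖ := by
  refine Lp.norm_le_norm_of_ae_le ?_
  filter_upwards [coeFn_mapField (crossL (basisVec i)) f] with x hx
  rw [hx]
  simpa [norm_basisVec] using norm_cross_le (basisVec i) (f x)

theorem norm_curl_le (f : L2Field) : ‖curl f‖ ≤ 3 * sobolevNorm 1 f := by
  rw [curl_eq]
  have : ‖∑ i, mapField (crossL (basisVec i)) (weakPartial i f)‖ ≤
      ∑ _i : Fin 3, sobolevNorm 1 f :=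
    (norm_sum_le _ _).trans (Finset.sum_le_sum fun i _ =>
      (norm_mapField_cross_le i _).trans (norm_weakPartial_le i f))
  simpa using this

theorem curl_sub {f g : L2Field} (hf : MemH 1 f) (hg : MemH 1 g) :
    curl (f - g) = curl f - curl g := by
  simp [curl_eq, weakPartial_sub hf hg]

theorem curl_smul {f : L2Field} (hf : MemH 1 f) (a : ℝ) : curl (a • f) = a • curl f := by
  simp [curl_eq, weakPartial_smul hf, Finset.smul_sum]

theorem MemH.mapField {m : ℕ} {f : L2Field} (h : MemH m f) (L : R3 →L[ℝ] R3) :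
    MemH m (mapField L f) := by
  induction m generalizing f with
  | zero => trivial
  | succ m ih =>
    exact memH_succ_of (fun i => (h.isWeakDeriv i).mapField L) fun i => ih (h.weakPartial i)

theorem memH_zero (m : ℕ) : MemH m 0 := by
  induction m with
  | zero => trivial
  | succ m ih => exact memH_succ_of (fun _ => isWeakDeriv_zero) fun _ => ih

theorem MemH.sum {m : ℕ} {ι : Type*} {s : Finset ι} {f : ι → L2Field}
    (h : ∀ i ∈ s, MemH m (f i)) : MemH m (∑ i ∈ s, f i) := by
  classical
  induction s using Finset.induction_on with
  | empty =>
    simpa using memH_zero m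
  | insert a s ha ih =>
    rw [Finset.sum_insert ha]
    exact (h a (Finset.mem_insert_self a s)).add
      (ih fun i hi => h i (Finset.mem_insert_of_mem hi))

theorem MemH.curl {m : ℕ} {f : L2Field} (h : MemH (m + 1) f) : MemH m (curl f) := by
  rw [curl_eq]
  exact MemH.sum fun i _ => (h.weakPartial i).mapField _

theorem inner_mapField_cross (a : R3) (f g : L2Field) :
    inner ℝ (mapField (crossL a) f) g = - inner ℝ f (mapField (crossL a) g) := by
  rw [L2.inner_def, L2.inner_def, ← integral_neg]
  refine integral_congr_ae ?_
  filter_upwards [coeFn_mapField (crossL a) f, coeFn_mapField (crossL a) g] with x e1 e2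
  rw [e1, e2]
  simp only [inner_eq_three, crossL_apply, cross_zero_apply, cross_one_apply, cross_two_apply]
  ring

/-- The curl is symmetric. -/
theorem inner_curl_left {f g : L2Field} (hf : MemH 1 f) (hg : MemH 1 g) :
    inner ℝ (curl f) g = inner ℝ f (curl g) := by
  rw [curl_eq, curl_eq, sum_inner, inner_sum]
  refine Finset.sum_congr rfl fun i _ => ?_
  rw [((hf.isWeakDeriv i).mapField (crossL (basisVec i))).inner_left (hg.isWeakDeriv i),
    inner_mapField_cross, neg_neg]

/-! ### Divergence free and curl free fields -/

theorem basisVec_apply (i j : Fin 3) : basisVec i j = if j = i then 1 else 0 := by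
  simp [basisVec, PiLp.single_apply]

theorem pair_apply_coord {φ : R3 → ℝ} (hφ : IsTest φ) (f : L2Field) (k : Fin 3) :
    pair φ hφ f k = ∫ x, φ x * f x k := by
  have h := (EuclideanSpace.proj (𝕜 := ℝ) k : R3 →L[ℝ] ℝ).integral_comp_comm
    (memLp_one_iff_integrable.1 ((Lp.memLp f).smul (hφ.memLp 2)))
  rw [pair_apply]
  simpa using h.symm

theorem integrable_test_mul {φ : R3 → ℝ} (hφ : IsTest φ) (f : L2Field) (k : Fin 3) :
    Integrable fun x => φ x * f x k := by
  have h := (EuclideanSpace.proj (𝕜 := ℝ) k : R3 →L[ℝ] ℝ).integrable_comp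
    (memLp_one_iff_integrable.1 ((Lp.memLp f).smul (hφ.memLp 2)))
  simpa using h

theorem gradient_apply (φ : R3 → ℝ) (x : R3) (i : Fin 3) :
    gradient φ x i = fderiv ℝ φ x (basisVec i) := by
  have : inner ℝ (gradient φ x) (basisVec i) = fderiv ℝ φ x (basisVec i) := by
    simp [gradient]
  rw [← this, inner_eq_three]
  fin_cases i <;> simp [basisVec_apply]

theorem exists_gradField {φ : R3 → ℝ} (hφ : IsTest φ) :
    ∃ g : L2Field, g =ᵐ[volume] fun x => gradient φ x := by
  have hc : Continuous (gradient φ) :=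
    (LinearIsometryEquiv.continuous _).comp (hφ.1.continuous_fderiv (by simp))
  have hs : HasCompactSupport (gradient φ) := by
    refine (hφ.2.fderiv ℝ).comp_left (g := (InnerProductSpace.toDual ℝ R3).symm) ?_
    simp
  have hm : MemLp (gradient φ) 2 volume := hc.memLp_of_hasCompactSupport hs
  exact ⟨hm.toLp _, hm.coeFn_toLp⟩

/-- The distributional divergence paired with a test function, up to sign. -/
def divPair (φ : R3 → ℝ) (hφ : IsTest φ) : L2Field →L[ℝ] ℝ :=
  ∑ i : Fin 3, (EuclideanSpace.proj (𝕜 := ℝ) i : R3 →L[ℝ] ℝ).comp (pair _ (hφ.fderiv (basisVec i)))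

theorem divPair_apply {φ : R3 → ℝ} (hφ : IsTest φ) (f : L2Field) :
    divPair φ hφ f = ∑ i, pair _ (hφ.fderiv (basisVec i)) f i := by
  simp [divPair]

/-- The distributional curl paired with a test function, up to sign. -/
def curlPair (φ : R3 → ℝ) (hφ : IsTest φ) : L2Field →L[ℝ] R3 :=
  ∑ i : Fin 3, (crossL (basisVec i)).comp (pair _ (hφ.fderiv (basisVec i)))

theorem curlPair_apply {φ : R3 → ℝ} (hφ : IsTest φ) (f : L2Field) :
    curlPair φ hφ f = ∑ i, cross (basisVec i) (pair _ (hφ.fderiv (basisVec i)) f) := by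
  simp [curlPair]

theorem inner_gradField {φ : R3 → ℝ} (hφ : IsTest φ) {g : L2Field}
    (hg : g =ᵐ[volume] fun x => gradient φ x) (f : L2Field) :
    inner ℝ g f = divPair φ hφ f := by
  rw [divPair_apply, L2.inner_def]
  simp only [pair_apply_coord]
  rw [← integral_finsetSum _ fun i _ => integrable_test_mul (hφ.fderiv (basisVec i)) f i]
  refine integral_congr_ae ?_
  filter_upwards [hg] with x hx
  rw [hx]
  simp only [inner_eq_three, gradient_apply, Fin.sum_univ_three]

theorem mem_solenoidal_iff {f : L2Field} :
    f ∈ solenoidal ↔ ∀ φ (hφ : IsTest φ), divPair φ hφ f = 0 := by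
  rw [solenoidal, Submodule.mem_orthogonal]
  constructor
  · intro h φ hφ
    obtain ⟨g, hg⟩ := exists_gradField hφ
    rw [← inner_gradField hφ hg]
    exact h g (Submodule.subset_span ⟨φ, hφ, hg⟩)
  · intro h u hu
    induction hu using Submodule.span_induction with
    | mem u hu =>
      obtain ⟨φ, hφ, hg⟩ := hu
      rw [inner_gradField hφ hg, h φ hφ]
    | zero => simp
    | add u v _ _ hu hv => rw [inner_add_left, hu, hv, add_zero]
    | smul a u _ hu => rw [real_inner_smul_left, hu, mul_zero]

theorem isPressureGradient_gradField {φ : R3 → ℝ} (hφ : IsTest φ) {g : L2Field}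
    (hg : g =ᵐ[volume] fun x => gradient φ x) : IsPressureGradient g := by
  refine ⟨φ, hφ.1.continuous.locallyIntegrable, fun i ψ hψ => ?_⟩
  have hint : ∀ {a b : R3 → ℝ}, IsTest a → IsTest b → Integrable fun x => a x * b x :=
    fun ha hb => memLp_one_iff_integrable.1 ((hb.memLp 2).mul (ha.memLp 2))
  have := integral_mul_fderiv_eq_neg_fderiv_mul_of_integrable (μ := (volume : Measure R3))
    (f := ψ) (g := φ) (v := basisVec i) (hint (hψ.fderiv _) hφ) (hint hψ (hφ.fderiv _))
    (hint hψ hφ) (fun x _ => hψ.1.differentiable (by simp) x)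
    (fun x _ => hφ.1.differentiable (by simp) x)
  rw [← neg_eq_iff_eq_neg.2 this]
  congr 1
  refine integral_congr_ae ?_
  filter_upwards [hg] with x hx
  rw [hx, gradient_apply]

/-- Symmetry of the second derivatives of `φ`, applied to `p` as a distribution; neither regularity
nor decay of the pressure enters. -/
theorem IsPressureGradient.curlPair_eq_zero {G : L2Field} (hG : IsPressureGradient G)
    {φ : R3 → ℝ} (hφ : IsTest φ) : curlPair φ hφ G = 0 := by
  obtain ⟨p, -, hp⟩ := hG
  have hsymm : ∀ i k, pair _ (hφ.fderiv (basisVec i)) G k =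
      pair _ (hφ.fderiv (basisVec k)) G i := by
    intro i k
    have h1 := hp k _ (hφ.fderiv (basisVec i))
    have h2 := hp i _ (hφ.fderiv (basisVec k))
    simp only [hφ.fderiv_comm _ (basisVec i) (basisVec k)] at h1
    rw [pair_apply_coord, pair_apply_coord]
    linarith
  rw [curlPair_apply, Fin.sum_univ_three]
  refine ext_three ?_ ?_ ?_
  · simp [basisVec_apply, hsymm 1 2]
  · simp [basisVec_apply, hsymm 2 0]
  · simp [basisVec_apply, hsymm 0 1]

theorem divPair_shift {φ : R3 → ℝ} (hφ : IsTest φ) (y : R3) (f : L2Field) :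
    divPair φ hφ (shift y f) = divPair _ (hφ.comp_sub y) f := by
  simp only [divPair_apply]
  refine Finset.sum_congr rfl fun i _ => ?_
  rw [pair_shift, pair_apply_coord, pair_apply_coord]
  simp [fderiv_comp_sub]

theorem curlPair_shift {φ : R3 → ℝ} (hφ : IsTest φ) (y : R3) (f : L2Field) :
    curlPair φ hφ (shift y f) = curlPair _ (hφ.comp_sub y) f := by
  simp only [curlPair_apply]
  refine Finset.sum_congr rfl fun i _ => ?_
  rw [pair_shift, pair_apply, pair_apply]
  simp [fderiv_comp_sub]

theorem avg_mem_solenoidal {k : R3 → ℝ} (hk : Integrable k) (δ : ℝ) {f : L2Field}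
    (hf : f ∈ solenoidal) : avg k δ f ∈ solenoidal := by
  rw [mem_solenoidal_iff] at hf ⊢
  intro φ hφ
  simp [clm_avg _ hk, divPair_shift, hf]

theorem curlPair_avg {k : R3 → ℝ} (hk : Integrable k) (δ : ℝ) {f : L2Field}
    (hf : ∀ φ (hφ : IsTest φ), curlPair φ hφ f = 0) {φ : R3 → ℝ} (hφ : IsTest φ) :
    curlPair φ hφ (avg k δ f) = 0 := by
  simp [clm_avg _ hk, curlPair_shift, hf]

theorem pair_curl {f : L2Field} (hf : MemH 1 f) {φ : R3 → ℝ} (hφ : IsTest φ) :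
    pair φ hφ (curl f) = - curlPair φ hφ f := by
  rw [curl_eq, map_sum, curlPair_apply, ← Finset.sum_neg_distrib]
  refine Finset.sum_congr rfl fun i _ => ?_
  rw [pair_mapField, hf.isWeakDeriv i φ hφ, ← crossL_apply, map_neg, neg_neg]

/-- The linear map `a ↦ aᵢ eⱼ`. -/
def coordMap (i j : Fin 3) : R3 →L[ℝ] R3 :=
  (EuclideanSpace.proj (𝕜 := ℝ) i : R3 →L[ℝ] ℝ).smulRight (basisVec j)

@[simp] theorem coordMap_apply (i j : Fin 3) (a : R3) : coordMap i j a = a i • basisVec j := by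
  simp [coordMap]

/-- The scalar identity `div f = 0`, placed in the `j`-th component of a vector field so that the
calculus of `L2Field` applies to it. -/
theorem sum_coordMap_weakPartial {f : L2Field} (hf : MemH 1 f) (hs : f ∈ solenoidal) (j : Fin 3) :
    ∑ i, mapField (coordMap i j) (weakPartial i f) = 0 := by
  refine ext_pair fun φ hφ => ?_
  rw [map_sum, map_zero]
  have h := mem_solenoidal_iff.1 hs φ hφ
  rw [divPair_apply] at h
  simp only [pair_mapField, coordMap_apply, hf.isWeakDeriv _ φ hφ] at h ⊢
  rw [← Finset.sum_smul]
  simp only [PiLp.neg_apply, Finset.sum_neg_distrib, neg_eq_zero] at h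
  rw [h, zero_smul]

/-- The divergence of a solenoidal field vanishes almost everywhere. -/
theorem ae_div_eq_zero {f : L2Field} (hf : MemH 1 f) (hs : f ∈ solenoidal) :
    ∀ᵐ x, ∑ i, weakPartial i f x i = 0 := by
  have h := sum_coordMap_weakPartial hf hs 0
  rw [Fin.sum_univ_three] at h
  have h0 := Lp.coeFn_zero R3 2 (volume : Measure R3)
  rw [← h] at h0
  filter_upwards [h0, coeFn_mapField (coordMap 0 0) (weakPartial 0 f),
    coeFn_mapField (coordMap 1 0) (weakPartial 1 f), coeFn_mapField (coordMap 2 0) (weakPartial 2 f),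
    Lp.coeFn_add (mapField (coordMap 0 0) (weakPartial 0 f) +
      mapField (coordMap 1 0) (weakPartial 1 f)) (mapField (coordMap 2 0) (weakPartial 2 f)),
    Lp.coeFn_add (mapField (coordMap 0 0) (weakPartial 0 f))
      (mapField (coordMap 1 0) (weakPartial 1 f))] with x e0 e1 e2 e3 e4 e5
  rw [e4, Pi.add_apply, e5, Pi.add_apply, e1, e2, e3] at e0
  have := congrArg (fun a : R3 => a 0) e0
  simpa [basisVec_apply, Fin.sum_univ_three] using this

theorem curl_mem_solenoidal {f : L2Field} (hf : MemH 1 f) : curl f ∈ solenoidal := by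
  rw [mem_solenoidal_iff]
  intro φ hφ
  rw [divPair_apply]
  simp only [pair_curl hf, curlPair_apply, Fin.sum_univ_three]
  have hc : ∀ i j, pair _ ((hφ.fderiv (basisVec i)).fderiv (basisVec j)) f =
      pair _ ((hφ.fderiv (basisVec j)).fderiv (basisVec i)) f := by
    intro i j
    rw [pair_apply, pair_apply]
    simp only [hφ.fderiv_comm _ (basisVec i) (basisVec j)]
  simp [basisVec_apply, hc 1 0, hc 2 0, hc 2 1]
  try ring

/-- The triple product `eᵢ × (eⱼ × a) = aᵢ eⱼ - (eᵢ · eⱼ) a`. In `curl_curl` the first term sums to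
the gradient of the divergence, the second to the Laplacian. -/
theorem cross_basisVec_cross (i j : Fin 3) :
    (crossL (basisVec i)).comp (crossL (basisVec j)) =
      coordMap i j - if i = j then ContinuousLinearMap.id ℝ R3 else 0 := by
  ext a k
  fin_cases i <;> fin_cases j <;> fin_cases k <;> simp [basisVec_apply]

theorem mapField_comp (L L' : R3 →L[ℝ] R3) (f : L2Field) :
    mapField L (mapField L' f) = mapField (L.comp L') f := by
  apply Lp.ext
  filter_upwards [coeFn_mapField L (mapField L' f), coeFn_mapField L' f,
    coeFn_mapField (L.comp L') f] with x e1 e2 e3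
  rw [e1, e2, e3]
  rfl

theorem mapField_sub (L L' : R3 →L[ℝ] R3) (f : L2Field) :
    mapField (L - L') f = mapField L f - mapField L' f :=
  ext_pair fun φ hφ => by simp [pair_mapField]

theorem mapField_id (f : L2Field) : mapField (ContinuousLinearMap.id ℝ R3) f = f :=
  ext_pair fun φ hφ => by simp [pair_mapField]

theorem mapField_zero (f : L2Field) : mapField 0 f = 0 :=
  ext_pair fun φ hφ => by simp [pair_mapField]

theorem weakPartial_mapField {f : L2Field} (hf : MemH 1 f) (L : R3 →L[ℝ] R3) (i : Fin 3) :
    weakPartial i (mapField L f) = mapField L (weakPartial i f) :=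
  weakPartial_eq ((hf.isWeakDeriv i).mapField L)

theorem weakPartial_comm {f : L2Field} (hf : MemH 2 f) (i j : Fin 3) :
    weakPartial i (weakPartial j f) = weakPartial j (weakPartial i f) :=
  (weakPartial_eq ((hf.isWeakDeriv i).comm (hf.isWeakDeriv j)
    ((hf.weakPartial j).isWeakDeriv i))).symm

theorem weakPartial_sum {ι : Type*} {s : Finset ι} {f : ι → L2Field} (hf : ∀ k ∈ s, MemH 1 (f k))
    (i : Fin 3) : weakPartial i (∑ k ∈ s, f k) = ∑ k ∈ s, weakPartial i (f k) :=
  weakPartial_eq (IsWeakDeriv.sum fun k hk => (hf k hk).isWeakDeriv i)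

/-- `∇ × ∇ × f = - Δ f` for divergence free fields. -/
theorem curl_curl {f : L2Field} (hf : MemH 2 f) (hs : f ∈ solenoidal) :
    curl (curl f) = - laplacian f := by
  have h1 : curl (curl f) = ∑ i, ∑ j,
      mapField ((crossL (basisVec i)).comp (crossL (basisVec j)))
        (weakPartial i (weakPartial j f)) := by
    rw [curl_eq (curl f)]
    refine Finset.sum_congr rfl fun i _ => ?_
    rw [curl_eq f, weakPartial_sum (fun j _ => (hf.weakPartial j).mapField _), map_sum]
    refine Finset.sum_congr rfl fun j _ => ?_
    rw [weakPartial_mapField (hf.weakPartial j), mapField_comp]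
  have h2 : ∀ j, ∑ i, mapField (coordMap i j) (weakPartial i (weakPartial j f)) = 0 := by
    intro j
    have := weakPartial_sum (s := Finset.univ) (f := fun i => mapField (coordMap i j)
      (weakPartial i f)) (fun i _ => (hf.weakPartial i).mapField _) j
    rw [sum_coordMap_weakPartial hf.of_succ hs j, weakPartial_eq isWeakDeriv_zero] at this
    rw [this]
    refine Finset.sum_congr rfl fun i _ => ?_
    rw [weakPartial_mapField (hf.weakPartial i), weakPartial_comm hf]
  rw [h1]
  simp only [cross_basisVec_cross, mapField_sub, Finset.sum_sub_distrib]
  rw [Finset.sum_comm, Finset.sum_congr rfl fun j _ => h2 j, Finset.sum_const_zero, zero_sub,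
    laplacian]
  congr 1
  refine Finset.sum_congr rfl fun i _ => ?_
  rw [Finset.sum_eq_single i]
  · simp [mapField_id]
  · intro j _ hj
    rw [if_neg hj.symm, mapField_zero]
  · simp

/-- `∇ × ∇ × f = -Δf` makes `f` harmonic. Then `∑ ‖∂ᵢf‖² = -⟨f, Δf⟩ = 0`, so `f` is translation
invariant and vanishes. -/
theorem eq_zero_of_curl_eq_zero {f : L2Field} (hf : MemH 2 f) (hs : f ∈ solenoidal)
    (hc : curl f = 0) : f = 0 := by
  have h1 : laplacian f = 0 := by
    have := curl_curl hf hs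
    rw [hc] at this
    rw [← neg_eq_zero, ← this, curl_eq]
    refine Finset.sum_eq_zero fun i _ => ?_
    rw [weakPartial_eq isWeakDeriv_zero, map_zero]
  have h2 : ∑ i, ‖weakPartial i f‖ ^ 2 = 0 := by
    have : ∀ i, ‖weakPartial i f‖ ^ 2 = - inner ℝ f (weakPartial i (weakPartial i f)) := fun i => by
      rw [← real_inner_self_eq_norm_sq,
        (hf.isWeakDeriv i).inner_left ((hf.weakPartial i).isWeakDeriv i)]
    rw [Finset.sum_congr rfl fun i _ => this i, Finset.sum_neg_distrib, ← inner_sum]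
    change - inner ℝ f (laplacian f) = 0
    simp [h1]
  refine eq_zero_of_weakDeriv_zero fun i => ?_
  have h3 := (Finset.sum_eq_zero_iff_of_nonneg fun i _ => sq_nonneg _).1 h2 i (Finset.mem_univ i)
  rw [← norm_eq_zero.1 (pow_eq_zero_iff (two_ne_zero) |>.1 h3)]
  exact hf.isWeakDeriv i

/-- A square integrable field with vanishing divergence and curl vanishes. -/
theorem eq_zero_of_div_curl {f : L2Field} (hs : f ∈ solenoidal)
    (hc : ∀ φ (hφ : IsTest φ), curlPair φ hφ f = 0) : f = 0 := by
  -- Each Gaussian average supplies one derivative, so two of them reach the `H²` regularity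
  -- required by `eq_zero_of_curl_eq_zero`, and both preserve vanishing divergence and curl.
  have hz : ∀ δ : ℝ, 0 < δ → avg gauss δ (avg gauss δ f) = 0 := by
    intro δ hδ
    set w := avg gauss δ (avg gauss δ f) with hw
    have hk := fun i => integrable_inner_mul_gauss (basisVec i)
    have hmem : MemH 2 w := by
      refine memH_succ_of (fun i => isWeakDeriv_avg_gauss hδ.ne' _ _) fun i => MemH.smul ?_ _
      exact memH_succ_of (fun j => (isWeakDeriv_avg_gauss hδ.ne' f (basisVec j)).avg (hk i) δ)
        fun _ => trivial
    refine eq_zero_of_curl_eq_zero hmem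
      (avg_mem_solenoidal integrable_gauss δ (avg_mem_solenoidal integrable_gauss δ hs)) ?_
    refine ext_pair fun φ hφ => ?_
    rw [pair_curl hmem.of_succ, map_zero, neg_eq_zero]
    exact curlPair_avg integrable_gauss δ
      (fun ψ hψ => curlPair_avg integrable_gauss δ hc hψ) hφ
  have hm := gaussMass_pos
  -- Since the double average vanishes, a multiple of `f` can be written through the error of the
  -- single average alone, which tends to zero with `δ`.
  have hbound : ∀ δ : ℝ, 0 < δ → ‖(gaussMass * gaussMass) • f‖ ≤
      (2 * gaussMass) * ‖avg gauss δ f - gaussMass • f‖ := by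
    intro δ hδ
    have h1 : (gaussMass * gaussMass) • f = - (gaussMass • (avg gauss δ f - gaussMass • f) +
        avg gauss δ (avg gauss δ f - gaussMass • f)) := by
      have h2 : avg gauss δ (avg gauss δ f - gaussMass • f) =
          avg gauss δ (avg gauss δ f) - gaussMass • avg gauss δ f := by
        simp only [avg, map_sub, map_smul, smul_sub]
        rw [integral_sub (integrable_smul_shift integrable_gauss δ _)]
        · simp only [smul_comm _ gaussMass]
          rw [integral_smul]
        · simpa [smul_comm _ gaussMass, Pi.smul_def] using
            (integrable_smul_shift integrable_gauss δ f).smul gaussMass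
      rw [h2, hz δ hδ, mul_smul]
      module
    rw [h1, norm_neg]
    refine (norm_add_le _ _).trans ?_
    have h3 := norm_avg_le integrable_gauss δ (avg gauss δ f - gaussMass • f)
    have h4 : ∫ z, ‖gauss z‖ = gaussMass :=
      integral_congr_ae (Eventually.of_forall fun z => Real.norm_of_nonneg (gauss_pos z).le)
    rw [h4] at h3
    rw [norm_smul, Real.norm_of_nonneg hm.le]
    linarith
  have hlim : Tendsto (fun δ => (2 * gaussMass) * ‖avg gauss δ f - gaussMass • f‖) (𝓝[>] 0)
      (𝓝 0) := by
    have := ((tendsto_avg_gauss f).sub_const (gaussMass • f)).norm.const_mul (2 * gaussMass)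
    rw [sub_self, norm_zero, mul_zero] at this
    exact this.mono_left nhdsWithin_le_nhds
  have h0 : ‖(gaussMass * gaussMass) • f‖ ≤ 0 :=
    ge_of_tendsto hlim (eventually_mem_nhdsWithin.mono fun δ hδ => hbound δ hδ)
  have := norm_le_zero_iff.1 h0
  exact (smul_eq_zero.1 this).resolve_left (by positivity)

/-! ### The Leray projection and pressure gradients -/

theorem leray_mem (f : L2Field) : leray f ∈ solenoidal := by
  rw [leray, Submodule.starProjection_apply]
  exact Submodule.coe_mem _

theorem leray_eq_self {f : L2Field} (hf : f ∈ solenoidal) : leray f = f :=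
  Submodule.starProjection_eq_self_iff.2 hf

theorem norm_leray_le (f : L2Field) : ‖leray f‖ ≤ ‖f‖ :=
  Submodule.norm_starProjection_apply_le _ _

theorem inner_leray_right {f : L2Field} (hf : f ∈ solenoidal) (g : L2Field) :
    inner ℝ f (leray g) = inner ℝ f g := by
  have h := Submodule.inner_starProjection_left_eq_right solenoidal f g
  rw [← leray, leray_eq_self hf] at h
  exact h.symm

/-- Pressure gradients are orthogonal to the divergence free fields. -/
theorem inner_pressureGradient {f G : L2Field} (hf : f ∈ solenoidal) (hG : IsPressureGradient G) :
    inner ℝ f G = 0 := by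
  -- The pressure is only locally integrable, so it cannot be integrated by parts against `f`
  -- directly. Instead, `G - ℙG` lies in the closure of the test gradients and is curl free, as is
  -- `G`; thus `ℙG` has neither divergence nor curl and vanishes.
  have hP : leray G = 0 := by
    refine eq_zero_of_div_curl (leray_mem G) fun φ hφ => ?_
    have h1 : G - leray G ∈ (Submodule.span ℝ testGradients).topologicalClosure := by
      rw [← Submodule.orthogonal_orthogonal_eq_closure]
      exact Submodule.sub_starProjection_mem_orthogonal (K := solenoidal) G
    have h2 : (Submodule.span ℝ testGradients).topologicalClosure ≤
        LinearMap.ker (curlPair φ hφ : L2Field →ₗ[ℝ] R3) := by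
      refine Submodule.topologicalClosure_minimal _ (Submodule.span_le.2 ?_)
        (ContinuousLinearMap.isClosed_ker (curlPair φ hφ))
      rintro g ⟨ψ, hψ, hg⟩
      exact (isPressureGradient_gradField hψ hg).curlPair_eq_zero hφ
    have h3 : curlPair φ hφ (G - leray G) = 0 := h2 h1
    rw [map_sub, hG.curlPair_eq_zero hφ, zero_sub, neg_eq_zero] at h3
    exact h3
  rw [← inner_leray_right hf, hP, inner_zero_right]

/-! ### Convection -/

/-- The bilinear map `(a, b) ↦ aᵢ b`. -/
def coordSmul (i : Fin 3) : R3 →L[ℝ] R3 →L[ℝ] R3 :=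
  (ContinuousLinearMap.lsmul ℝ ℝ).comp (EuclideanSpace.proj (𝕜 := ℝ) i : R3 →L[ℝ] ℝ)

@[simp] theorem coordSmul_apply (i : Fin 3) (a b : R3) : coordSmul i a b = a i • b := rfl

theorem norm_coordSmul_le (i : Fin 3) (a b : R3) : ‖coordSmul i a b‖ ≤ ‖a‖ * ‖b‖ := by
  rw [coordSmul_apply, norm_smul]
  gcongr
  exact PiLp.norm_apply_le a i

theorem coeFn_finsetSum {ι : Type*} (s : Finset ι) (f : ι → L2Field) :
    (∑ k ∈ s, f k : L2Field) =ᵐ[volume] fun x => ∑ k ∈ s, f k x := by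
  classical
  induction s using Finset.induction_on with
  | empty =>
    exact Eventually.of_forall fun x => by simp
  | insert a s ha ih =>
    rw [Finset.sum_insert ha]
    filter_upwards [ih, Lp.coeFn_add (f a) (∑ k ∈ s, f k)] with x h1 h2
    rw [h2, Pi.add_apply, h1, Finset.sum_insert ha]

theorem convection_eq {f g : L2Field} (h : ∀ i, MulMem (coordSmul i) f (weakPartial i g)) :
    convection f g = ∑ i, mulField (coordSmul i) f (weakPartial i g) := by
  refine toL2_eq ?_
  have h' : ∀ᵐ x, ∀ i, mulField (coordSmul i) f (weakPartial i g) x =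
      coordSmul i (f x) (weakPartial i g x) := ae_all_iff.2 fun i => (h i).coeFn
  filter_upwards [coeFn_finsetSum Finset.univ fun i => mulField (coordSmul i) f (weakPartial i g),
    h'] with x e1 e2
  rw [e1]
  exact Finset.sum_congr rfl fun i _ => e2 i

theorem inner_mulField_coordSmul {f g h : L2Field} {i : Fin 3} (h1 : MulMem (coordSmul i) f g)
    (h2 : MulMem (coordSmul i) f h) :
    inner ℝ (mulField (coordSmul i) f g) h = inner ℝ g (mulField (coordSmul i) f h) := by
  rw [L2.inner_def, L2.inner_def]
  refine integral_congr_ae ?_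
  filter_upwards [h1.coeFn, h2.coeFn] with x e1 e2
  rw [e1, e2]
  simp [real_inner_smul_left, real_inner_smul_right]

/-- Transport by a divergence free field is antisymmetric. -/
theorem inner_convection_self {u f : L2Field} (hu : MemH 2 u) (hs : u ∈ solenoidal)
    (hf : MemH 2 f) : inner ℝ f (convection u f) = 0 := by
  have hub := hu.essBdd
  have hfb := hf.essBdd
  -- The product rule for `uᵢ f`, paired with `f`. Summed over `i`, the first term contains `div u`
  -- and disappears.
  have h1 : ∀ i, inner ℝ f (mulField (coordSmul i) (weakPartial i u) f) +
      2 * inner ℝ f (mulField (coordSmul i) u (weakPartial i f)) = 0 := by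
    intro i
    have hd := (hu.of_succ.isWeakDeriv i).mulField (β := coordSmul i) (hf.of_succ.isWeakDeriv i)
      (hub.mulMem_left f) (hfb.mulMem_right _) (hub.mulMem_left _)
    have h2 := hd.inner_left (hf.of_succ.isWeakDeriv i)
    rw [inner_mulField_coordSmul (hub.mulMem_left f) (hub.mulMem_left _), inner_add_left,
      real_inner_comm, real_inner_comm f] at h2
    linarith
  have h3 : ∑ i, mulField (coordSmul i) (weakPartial i u) f = 0 := by
    apply Lp.ext
    have h' : ∀ᵐ x, ∀ i, mulField (coordSmul i) (weakPartial i u) f x =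
        coordSmul i (weakPartial i u x) (f x) := ae_all_iff.2 fun i => (hfb.mulMem_right _).coeFn
    filter_upwards [coeFn_finsetSum Finset.univ fun i => mulField (coordSmul i) (weakPartial i u) f,
      h', ae_div_eq_zero hu.of_succ hs, Lp.coeFn_zero R3 2 (volume : Measure R3)] with x e1 e2 e3 e4
    rw [e1, e4, Finset.sum_congr rfl fun i _ => e2 i]
    simp only [coordSmul_apply, ← Finset.sum_smul]
    rw [e3, zero_smul]
    rfl
  have h4 : ∑ i, (inner ℝ f (mulField (coordSmul i) (weakPartial i u) f) +
      2 * inner ℝ f (mulField (coordSmul i) u (weakPartial i f))) = 0 :=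
    Finset.sum_eq_zero fun i _ => h1 i
  rw [Finset.sum_add_distrib, ← inner_sum, h3, inner_zero_right, zero_add, ← Finset.mul_sum,
    ← inner_sum] at h4
  rw [convection_eq fun i => hub.mulMem_left _]
  linarith

/-! ### Bounds for products -/

theorem norm_crossField_le_left {f : L2Field} {C : ℝ} (hf : EssBdd f C) (g : L2Field) :
    ‖crossField f g‖ ≤ C * ‖g‖ := norm_mulField_le_left norm_crossL_le hf g

theorem norm_crossField_le_right {g : L2Field} {C : ℝ} (hg : EssBdd g C) (f : L2Field) :
    ‖crossField f g‖ ≤ C * ‖f‖ := norm_mulField_le_right norm_crossL_le hg f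

theorem essBdd_curl {f : L2Field} {C : ℝ} (h : ∀ i, EssBdd (weakPartial i f) C) :
    EssBdd (curl f) (3 * C) := by
  have h1 : ∀ᵐ x, ∀ i, ‖weakPartial i f x‖ ≤ C := ae_all_iff.2 h
  have h2 : ∀ᵐ x, ∀ i, mapField (crossL (basisVec i)) (weakPartial i f) x =
      crossL (basisVec i) (weakPartial i f x) := ae_all_iff.2 fun i => coeFn_mapField _ _
  have h3 := coeFn_finsetSum Finset.univ fun i => mapField (crossL (basisVec i)) (weakPartial i f)
  rw [← curl_eq] at h3
  refine Filter.Eventually.mono (h1.and (h2.and h3)) fun x ⟨e1, e2, e3⟩ => ?_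
  rw [e3]
  dsimp only
  rw [Finset.sum_congr rfl fun i _ => e2 i]
  have : ‖∑ i, crossL (basisVec i) (weakPartial i f x)‖ ≤ ∑ _i : Fin 3, C :=
    (norm_sum_le _ _).trans (Finset.sum_le_sum fun i _ =>
      (norm_crossL_le _ _).trans (by rw [norm_basisVec, one_mul]; exact e1 i))
  simpa using this

theorem norm_convection_le {f g : L2Field} {C : ℝ} (h : ∀ i, EssBdd (weakPartial i g) C) :
    ‖convection f g‖ ≤ 3 * C * ‖f‖ := by
  rw [convection_eq fun i => (h i).mulMem_right f]
  have : ‖∑ i, mulField (coordSmul i) f (weakPartial i g)‖ ≤ ∑ _i : Fin 3, C * ‖f‖ :=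
    (norm_sum_le _ _).trans (Finset.sum_le_sum fun i _ =>
      norm_mulField_le_right (norm_coordSmul_le i) (h i) f)
  simpa [mul_assoc] using this

/-- The splitting leaves `u`, for which no uniform `H^m` bound is available, only as a transporting
velocity, where it drops out by antisymmetry; the gradient that must be estimated falls on `ub`. -/
theorem convection_sub_convection {u ub : L2Field} (hu : MemH 3 u) (hub : MemH 3 ub) :
    convection u u - convection ub ub = convection u (u - ub) + convection (u - ub) ub := by
  have h1 := (hu.mono (by norm_num : 2 ≤ 3)).essBdd
  have h2 := (hub.mono (by norm_num : 2 ≤ 3)).essBdd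
  have h3 := fun i => (hub.weakPartial i).essBdd
  rw [convection_eq fun i => h1.mulMem_left _, convection_eq fun i => h2.mulMem_left _,
    convection_eq fun i => h1.mulMem_left _, convection_eq fun i => (h3 i).mulMem_right _,
    ← Finset.sum_sub_distrib, ← Finset.sum_add_distrib]
  refine Finset.sum_congr rfl fun i _ => ?_
  rw [weakPartial_sub (hu.mono (by norm_num)) (hub.mono (by norm_num)),
    mulField_sub_right (h1.mulMem_left _) (h1.mulMem_left _),
    mulField_sub_left (h1.mulMem_left _) (h2.mulMem_left _)]
  abel

/-- Of the two factors measured in `L^∞`, `ub` is bounded uniformly in time. `B` is bounded only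
after integration in time, and in the energy balance its term cancels. -/
theorem crossField_sub_crossField {u B ub Bb : L2Field} (hB : MemH 2 B) (hub : MemH 2 ub) :
    crossField u B - crossField ub Bb = crossField (u - ub) B + crossField ub (B - Bb) := by
  have h1 := hB.essBdd
  have h2 := hub.essBdd
  simp only [crossField_eq]
  rw [mulField_sub_left (h1.mulMem_right _) (h1.mulMem_right _),
    mulField_sub_right (h2.mulMem_left _) (h2.mulMem_left _)]
  abel

section products

variable {f g : L2Field} {K : ℝ}

theorem crossField_isWeakDeriv (hf : MemH 2 f) (hg : MemH 2 g) (j : Fin 3) :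
    IsWeakDeriv (basisVec j) (crossField f g)
      (crossField (weakPartial j f) g + crossField f (weakPartial j g)) := by
  have h0 : MulMem crossL f g := hf.essBdd.mulMem_left _
  have h1 : MulMem crossL (weakPartial j f) g := hg.essBdd.mulMem_right _
  have h2 : MulMem crossL f (weakPartial j g) := hf.essBdd.mulMem_left _
  simp only [crossField_eq]
  exact IsWeakDeriv.mulField (hf.of_succ.isWeakDeriv j) (hg.of_succ.isWeakDeriv j) h0 h1 h2

theorem crossField_memH (hf : MemH 2 f) (hg : MemH 2 g) : MemH 1 (crossField f g) :=
  memH_succ_of (crossField_isWeakDeriv hf hg) fun _ => trivial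

theorem crossField_weakPartial_isWeakDeriv (hf : MemH 3 f) (hg : MemH 3 g) (i j : Fin 3) :
    IsWeakDeriv (basisVec i) (weakPartial j (crossField f g))
      ((crossField (weakPartial i (weakPartial j f)) g +
          crossField (weakPartial j f) (weakPartial i g)) +
        (crossField (weakPartial i f) (weakPartial j g) +
          crossField f (weakPartial i (weakPartial j g)))) := by
  have hf2 : MemH 2 f := hf.of_succ
  have hg2 : MemH 2 g := hg.of_succ
  rw [weakPartial_eq (crossField_isWeakDeriv hf2 hg2 j)]
  refine IsWeakDeriv.add ?_ ?_
  · have h0 : MulMem crossL (weakPartial j f) g := hg2.essBdd.mulMem_right _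
    have h1 : MulMem crossL (weakPartial i (weakPartial j f)) g := hg2.essBdd.mulMem_right _
    have h2 : MulMem crossL (weakPartial j f) (weakPartial i g) :=
      (hf.weakPartial j).essBdd.mulMem_left _
    simp only [crossField_eq]
    exact IsWeakDeriv.mulField ((hf.weakPartial j).of_succ.isWeakDeriv i)
      (hg2.of_succ.isWeakDeriv i) h0 h1 h2
  · have h0 : MulMem crossL f (weakPartial j g) := hf2.essBdd.mulMem_left _
    have h1 : MulMem crossL (weakPartial i f) (weakPartial j g) :=
      (hg.weakPartial j).essBdd.mulMem_right _
    have h2 : MulMem crossL f (weakPartial i (weakPartial j g)) := hf2.essBdd.mulMem_left _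
    simp only [crossField_eq]
    exact IsWeakDeriv.mulField (hf2.of_succ.isWeakDeriv i)
      ((hg.weakPartial j).of_succ.isWeakDeriv i) h0 h1 h2

theorem crossField_memH_two (hf : MemH 3 f) (hg : MemH 3 g) : MemH 2 (crossField f g) := by
  have h := fun j => crossField_isWeakDeriv (f := f) (g := g) hf.of_succ hg.of_succ j
  refine memH_succ_of (d := fun j => weakPartial j (crossField f g))
    (fun j => by rw [weakPartial_eq (h j)]; exact h j)
    fun j => memH_succ_of (fun i => crossField_weakPartial_isWeakDeriv hf hg i j) fun _ => trivial

theorem norm_crossField_weakPartial_le (hf : MemH 3 f) (hg : MemH 3 g)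
    (hfK : sobolevNorm 3 f ≤ K) (hgK : sobolevNorm 3 g ≤ K) (i j : Fin 3) :
    ‖weakPartial i (weakPartial j (crossField f g))‖ ≤ 4 * (embConst * K * K) := by
  have hK : 0 ≤ K := (sobolevNorm_nonneg 3 f).trans hfK
  have hA : 0 ≤ embConst * K := mul_nonneg embConst_nonneg hK
  rw [weakPartial_eq (crossField_weakPartial_isWeakDeriv hf hg i j)]
  have bnd : ∀ {f : L2Field}, MemH 3 f → sobolevNorm 3 f ≤ K →
      EssBdd f (embConst * K) ∧ (∀ i, EssBdd (weakPartial i f) (embConst * K)) ∧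
      (∀ i, ‖weakPartial i f‖ ≤ K) ∧ ∀ i j, ‖weakPartial i (weakPartial j f)‖ ≤ K := by
    intro f hf hfK
    have h2 := sobolevNorm_mono (by norm_num : 2 ≤ 3) f
    have h1 := sobolevNorm_mono (by norm_num : 1 ≤ 3) f
    exact ⟨hf.of_succ.essBdd_of_le (h2.trans hfK),
      fun i => (hf.weakPartial i).essBdd_of_le ((sobolevNorm_weakPartial_le 2 i f).trans hfK),
      fun i => (norm_weakPartial_le i f).trans (h1.trans hfK),
      fun i j => (norm_weakPartial_weakPartial_le i j f).trans (h2.trans hfK)⟩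
  obtain ⟨f0, f1, f1', f2⟩ := bnd hf hfK
  obtain ⟨g0, g1, g1', g2⟩ := bnd hg hgK
  have e1 := (norm_crossField_le_right g0 (weakPartial i (weakPartial j f))).trans
    (mul_le_mul_of_nonneg_left (f2 i j) hA)
  have e2 := (norm_crossField_le_left (f1 j) (weakPartial i g)).trans
    (mul_le_mul_of_nonneg_left (g1' i) hA)
  have e3 := (norm_crossField_le_left (f1 i) (weakPartial j g)).trans
    (mul_le_mul_of_nonneg_left (g1' j) hA)
  have e4 := (norm_crossField_le_left f0 (weakPartial i (weakPartial j g))).trans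
    (mul_le_mul_of_nonneg_left (g2 i j) hA)
  refine (norm_add_le _ _).trans ?_
  have e5 := norm_add_le (crossField (weakPartial i (weakPartial j f)) g)
    (crossField (weakPartial j f) (weakPartial i g))
  have e6 := norm_add_le (crossField (weakPartial i f) (weakPartial j g))
    (crossField f (weakPartial i (weakPartial j g)))
  linarith

end products

/-! ### Continuity in time -/

section continuity

variable {m : ℕ} {T : ℝ} {f g : ℝ → L2Field}

theorem ContinuousInH.mono {n : ℕ} (h : ContinuousInH n T f) (hmn : m ≤ n) :
    ContinuousInH m T f := by
  refine ⟨fun t ht => (h.1 t ht).mono hmn, fun t ht => ?_⟩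
  exact squeeze_zero (fun _ => sobolevNorm_nonneg _ _) (fun _ => sobolevNorm_mono hmn _) (h.2 t ht)

theorem continuousOn_of_norm_sub_le {F : ℝ → L2Field} {C : ℝ} (h : ContinuousInH m T f)
    (hF : ∀ s ∈ Icc 0 T, ∀ t ∈ Icc 0 T, ‖F s - F t‖ ≤ C * sobolevNorm m (f s - f t)) :
    ContinuousOn F (Icc 0 T) := by
  intro t ht
  rw [ContinuousWithinAt, tendsto_iff_norm_sub_tendsto_zero]
  have h2 := (h.2 t ht).const_mul C
  rw [mul_zero] at h2
  exact squeeze_zero' (Eventually.of_forall fun _ => norm_nonneg _)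
    (eventually_mem_nhdsWithin.mono fun s hs => hF s hs t ht) h2

theorem ContinuousInH.continuousOn (h : ContinuousInH m T f) : ContinuousOn f (Icc 0 T) :=
  continuousOn_of_norm_sub_le (C := 1) h fun s _ t _ => by
    simpa using norm_le_sobolevNorm m (f s - f t)

theorem ContinuousInH.curl (h : ContinuousInH 1 T f) :
    ContinuousOn (fun t => curl (f t)) (Icc 0 T) :=
  continuousOn_of_norm_sub_le h fun s hs t ht => by
    rw [← curl_sub (h.1 s hs) (h.1 t ht)]
    exact norm_curl_le _

theorem ContinuousInH.crossField (hf : ContinuousInH 2 T f) (hg : ContinuousInH 2 T g) :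
    ContinuousOn (fun t => crossField (f t) (g t)) (Icc 0 T) := by
  intro t ht
  rw [ContinuousWithinAt, tendsto_iff_norm_sub_tendsto_zero]
  have h1 := ((hf.2 t ht).const_mul embConst).mul ((hg.continuousOn t ht).norm)
  have h2 := (tendsto_iff_norm_sub_tendsto_zero.1 (hg.continuousOn t ht)).const_mul
    (embConst * sobolevNorm 2 (f t))
  have h3 := h1.add h2
  simp only [mul_zero, zero_mul, add_zero] at h3
  refine squeeze_zero' (Eventually.of_forall fun _ => norm_nonneg _)
    (eventually_mem_nhdsWithin.mono fun s hs => ?_) h3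
  rw [crossField_sub_crossField (hg.1 s hs) (hf.1 t ht)]
  refine (norm_add_le _ _).trans (add_le_add ?_ ?_)
  · exact norm_crossField_le_left ((hf.1 s hs).sub (hf.1 t ht)).essBdd _
  · exact norm_crossField_le_left (hf.1 t ht).essBdd _

theorem norm_sub_le_of_hasDerivAt {E : Type*} [NormedAddCommGroup E] [NormedSpace ℝ E]
    {f f' : ℝ → E} {L : ℝ} (h : ∀ t ∈ Ioo 0 T, HasDerivAt f (f' t) t)
    (hL : ∀ t ∈ Ioo 0 T, ‖f' t‖ ≤ L) {s t : ℝ} (hs : s ∈ Ioo 0 T) (ht : t ∈ Ioo 0 T) :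
    ‖f t - f s‖ ≤ L * |t - s| := by
  simpa using Convex.norm_image_sub_le_of_norm_hasDerivWithin_le
    (fun x hx => (h x hx).hasDerivWithinAt) hL (convex_Ioo 0 T) hs ht

/-- The time derivative is known only in `L²`. Spatial increments of `f` by `r` are Lipschitz in
time with constant `|r| L`; dividing by `r` and letting `r` tend to `0` gives the claim. -/
theorem norm_weakPartial_sub_le {f' : ℝ → L2Field} {L : ℝ}
    (h : ∀ t ∈ Ioo 0 T, HasDerivAt f (f' t) t) (hf : ∀ t ∈ Ioo 0 T, MemH 1 (f t))
    (hf' : ∀ t ∈ Ioo 0 T, MemH 1 (f' t)) {i : Fin 3}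
    (hL : ∀ t ∈ Ioo 0 T, ‖weakPartial i (f' t)‖ ≤ L) {s t : ℝ} (hs : s ∈ Ioo 0 T)
    (ht : t ∈ Ioo 0 T) :
    ‖weakPartial i (f t) - weakPartial i (f s)‖ ≤ L * |t - s| := by
  have hL0 : 0 ≤ L := (norm_nonneg _).trans (hL s hs)
  have hd := ((hf t ht).isWeakDeriv i).sub ((hf s hs).isWeakDeriv i)
  refine hd.hasDerivAt_zero.le_of_lip' (by positivity) (Eventually.of_forall fun r => ?_)
  have h1 : ∀ t ∈ Ioo 0 T, HasDerivAt (fun t => shift (r • basisVec i) (f t) - f t)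
      (shift (r • basisVec i) (f' t) - f' t) t := fun t ht =>
    ((shift (r • basisVec i)).toContinuousLinearMap.hasFDerivAt.comp_hasDerivAt t
      (h t ht)).sub (h t ht)
  have h2 : ∀ t ∈ Ioo 0 T, ‖shift (r • basisVec i) (f' t) - f' t‖ ≤ |r| * L := fun t ht =>
    (((hf' t ht).isWeakDeriv i).norm_shift_sub_le r).trans (by gcongr; exact hL t ht)
  have h3 := norm_sub_le_of_hasDerivAt h1 h2 hs ht
  simp only [zero_smul, shift_zero, sub_zero, Real.norm_eq_abs, map_sub]
  calc _ = ‖shift (r • basisVec i) (f t) - f t - (shift (r • basisVec i) (f s) - f s)‖ := by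
        congr 1; abel
    _ ≤ _ := h3
    _ = _ := by ring

end continuity

/-! ### The limit system -/

/-- Uniform bounds for a solution of the MHD system. -/
structure MHDBounds (T : ℝ) (u B : ℝ → L2Field) (K : ℝ) : Prop where
  nonneg : 0 ≤ K
  memH_u : ∀ t ∈ Icc 0 T, MemH 3 (u t)
  memH_B : ∀ t ∈ Icc 0 T, MemH 3 (B t)
  bdd_u : ∀ t ∈ Icc 0 T, EssBdd (u t) K
  bdd_B : ∀ t ∈ Icc 0 T, EssBdd (B t) K
  bdd_grad_u : ∀ t ∈ Icc 0 T, ∀ i, EssBdd (weakPartial i (u t)) K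
  bdd_curl_B : ∀ t ∈ Icc 0 T, EssBdd (curl (B t)) K
  norm_B : ∀ t ∈ Icc 0 T, ‖B t‖ ≤ K
  norm_curl : ∀ t ∈ Icc 0 T, ‖curl (B t)‖ ≤ K
  norm_limitE : ∀ t ∈ Icc 0 T, ‖limitE u B t‖ ≤ K
  lipschitz : ∀ s ∈ Ioo 0 T, ∀ t ∈ Ioo 0 T, ‖limitE u B t - limitE u B s‖ ≤ K * |t - s|

theorem hasDerivAt_mem_solenoidal {f : ℝ → L2Field} {T : ℝ} (hf : ∀ t ∈ Icc 0 T, f t ∈ solenoidal)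
    {t : ℝ} (ht : t ∈ Ioo 0 T) {f' : L2Field} (h : HasDerivAt f f' t) : f' ∈ solenoidal := by
  rw [mem_solenoidal_iff]
  intro φ hφ
  have h1 := (divPair φ hφ).hasFDerivAt.comp_hasDerivAt t h
  have h2 : HasDerivAt (divPair φ hφ ∘ f) 0 t := by
    refine (hasDerivAt_const t (0 : ℝ)).congr_of_eventuallyEq ?_
    filter_upwards [Ioo_mem_nhds ht.1 ht.2] with s hs
    exact mem_solenoidal_iff.1 (hf s (Ioo_subset_Icc_self hs)) φ hφ
  exact h1.unique h2

/-- The essential point is that `Ē` is Lipschitz in time. The momentum equation bounds `∂ₜū` in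
`L²`, and the induction equation bounds `∂ₜB̄` in `H¹`, because three spatial derivatives of `ū` and
`B̄` are under control. Hence `∇ × B̄` and `ū × B̄` are Lipschitz with values in `L²`. -/
theorem IsMHDSolution.exists_bounds {m : ℕ} (hm : 3 ≤ m) {T : ℝ} {u B : ℝ → L2Field}
    {u₀ B₀ : L2Field} (h : IsMHDSolution m T u B u₀ B₀) {N : ℝ}
    (hu : ∀ t ∈ Icc 0 T, sobolevNorm m (u t) ≤ N) (hB : ∀ t ∈ Icc 0 T, sobolevNorm m (B t) ≤ N) :
    ∃ K, MHDBounds T u B K := by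
  rcases (Icc (0 : ℝ) T).eq_empty_or_nonempty with hem | ⟨t₀, ht₀⟩
  · refine ⟨0, le_rfl, ?_, ?_, ?_, ?_, ?_, ?_, ?_, ?_, ?_, ?_⟩
    all_goals intro t ht
    all_goals first
      | exact absurd ht (by rw [hem]; exact notMem_empty _)
      | exact absurd (Ioo_subset_Icc_self ht) (by rw [hem]; exact notMem_empty _)
  have hN : 0 ≤ N := (sobolevNorm_nonneg m _).trans (hu t₀ ht₀)
  have u3 : ∀ t ∈ Icc 0 T, MemH 3 (u t) := fun t ht => (h.continuous_u.1 t ht).mono hm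
  have B3 : ∀ t ∈ Icc 0 T, MemH 3 (B t) := fun t ht => (h.continuous_B.1 t ht).mono hm
  have un : ∀ t ∈ Icc 0 T, sobolevNorm 3 (u t) ≤ N := fun t ht =>
    (sobolevNorm_mono hm _).trans (hu t ht)
  have Bn : ∀ t ∈ Icc 0 T, sobolevNorm 3 (B t) ≤ N := fun t ht =>
    (sobolevNorm_mono hm _).trans (hB t ht)
  have un0 : ∀ t ∈ Icc 0 T, ‖u t‖ ≤ N := fun t ht => (norm_le_sobolevNorm 3 _).trans (un t ht)
  have Bn0 : ∀ t ∈ Icc 0 T, ‖B t‖ ≤ N := fun t ht => (norm_le_sobolevNorm 3 _).trans (Bn t ht)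
  set A := embConst * N with hA
  have hA0 : 0 ≤ A := mul_nonneg embConst_nonneg hN
  have bnd : ∀ {f : L2Field}, MemH 3 f → sobolevNorm 3 f ≤ N →
      EssBdd f A ∧ ∀ i, EssBdd (weakPartial i f) A := fun {f} hf hfN =>
    ⟨hf.of_succ.essBdd_of_le ((sobolevNorm_mono (by norm_num) f).trans hfN),
      fun i => (hf.weakPartial i).essBdd_of_le ((sobolevNorm_weakPartial_le 2 i f).trans hfN)⟩
  have ub : ∀ t ∈ Icc 0 T, EssBdd (u t) A := fun t ht => (bnd (u3 t ht) (un t ht)).1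
  have Bb : ∀ t ∈ Icc 0 T, EssBdd (B t) A := fun t ht => (bnd (B3 t ht) (Bn t ht)).1
  have ub' : ∀ t ∈ Icc 0 T, ∀ i, EssBdd (weakPartial i (u t)) A := fun t ht =>
    (bnd (u3 t ht) (un t ht)).2
  have cb : ∀ t ∈ Icc 0 T, EssBdd (curl (B t)) (3 * A) := fun t ht =>
    essBdd_curl (bnd (B3 t ht) (Bn t ht)).2
  have cn : ∀ t ∈ Icc 0 T, ‖curl (B t)‖ ≤ 3 * N := fun t ht =>
    (norm_curl_le _).trans (by linarith [sobolevNorm_mono (by norm_num : 1 ≤ 3) (B t), Bn t ht])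
  choose u' gu hu' hgu hmom using h.momentum
  choose B' hB' hind using h.induction
  have uder : ∀ t (ht : t ∈ Ioo 0 T), ‖u' t ht‖ ≤ 6 * (A * N) := by
    intro t ht
    have ht' := Ioo_subset_Icc_self ht
    have hs := hasDerivAt_mem_solenoidal h.div_u ht (hu' t ht)
    have e0 : u' t ht = crossField (curl (B t)) (B t) - convection (u t) (u t) - gu t ht := by
      rw [← hmom t ht]; abel
    -- `∂ₜū` is itself divergence free, so pairing the equation with it removes the pressure
    -- gradient.
    have e1 : ‖u' t ht‖ ^ 2 =
        inner ℝ (u' t ht) (crossField (curl (B t)) (B t) - convection (u t) (u t)) := by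
      rw [← real_inner_self_eq_norm_sq]
      refine (congrArg (inner ℝ (u' t ht)) e0).trans ?_
      rw [inner_sub_right, inner_pressureGradient hs (hgu t ht), sub_zero]
    have e2 := (norm_crossField_le_left (cb t ht') (B t))
    have e3 := norm_convection_le (f := u t) (ub' t ht')
    have e4 : ‖crossField (curl (B t)) (B t) - convection (u t) (u t)‖ ≤ 6 * (A * N) := by
      refine (norm_sub_le _ _).trans ?_
      have := mul_le_mul_of_nonneg_left (Bn0 t ht') hA0
      have := mul_le_mul_of_nonneg_left (un0 t ht') hA0
      linarith
    have e5 := (real_inner_le_norm (u' t ht)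
      (crossField (curl (B t)) (B t) - convection (u t) (u t)))
    rw [← e1] at e5
    by_contra hcon
    push Not at hcon
    have : 0 < ‖u' t ht‖ := lt_of_le_of_lt (by positivity) hcon
    nlinarith
  have ulip : ∀ s ∈ Ioo 0 T, ∀ t ∈ Ioo 0 T, ‖u t - u s‖ ≤ 6 * (A * N) * |t - s| := by
    intro s hs t ht
    exact norm_sub_le_of_hasDerivAt (f' := fun t => if ht : t ∈ Ioo 0 T then u' t ht else 0)
      (fun t ht => by simpa only [dif_pos ht] using hu' t ht)
      (fun t ht => by simpa only [dif_pos ht] using uder t ht) hs ht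
  have W2 : ∀ t ∈ Icc 0 T, MemH 2 (crossField (u t) (B t)) := fun t ht =>
    crossField_memH_two (u3 t ht) (B3 t ht)
  have B'eq : ∀ t (ht : t ∈ Ioo 0 T),
      B' t ht = laplacian (B t) + curl (crossField (u t) (B t)) := fun t ht => by
    rw [← hind t ht]; abel
  have B'1 : ∀ t (ht : t ∈ Ioo 0 T), MemH 1 (B' t ht) := fun t ht => by
    rw [B'eq]
    have ht' := Ioo_subset_Icc_self ht
    refine MemH.add (MemH.sum fun i _ => ?_) (W2 t ht').curl
    exact ((B3 t ht').weakPartial i).weakPartial i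
  have B'n : ∀ t (ht : t ∈ Ioo 0 T), ‖B' t ht‖ ≤ 3 * N + 6 * (A * N) := by
    intro t ht
    have ht' := Ioo_subset_Icc_self ht
    rw [B'eq]
    refine (norm_add_le _ _).trans (add_le_add ?_ ?_)
    · have : ‖laplacian (B t)‖ ≤ ∑ _i : Fin 3, N :=
        (norm_sum_le _ _).trans (Finset.sum_le_sum fun i _ =>
          (norm_weakPartial_weakPartial_le i i _).trans
            ((sobolevNorm_mono (by norm_num) _).trans (Bn t ht')))
      simpa using this
    · rw [curl_eq]
      have : ‖∑ i, mapField (crossL (basisVec i)) (weakPartial i (crossField (u t) (B t)))‖ ≤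
          ∑ _i : Fin 3, 2 * (A * N) := by
        refine (norm_sum_le _ _).trans (Finset.sum_le_sum fun i _ =>
          (norm_mapField_cross_le i _).trans ?_)
        rw [weakPartial_eq (crossField_isWeakDeriv (u3 t ht').of_succ (B3 t ht').of_succ i)]
        refine (norm_add_le _ _).trans ?_
        have e1 := (norm_crossField_le_left (ub' t ht' i) (B t)).trans
          (mul_le_mul_of_nonneg_left (Bn0 t ht') hA0)
        have e2 := (norm_crossField_le_left (ub t ht') (weakPartial i (B t))).trans
          (mul_le_mul_of_nonneg_left ((norm_weakPartial_le i _).trans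
            ((sobolevNorm_mono (by norm_num) _).trans (Bn t ht'))) hA0)
        linarith
      simp at this
      linarith
  have B'i : ∀ t (ht : t ∈ Ioo 0 T), ∀ k, ‖weakPartial k (B' t ht)‖ ≤ 3 * N + 12 * (A * N) := by
    intro t ht k
    have ht' := Ioo_subset_Icc_self ht
    have hl : MemH 1 (laplacian (B t)) :=
      MemH.sum fun i _ => ((B3 t ht').weakPartial i).weakPartial i
    have hc : MemH 1 (curl (crossField (u t) (B t))) := (W2 t ht').curl
    rw [B'eq, weakPartial_eq ((hl.isWeakDeriv k).add (hc.isWeakDeriv k))]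
    refine (norm_add_le _ _).trans (add_le_add ?_ ?_)
    · rw [laplacian, weakPartial_sum fun i _ => ((B3 t ht').weakPartial i).weakPartial i]
      have : ‖∑ i, weakPartial k (weakPartial i (weakPartial i (B t)))‖ ≤ ∑ _i : Fin 3, N :=
        (norm_sum_le _ _).trans (Finset.sum_le_sum fun i _ =>
          (norm_weakPartial_weakPartial_le k i _).trans
            ((sobolevNorm_weakPartial_le 2 i _).trans (Bn t ht')))
      simpa using this
    · rw [curl_eq, weakPartial_sum fun i _ => ((W2 t ht').weakPartial i).mapField _]
      have : ‖∑ i, weakPartial k (mapField (crossL (basisVec i))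
          (weakPartial i (crossField (u t) (B t))))‖ ≤ ∑ _i : Fin 3, 4 * (A * N) := by
        refine (norm_sum_le _ _).trans (Finset.sum_le_sum fun i _ => ?_)
        rw [weakPartial_mapField ((W2 t ht').weakPartial i)]
        exact (norm_mapField_cross_le i _).trans
          (norm_crossField_weakPartial_le (u3 t ht') (B3 t ht') (un t ht') (Bn t ht') k i)
      simp at this
      linarith
  have Blip : ∀ s ∈ Ioo 0 T, ∀ t ∈ Ioo 0 T, ‖B t - B s‖ ≤ (3 * N + 6 * (A * N)) * |t - s| := by
    intro s hs t ht
    exact norm_sub_le_of_hasDerivAt (f' := fun t => if ht : t ∈ Ioo 0 T then B' t ht else 0)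
      (fun t ht => by simpa only [dif_pos ht] using hB' t ht)
      (fun t ht => by simpa only [dif_pos ht] using B'n t ht) hs ht
  have Blip1 : ∀ s ∈ Ioo 0 T, ∀ t ∈ Ioo 0 T, ∀ i,
      ‖weakPartial i (B t) - weakPartial i (B s)‖ ≤ (3 * N + 12 * (A * N)) * |t - s| := by
    intro s hs t ht i
    exact norm_weakPartial_sub_le (f' := fun t => if ht : t ∈ Ioo 0 T then B' t ht else 0)
      (fun t ht => by simpa only [dif_pos ht] using hB' t ht)
      (fun t ht => (B3 t (Ioo_subset_Icc_self ht)).mono (by norm_num))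
      (fun t ht => by simpa only [dif_pos ht] using B'1 t ht)
      (fun t ht => by simpa only [dif_pos ht] using B'i t ht i) hs ht
  have hAN : 0 ≤ A * N := mul_nonneg hA0 hN
  -- `K` is a sum of nonnegative terms dominating every constant needed. In the Lipschitz bound, `9N
  -- + 36AN` accounts for the curl and the last two summands for the product.
  refine ⟨3 * A + 9 * N + A * N + 36 * (A * N) + A * (6 * (A * N)) + A * (3 * N + 6 * (A * N)),
    by positivity, u3, B3, fun t ht => (ub t ht).mono ?_, fun t ht => (Bb t ht).mono ?_,
    fun t ht i => (ub' t ht i).mono ?_, fun t ht => (cb t ht).mono ?_,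
    fun t ht => (Bn0 t ht).trans ?_,
    fun t ht => (cn t ht).trans ?_, fun t ht => ?_, fun s hs t ht => ?_⟩
  case refine_7 =>
    refine (norm_leray_le _).trans ((norm_sub_le _ _).trans ?_)
    have e1 := cn t ht
    have e2 := (norm_crossField_le_left (ub t ht) (B t)).trans
      (mul_le_mul_of_nonneg_left (Bn0 t ht) hA0)
    have : 0 ≤ A * (6 * (A * N)) := by positivity
    have : 0 ≤ A * (3 * N + 6 * (A * N)) := by positivity
    linarith
  case refine_8 =>
    have hs' := Ioo_subset_Icc_self hs
    have ht' := Ioo_subset_Icc_self ht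
    simp only [limitE]
    rw [← map_sub]
    refine (norm_leray_le _).trans ?_
    rw [sub_sub_sub_comm]
    refine (norm_sub_le _ _).trans ?_
    have e1 : ‖curl (B t) - curl (B s)‖ ≤ 3 * ((3 * N + 12 * (A * N)) * |t - s|) := by
      rw [curl_eq, curl_eq, ← Finset.sum_sub_distrib]
      have : ‖∑ i, (mapField (crossL (basisVec i)) (weakPartial i (B t)) -
          mapField (crossL (basisVec i)) (weakPartial i (B s)))‖ ≤
          ∑ _i : Fin 3, (3 * N + 12 * (A * N)) * |t - s| := by
        refine (norm_sum_le _ _).trans (Finset.sum_le_sum fun i _ => ?_)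
        rw [← map_sub]
        exact (norm_mapField_cross_le i _).trans (Blip1 s hs t ht i)
      simpa using this
    have e2 : ‖crossField (u t) (B t) - crossField (u s) (B s)‖ ≤
        A * (6 * (A * N) * |t - s|) + A * ((3 * N + 6 * (A * N)) * |t - s|) := by
      rw [crossField_sub_crossField (B3 t ht').of_succ (u3 s hs').of_succ]
      refine (norm_add_le _ _).trans (add_le_add ?_ ?_)
      · exact (norm_crossField_le_right (Bb t ht') _).trans
          (mul_le_mul_of_nonneg_left (ulip s hs t ht) hA0)
      · exact (norm_crossField_le_left (ub s hs') _).trans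
          (mul_le_mul_of_nonneg_left (Blip s hs t ht) hA0)
    have : 0 ≤ (3 * A + A * N) * |t - s| := by positivity
    linarith
  all_goals
    have : 0 ≤ A * (6 * (A * N)) := by positivity
    have : 0 ≤ A * (3 * N + 6 * (A * N)) := by positivity
    linarith

/-! ### The energy balance at a fixed time -/

section fixedTime

variable {c : ℝ} {u E B ub Bb Λ : L2Field}

theorem crossField_sub_left {f g h : L2Field} (hh : MemH 2 h) :
    crossField (f - g) h = crossField f h - crossField g h := by
  simp only [crossField_eq]
  exact mulField_sub_left (hh.essBdd.mulMem_right _) (hh.essBdd.mulMem_right _)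

theorem crossField_sub_right {f g h : L2Field} (hg : MemH 2 g) (hh : MemH 2 h) :
    crossField f (g - h) = crossField f g - crossField f h := by
  simp only [crossField_eq]
  exact mulField_sub_right (hg.essBdd.mulMem_right _) (hh.essBdd.mulMem_right _)

/-- The Lorentz forces are split so that the full field `B` multiplies exactly the current error `J
- Jb - Λ`. This term is the one that cancels against Ohm's law; in all others `B` enters only
through `B - Bb`. -/
theorem inner_velocity_eq (hu : MemH 3 u) (hB : MemH 2 B) (hub : MemH 3 ub) (hBb : MemH 2 Bb)
    (su : u ∈ solenoidal) (sub : ub ∈ solenoidal) {J Jb : L2Field} {u' G ub' Gb : L2Field}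
    (hG : IsPressureGradient G) (hGb : IsPressureGradient Gb)
    (h1 : u' + convection u u + G = crossField J B)
    (h2 : ub' + convection ub ub + Gb = crossField Jb Bb) :
    inner ℝ (u - ub) (u' - ub') = inner ℝ (u - ub) (crossField (J - Jb - Λ) B) +
      (inner ℝ (u - ub) (crossField Λ (B - Bb)) + inner ℝ (u - ub) (crossField Λ Bb)) +
      inner ℝ (u - ub) (crossField Jb (B - Bb)) - inner ℝ (u - ub) (convection (u - ub) ub) := by
  have sU := solenoidal.sub_mem su sub
  have e1 : u' - ub' = crossField J B - crossField Jb Bb -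
      (convection u (u - ub) + convection (u - ub) ub) - (G - Gb) := by
    rw [← h1, ← h2, ← convection_sub_convection hu hub]
    abel
  rw [e1, inner_sub_right, inner_sub_right _ G, inner_pressureGradient sU hG,
    inner_pressureGradient sU hGb, inner_sub_right, inner_add_right,
    inner_convection_self hu.of_succ su (hu.sub hub).of_succ]
  have e2 : crossField J B - crossField Jb Bb = crossField (J - Jb - Λ) B +
      (crossField Λ (B - Bb) + crossField Λ Bb) + crossField Jb (B - Bb) := by
    rw [crossField_sub_left hB, crossField_sub_left hB, crossField_sub_right hB hBb,
      crossField_sub_right hB hBb]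
    abel
  rw [e2]
  simp only [inner_add_right]
  ring

/-- Both equations for the magnetic field are curls, and the curl is symmetric. The projection in
`Ē` can be inserted freely because `∇ × (B - Bb)` is divergence free. -/
theorem inner_magnetic_eq (hE : MemH 1 E) (hB : MemH 1 B) (hub : MemH 2 ub) (hBb : MemH 2 Bb)
    (hΛ : MemH 1 Λ) :
    inner ℝ (B - Bb) (-(c • curl E) + curl (curl Bb - crossField ub Bb)) =
      - inner ℝ (curl (B - Bb)) (c • E - leray (curl Bb - crossField ub Bb) - Λ)
        - inner ℝ (B - Bb) (curl Λ) := by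
  have hb : MemH 1 (B - Bb) := hB.sub hBb.of_succ
  have hW : MemH 1 (curl Bb - crossField ub Bb) := hBb.curl.sub (crossField_memH hub hBb)
  rw [inner_add_right, inner_neg_right, inner_smul_right, ← inner_curl_left hb hE,
    ← inner_curl_left hb hW, ← inner_curl_left hb hΛ]
  simp only [inner_sub_right, inner_smul_right, inner_leray_right (curl_mem_solenoidal hb)]
  ring

/-- Ohm's law for the differences. It drives the cancellation in the energy balance and later
converts bounds on the current into bounds on the electric field and back. -/
theorem electric_eq (hB : MemH 2 B) (hub : MemH 2 ub) (hBb : MemH 1 Bb) :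
    c • E - leray (curl Bb - crossField ub Bb) - Λ =
      current c u E B - curl Bb - Λ -
        leray (crossField (u - ub) B + crossField ub (B - Bb)) := by
  rw [← crossField_sub_crossField hB hub, current, map_sub, map_sub,
    leray_eq_self (curl_mem_solenoidal hBb)]
  abel

/-- The left side is the formal time derivative of the relative energy with `Ē` frozen. The curl
terms of the magnetic and electric parts cancel, and the work of the Lorentz force on `u - ub`
cancels the term `(u - ub) × B` from Ohm's law, by cyclicity of the triple product. Hence no norm of
`B` appears. -/
theorem energy_balance (hu : MemH 3 u) (hE : MemH 1 E) (hB : MemH 2 B) (hub : MemH 3 ub)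
    (hBb : MemH 3 Bb) (hΛ : MemH 1 Λ) (su : u ∈ solenoidal) (sub : ub ∈ solenoidal)
    (sΛ : Λ ∈ solenoidal) (sJ : current c u E B ∈ solenoidal) {u' G ub' Gb : L2Field}
    (hG : IsPressureGradient G) (hGb : IsPressureGradient Gb)
    (h1 : u' + convection u u + G = crossField (current c u E B) B)
    (h2 : ub' + convection ub ub + Gb = crossField (curl Bb) Bb) :
    inner ℝ (u - ub) (u' - ub') +
      inner ℝ (B - Bb) (-(c • curl E) + curl (curl Bb - crossField ub Bb)) +
      inner ℝ (c • E - leray (curl Bb - crossField ub Bb) - Λ)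
        (curl (B - Bb) - (current c u E B - curl Bb - Λ)) =
    - ‖current c u E B - curl Bb - Λ‖ ^ 2 +
      inner ℝ (crossField ub (B - Bb)) (current c u E B - curl Bb - Λ) +
      inner ℝ (u - ub) (crossField (curl Bb) (B - Bb)) -
      inner ℝ (u - ub) (convection (u - ub) ub) +
      inner ℝ (u - ub) (crossField Λ (B - Bb)) + inner ℝ (u - ub) (crossField Λ Bb) -
      inner ℝ (B - Bb) (curl Λ) := by
  have hBb2 : MemH 2 Bb := hBb.of_succ
  have sJt : current c u E B - curl Bb - Λ ∈ solenoidal :=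
    solenoidal.sub_mem (solenoidal.sub_mem sJ (curl_mem_solenoidal hBb2.of_succ)) sΛ
  rw [inner_velocity_eq (Λ := Λ) hu hB hub hBb2 su sub hG hGb h1 h2,
    inner_magnetic_eq hE hB.of_succ hub.of_succ hBb2 hΛ, inner_sub_right (c • E - _ - Λ),
    real_inner_comm (curl (B - Bb))]
  have e1 : inner ℝ (c • E - leray (curl Bb - crossField ub Bb) - Λ)
      (current c u E B - curl Bb - Λ) = ‖current c u E B - curl Bb - Λ‖ ^ 2 -
        inner ℝ (current c u E B - curl Bb - Λ) (crossField (u - ub) B) -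
        inner ℝ (crossField ub (B - Bb)) (current c u E B - curl Bb - Λ) := by
    rw [real_inner_comm, electric_eq (u := u) hB hub.of_succ hBb2.of_succ, inner_sub_right,
      real_inner_self_eq_norm_sq, inner_leray_right sJt, inner_add_right,
      real_inner_comm (crossField ub (B - Bb))]
    ring
  have e2 : inner ℝ (u - ub) (crossField (current c u E B - curl Bb - Λ) B) =
      - inner ℝ (current c u E B - curl Bb - Λ) (crossField (u - ub) B) := by
    rw [inner_crossField_cyclic (hB.essBdd.mulMem_right _) (hB.essBdd.mulMem_left _),
      crossField_swap (hB.essBdd.mulMem_right _), inner_neg_right]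
  rw [e1, e2]
  ring

/-- Young's inequality: half of the dissipation absorbs `ub × (B - Bb)`. The amplitude `ℓ` of the
layer is kept as a factor because it is large at time zero and only its time integral is small. -/
theorem energy_balance_le {F : L2Field} {K R a ℓ : ℝ} (hK : 0 ≤ K) (hR : 0 ≤ R) (hℓ : 0 ≤ ℓ)
    (hu : MemH 3 u) (hE : MemH 1 E) (hB : MemH 2 B) (hub : MemH 3 ub)
    (hBb : MemH 3 Bb) (hF : MemH 1 F) (su : u ∈ solenoidal) (sub : ub ∈ solenoidal)
    (sF : F ∈ solenoidal) (sJ : current c u E B ∈ solenoidal) {u' G ub' Gb : L2Field}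
    (hG : IsPressureGradient G) (hGb : IsPressureGradient Gb)
    (h1 : u' + convection u u + G = crossField (current c u E B) B)
    (h2 : ub' + convection ub ub + Gb = crossField (curl Bb) Bb)
    (bub : EssBdd ub K) (bub' : ∀ i, EssBdd (weakPartial i ub) K) (bBb : EssBdd Bb K)
    (bjb : EssBdd (curl Bb) K) (bF : EssBdd F R) (nF : ‖F‖ ≤ a) (nF' : ‖curl F‖ ≤ a) :
    inner ℝ (u - ub) (u' - ub') +
      inner ℝ (B - Bb) (-(c • curl E) + curl (curl Bb - crossField ub Bb)) +
      inner ℝ (c • E - leray (curl Bb - crossField ub Bb) - ℓ • F)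
        (curl (B - Bb) - (current c u E B - curl Bb - ℓ • F)) ≤
    - (1 / 2) * ‖current c u E B - curl Bb - ℓ • F‖ ^ 2 +
      (K ^ 2 + 7 * K + ℓ * (R + 1)) * ((1 / 2) * (‖u - ub‖ ^ 2 + ‖B - Bb‖ ^ 2)) +
      ℓ * ((1 / 2) * (K ^ 2 + 1) * a ^ 2) := by
  have hBb2 : MemH 2 Bb := hBb.of_succ
  rw [energy_balance hu hE hB hub hBb (hF.smul ℓ) su sub (solenoidal.smul_mem ℓ sF) sJ hG hGb h1 h2]
  set U := u - ub
  set b := B - Bb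
  have hb : MemH 2 b := hB.sub hBb2
  set J := current c u E B - curl Bb - ℓ • F
  have c1 : inner ℝ (crossField ub b) J ≤ K * ‖b‖ * ‖J‖ :=
    (real_inner_le_norm _ _).trans (by gcongr; exact norm_crossField_le_left bub _)
  have c2 : inner ℝ U (crossField (curl Bb) b) ≤ ‖U‖ * (K * ‖b‖) :=
    (real_inner_le_norm _ _).trans (by gcongr; exact norm_crossField_le_left bjb _)
  have c3 : - inner ℝ U (convection U ub) ≤ ‖U‖ * (3 * K * ‖U‖) :=
    (neg_le_abs _).trans ((abs_real_inner_le_norm _ _).trans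
      (by gcongr; exact norm_convection_le bub'))
  have e4 : crossField (ℓ • F) b = ℓ • crossField F b := by
    simp only [crossField_eq]
    exact mulField_smul_left ℓ (hb.essBdd.mulMem_right _)
  have e5 : crossField (ℓ • F) Bb = ℓ • crossField F Bb := by
    simp only [crossField_eq]
    exact mulField_smul_left ℓ (hBb2.essBdd.mulMem_right _)
  have c4 : inner ℝ U (crossField F b) ≤ ‖U‖ * (R * ‖b‖) :=
    (real_inner_le_norm _ _).trans (by gcongr; exact norm_crossField_le_left bF _)
  have c5 : inner ℝ U (crossField F Bb) ≤ ‖U‖ * (K * a) :=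
    (real_inner_le_norm _ _).trans
      (by gcongr; exact (norm_crossField_le_right bBb _).trans (by gcongr))
  have c6 : - inner ℝ b (curl F) ≤ ‖b‖ * a :=
    (neg_le_abs _).trans ((abs_real_inner_le_norm _ _).trans (by gcongr))
  rw [e4, e5, curl_smul hF, inner_smul_right, inner_smul_right, inner_smul_right]
  have c7 : inner ℝ U (crossField F b) + inner ℝ U (crossField F Bb) - inner ℝ b (curl F) ≤
      (R + 1) * ((1 / 2) * (‖U‖ ^ 2 + ‖b‖ ^ 2)) + (1 / 2) * (K ^ 2 + 1) * a ^ 2 := by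
    have q1 := mul_nonneg hR (sq_nonneg (‖U‖ - ‖b‖))
    nlinarith [sq_nonneg (‖U‖ - K * a), sq_nonneg (‖b‖ - a)]
  have c8 := mul_le_mul_of_nonneg_left c7 hℓ
  have c9 : K * ‖b‖ * ‖J‖ ≤ (1 / 2) * ‖J‖ ^ 2 + (1 / 2) * K ^ 2 * ‖b‖ ^ 2 := by
    nlinarith [sq_nonneg (K * ‖b‖ - ‖J‖)]
  have c10 : ‖U‖ * (K * ‖b‖) + ‖U‖ * (3 * K * ‖U‖) + (1 / 2) * K ^ 2 * ‖b‖ ^ 2 ≤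
      (K ^ 2 + 7 * K) * ((1 / 2) * (‖U‖ ^ 2 + ‖b‖ ^ 2)) := by
    nlinarith [mul_nonneg hK (sq_nonneg (‖U‖ - ‖b‖)), mul_nonneg hK (sq_nonneg ‖b‖),
      mul_nonneg (sq_nonneg K) (sq_nonneg ‖U‖)]
  linarith

end fixedTime

/-! ### A differential inequality -/

/-- A continuous function which at every point is touched from above, on the right, by a function
with nonpositive derivative is antitone. -/
theorem le_of_touching_above {f : ℝ → ℝ} {T : ℝ} (hf : ContinuousOn f (Icc 0 T))
    (h : ∀ t ∈ Ioo 0 T, ∃ (H : ℝ → ℝ) (d : ℝ), H t = f t ∧ (∀ᶠ z in 𝓝[>] t, f z ≤ H z) ∧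
      HasDerivAt H d t ∧ d ≤ 0) {t : ℝ} (ht : t ∈ Icc 0 T) : f t ≤ f 0 := by
  rcases ht.1.eq_or_lt with rfl | ht0
  · exact le_rfl
  have key : ∀ s ∈ Ioo 0 t, f t ≤ f s := by
    intro s hs
    have hsub : Icc s t ⊆ Icc 0 T := Icc_subset_Icc hs.1.le ht.2
    refine image_le_of_liminf_slope_right_le_deriv_boundary (B := fun _ => f s)
      (B' := fun _ => 0) (hf.mono hsub) le_rfl continuousOn_const
      (fun x _ => hasDerivWithinAt_const _ _ _) (fun x hx r hr => ?_) (right_mem_Icc.2 hs.2.le)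
    obtain ⟨H, d, h1, h2, h3, h4⟩ := h x ⟨hs.1.trans_le hx.1, hx.2.trans_le ht.2⟩
    have h5 : Tendsto (slope H x) (𝓝[>] x) (𝓝 d) :=
      (hasDerivAt_iff_tendsto_slope.1 h3).mono_left (nhdsWithin_mono _ fun z hz => ne_of_gt hz)
    refine Eventually.frequently ?_
    filter_upwards [h5.eventually_lt_const (h4.trans_lt hr), h2, self_mem_nhdsWithin]
      with z hz1 hz2 hz3
    refine lt_of_le_of_lt ?_ hz1
    rw [slope_def_field, slope_def_field, h1]
    have : 0 < z - x := sub_pos.2 hz3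
    gcongr
  -- The touching functions exist only at interior times, so the comparison is made from `s > 0` and
  -- `s` is sent to `0` by continuity.
  have hc : ContinuousWithinAt f (Ioo 0 t) 0 :=
    (hf 0 ⟨le_rfl, ht.1.trans ht.2⟩).mono (Ioo_subset_Icc_self.trans (Icc_subset_Icc_right ht.2))
  have : (𝓝[Ioo 0 t] (0 : ℝ)).NeBot := left_nhdsWithin_Ioo_neBot ht0
  exact ge_of_tendsto hc (eventually_mem_nhdsWithin.mono key)

theorem MHDBounds.continuousOn_limitE {m : ℕ} (hm : 3 ≤ m) {T : ℝ} {u B : ℝ → L2Field}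
    {u₀ B₀ : L2Field} (h : IsMHDSolution m T u B u₀ B₀) : ContinuousOn (limitE u B) (Icc 0 T) :=
  leray.continuous.comp_continuousOn
    ((h.continuous_B.mono (by omega)).curl.sub
      ((h.continuous_u.mono (by omega)).crossField (h.continuous_B.mono (by omega))))

theorem IsEulerMaxwellSolution.continuousOn_current {m : ℕ} (hm : 3 ≤ m) {c T : ℝ}
    {u E B : ℝ → L2Field} {u₀ E₀ B₀ : L2Field} (h : IsEulerMaxwellSolution m c T u E B u₀ E₀ B₀) :
    ContinuousOn (fun t => current c (u t) (E t) (B t)) (Icc 0 T) :=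
  (h.continuous_E.continuousOn.const_smul c).add (leray.continuous.comp_continuousOn
    ((h.continuous_u.mono (by omega)).crossField (h.continuous_B.mono (by omega))))

theorem hasDerivAt_integral_of_continuousOn {g : ℝ → ℝ} {T : ℝ} (hg : ContinuousOn g (Icc 0 T)) :
    ContinuousOn (fun t => ∫ s in (0 : ℝ)..t, g s) (Icc 0 T) ∧
      ∀ t ∈ Ioo 0 T, HasDerivAt (fun t => ∫ s in (0 : ℝ)..t, g s) (g t) t := by
  rcases lt_or_ge T 0 with hT | hT
  · simp [Icc_eq_empty_of_lt hT, Ioo_eq_empty_of_le hT.le]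
  have hi : IntervalIntegrable g volume 0 T := hg.intervalIntegrable_of_Icc hT
  refine ⟨?_, fun t ht => ?_⟩
  · have := intervalIntegral.continuousOn_primitive_interval (μ := volume) (a := (0 : ℝ))
      (b := T) (f := g)
      (by rw [uIcc_of_le hT]; exact hg.integrableOn_Icc)
    rwa [uIcc_of_le hT] at this
  · have hn : Icc 0 T ∈ 𝓝 t := Icc_mem_nhds ht.1 ht.2
    refine intervalIntegral.integral_hasDerivAt_right
      ((hg.mono (Icc_subset_Icc_right ht.2.le)).intervalIntegrable_of_Icc ht.1.le) ?_
      (hg.continuousAt hn)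
    exact (hg.mono Ioo_subset_Icc_self).stronglyMeasurableAtFilter isOpen_Ioo t ht

/-! ### The layer-corrected energy estimate -/

/-- The initial layer `c e^{-c² t} F` of the electric field. -/
def layer (c : ℝ) (F : L2Field) (t : ℝ) : L2Field := (c * Real.exp (-(c ^ 2 * t))) • F

section energy

variable {m : ℕ} {c T K R a : ℝ} {u E B ub Bb : ℝ → L2Field} {u₀ E₀ B₀ ub₀ Bb₀ F : L2Field}

/-- `Λ' = -c² Λ` is the fast part of Ampère's law for `cE`. Subtracting `Λ` from `cE` therefore
amounts to subtracting the same `Λ` from the current. -/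
theorem hasDerivAt_layer (c t : ℝ) (F : L2Field) :
    HasDerivAt (layer c F) (-(c ^ 2) • layer c F t) t := by
  have h1 : HasDerivAt (fun s => c * Real.exp (-(c ^ 2 * s)))
      (c * (Real.exp (-(c ^ 2 * t)) * -(c ^ 2 * 1))) t :=
    ((((hasDerivAt_id t).const_mul (c ^ 2)).neg).exp).const_mul c
  have h2 := h1.smul_const F
  refine h2.congr_deriv ?_
  rw [layer, smul_smul]
  congr 1
  ring

theorem continuous_layer (c : ℝ) (F : L2Field) : Continuous (layer c F) :=
  continuous_iff_continuousAt.2 fun t => (hasDerivAt_layer c t F).continuousAt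

/-- `Ē` enters the pairing with `w'` but is not differentiated, since it is only Lipschitz in time.
The identity `∇ × ∇ × B̄ = -ΔB̄` turns the induction equation into the curl form required by the
balance. -/
theorem energy_hasDerivAt (hm : 3 ≤ m) (hc : 0 < c) (hR : 0 ≤ R)
    (h : IsEulerMaxwellSolution m c T u E B u₀ E₀ B₀) (hb : IsMHDSolution m T ub Bb ub₀ Bb₀)
    (hK : MHDBounds T ub Bb K) (hF : MemH 1 F) (sF : F ∈ solenoidal) (bF : EssBdd F R)
    (nF : ‖F‖ ≤ a) (nF' : ‖curl F‖ ≤ a) {t : ℝ} (ht : t ∈ Ioo 0 T) :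
    ∃ U' b' w' : L2Field, HasDerivAt (fun s => u s - ub s) U' t ∧
      HasDerivAt (fun s => B s - Bb s) b' t ∧
      HasDerivAt (fun s => c • E s - layer c F s) (c ^ 2 • w') t ∧
      inner ℝ (u t - ub t) U' + inner ℝ (B t - Bb t) b' +
        inner ℝ (c • E t - limitE ub Bb t - layer c F t) w' ≤
      - (1 / 2) * ‖current c (u t) (E t) (B t) - curl (Bb t) - layer c F t‖ ^ 2 +
      (K ^ 2 + 7 * K + (c * Real.exp (-(c ^ 2 * t))) * (R + 1)) *
        ((1 / 2) * (‖u t - ub t‖ ^ 2 + ‖B t - Bb t‖ ^ 2)) +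
      (c * Real.exp (-(c ^ 2 * t))) * ((1 / 2) * (K ^ 2 + 1) * a ^ 2) := by
  have ht' := Ioo_subset_Icc_self ht
  obtain ⟨u', G, hu', hG, h1⟩ := h.euler t ht
  obtain ⟨ub', Gb, hub', hGb, h2⟩ := hb.momentum t ht
  obtain ⟨E', hE', h3⟩ := h.ampere t ht
  obtain ⟨B', hB', h4⟩ := h.faraday t ht
  obtain ⟨Bb', hBb', h5⟩ := hb.induction t ht
  have Bb3 := hK.memH_B t ht'
  have ub3 := hK.memH_u t ht'
  have B1 : MemH 1 (B t) := (h.continuous_B.1 t ht').mono (by omega)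
  have e4 : B' = -(c • curl (E t)) := by
    have : B' = c • ((1 / c) • B' + curl (E t)) - c • curl (E t) := by
      rw [smul_add, smul_smul, mul_one_div_cancel hc.ne', one_smul]; abel
    rw [this, h4, smul_zero, zero_sub]
  have e3 : E' = c • (curl (B t) - current c (u t) (E t) (B t)) := by
    have : E' = c • ((1 / c) • E' - curl (B t)) + c • curl (B t) := by
      rw [smul_sub, smul_smul, mul_one_div_cancel hc.ne', one_smul]; abel
    rw [this, h3, smul_sub, smul_neg]; abel
  have e5 : Bb' = - curl (curl (Bb t) - crossField (ub t) (Bb t)) := by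
    rw [curl_sub Bb3.of_succ.curl (crossField_memH ub3.of_succ Bb3.of_succ),
      curl_curl Bb3.of_succ (hb.div_B t ht'), ← h5]
    abel
  refine ⟨u' - ub', B' - Bb', curl (B t - Bb t) -
      (current c (u t) (E t) (B t) - curl (Bb t) - layer c F t), hu'.sub hub', hB'.sub hBb', ?_,
    energy_balance_le hK.nonneg hR (mul_nonneg hc.le (Real.exp_pos _).le)
      ((h.continuous_u.1 t ht').mono hm) ((h.continuous_E.1 t ht').mono (by omega))
      ((h.continuous_B.1 t ht').mono (by omega)) ub3 Bb3 hF (h.div_u t ht') (hb.div_u t ht')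
      sF (h.div_j t ht') hG hGb h1 h2 (hK.bdd_u t ht') (hK.bdd_grad_u t ht') (hK.bdd_B t ht')
      (hK.bdd_curl_B t ht') bF nF nF' |>.trans' (le_of_eq ?_)⟩
  · refine ((hE'.const_smul c).sub (hasDerivAt_layer c t F)).congr_deriv ?_
    rw [e3, curl_sub B1 (Bb3.mono (by norm_num)), smul_smul, ← pow_two, neg_smul, sub_neg_eq_add,
      ← smul_add]
    congr 1
    abel
  · rw [e4, e5, sub_neg_eq_add]
    rfl

/-- Here `x` stands for the integrating factor and `y` for a constant below it, so that half of the
dissipation survives with a weight independent of time. -/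
theorem weighted_deriv_nonpos {x y α φ d j k : ℝ} (hx : 0 ≤ x) (hyx : y ≤ x) (hx1 : x ≤ 1)
    (hj : 0 ≤ j) (hk : 0 ≤ k) (hd : d ≤ -(1 / 2) * j + α * φ + k) :
    x * -α * φ + x * d - k + y * ((1 / 2) * j) ≤ 0 := by
  have q1 := mul_le_mul_of_nonneg_left hd hx
  have q2 := mul_le_mul_of_nonneg_right hyx hj
  have q3 := mul_le_mul_of_nonneg_right hx1 hk
  linarith

set_option maxHeartbeats 1000000 in
/-- The basic energy estimate for the difference between a solution of the Euler–Maxwell system and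
a solution of the MHD system, the initial layer generated by `F` being subtracted. -/
theorem energy_estimate (hm : 3 ≤ m) (hT : 0 ≤ T) (hR : 0 ≤ R) (hc : R + 1 ≤ c)
    (h : IsEulerMaxwellSolution m c T u E B u₀ E₀ B₀) (hb : IsMHDSolution m T ub Bb ub₀ Bb₀)
    (hK : MHDBounds T ub Bb K) (hF : MemH 1 F) (sF : F ∈ solenoidal) (bF : EssBdd F R)
    (nF : ‖F‖ ≤ a) (nF' : ‖curl F‖ ≤ a) {t : ℝ} (ht : t ∈ Icc 0 T) :
    (‖u t - ub t‖ ^ 2 + ‖B t - Bb t‖ ^ 2 +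
        (c ^ 2)⁻¹ * ‖c • E t - limitE ub Bb t - layer c F t‖ ^ 2) +
      ∫ s in (0 : ℝ)..t, ‖current c (u s) (E s) (B s) - curl (Bb s) - layer c F s‖ ^ 2 ≤
    4 * Real.exp ((K ^ 2 + 7 * K + 1) * T + 1) * (1 + K ^ 2) * (1 + T) *
      (‖u₀ - ub₀‖ ^ 2 + ‖B₀ - Bb₀‖ ^ 2 + ‖E₀ - F‖ ^ 2 + a ^ 2 / c + (c ^ 2)⁻¹) := by
  have hc0 : 0 < c := by linarith
  have hK0 := hK.nonneg
  set A := K ^ 2 + 7 * K + 1 with hA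
  set L : ℝ → ℝ := fun t => (1 - Real.exp (-(c ^ 2 * t))) / c with hL
  have hLd : ∀ t, HasDerivAt L (c * Real.exp (-(c ^ 2 * t))) t := by
    intro t
    have h1 : HasDerivAt (fun s => (1 - Real.exp (-(c ^ 2 * s))) / c)
      ((-(Real.exp (-(c ^ 2 * t)) * -(c ^ 2 * 1))) / c) t :=
      (((((hasDerivAt_id t).const_mul (c ^ 2)).neg).exp).const_sub 1).div_const c
    convert h1 using 1
    field_simp
  have hLc : Continuous L := continuous_iff_continuousAt.2 fun t => (hLd t).continuousAt
  have hL0 : ∀ t, 0 ≤ t → 0 ≤ L t := fun t ht => by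
    have : Real.exp (-(c ^ 2 * t)) ≤ 1 := Real.exp_le_one_iff.2 (by
      have := mul_nonneg (sq_nonneg c) ht; linarith)
    exact div_nonneg (by linarith) hc0.le
  have hL1 : ∀ t, L t ≤ 1 / c := fun t => by
    have := Real.exp_pos (-(c ^ 2 * t))
    simp only [hL]
    gcongr
    linarith
  -- The exponent of the integrating factor. As `L` is the time integral of `c exp(-c² s)` and is at
  -- most `1/c`, the layer contributes at most `(R + 1)/c ≤ 1`; this is the purpose of `R + 1 ≤ c`.
  set G : ℝ → ℝ := fun t => A * t + (R + 1) * L t with hG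
  have hGd : ∀ t, HasDerivAt G (A * 1 + (R + 1) * (c * Real.exp (-(c ^ 2 * t)))) t := fun t =>
    ((hasDerivAt_id t).const_mul A).add ((hLd t).const_mul (R + 1))
  have hGc : Continuous G := continuous_iff_continuousAt.2 fun t => (hGd t).continuousAt
  set g := A * T + 1 with hg
  have hA0 : 0 ≤ A := by positivity
  have hGle : ∀ t ∈ Icc 0 T, G t ≤ g := fun t ht => by
    have e1 := mul_le_mul_of_nonneg_left ht.2 hA0
    have e2 := mul_le_mul_of_nonneg_left (hL1 t) (by linarith : 0 ≤ R + 1)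
    have e3 : (R + 1) * (1 / c) ≤ 1 := by rw [mul_one_div, div_le_one hc0]; exact hc
    simp only [hG, hg]
    linarith
  have hG0 : ∀ t ∈ Icc 0 T, 0 ≤ G t := fun t ht => by
    have := hL0 t ht.1
    have := ht.1
    simp only [hG]
    positivity
  set ε : ℝ → L2Field := fun t => c • E t - limitE ub Bb t - layer c F t with hε
  set J : ℝ → L2Field := fun t => current c (u t) (E t) (B t) - curl (Bb t) - layer c F t with hJ
  set Φ : ℝ → ℝ := fun t => (1 / 2) * (‖u t - ub t‖ ^ 2 + ‖B t - Bb t‖ ^ 2 +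
    (c ^ 2)⁻¹ * ‖ε t‖ ^ 2) with hΦ
  have hJc : ContinuousOn J (Icc 0 T) :=
    ((h.continuousOn_current hm).sub (hb.continuous_B.mono (by omega)).curl).sub
      (continuous_layer c F).continuousOn
  obtain ⟨hIc, hId⟩ := hasDerivAt_integral_of_continuousOn (g := fun s => ‖J s‖ ^ 2)
    (hJc.norm.pow 2)
  set I : ℝ → ℝ := fun t => ∫ s in (0 : ℝ)..t, ‖J s‖ ^ 2 with hI
  have hεc : ContinuousOn ε (Icc 0 T) :=
    ((h.continuous_E.continuousOn.const_smul c).sub (MHDBounds.continuousOn_limitE hm hb)).sub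
      (continuous_layer c F).continuousOn
  have hΦc : ContinuousOn Φ (Icc 0 T) :=
    ((((h.continuous_u.continuousOn.sub hb.continuous_u.continuousOn).norm.pow 2).add
      ((h.continuous_B.continuousOn.sub hb.continuous_B.continuousOn).norm.pow 2)).add
      ((hεc.norm.pow 2).const_mul _)).const_mul _
  have hΦ0 : ∀ t, 0 ≤ Φ t := fun t => by positivity
  set k₁ := (1 / 2) * (K ^ 2 + 1) * a ^ 2 with hk₁
  set k₂ := (1 / 2) * ((c ^ 2)⁻¹ * K ^ 2) with hk₂
  -- The nonincreasing quantity: weighted energy plus accumulated dissipation. `k₁ L` pays for the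
  -- source terms of the layer, and `k₂ t` for the motion of `Ē`.
  set f : ℝ → ℝ := fun t => Real.exp (-G t) * Φ t - k₁ * L t - k₂ * t +
    Real.exp (-g) * ((1 / 2) * I t) with hf
  have hfc : ContinuousOn f (Icc 0 T) :=
    (((hGc.neg.rexp.continuousOn.mul hΦc).sub (hLc.const_mul k₁).continuousOn).sub
      (continuous_id.const_mul k₂).continuousOn).add ((hIc.const_mul _).const_mul _)
  have key : f t ≤ f 0 := by
    refine le_of_touching_above hfc (fun t ht => ?_) ht
    have ht' := Ioo_subset_Icc_self ht
    obtain ⟨U', b', w', hU', hb', hw', hle⟩ :=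
      energy_hasDerivAt hm hc0 hR h hb hK hF sF bF nF nF' ht
    set ℓ := c * Real.exp (-(c ^ 2 * t)) with hℓ
    have hℓ0 : 0 ≤ ℓ := by positivity
    -- A differentiable majorant of the energy to the right of `t`, with `Ē` frozen at time `t`. If
    -- `Ē` moves by at most `K s` with `s = z - t`, then `(x + K s)² ≤ (1 + s) x² + (s + s²) K²`.
    -- Its derivative at `t` costs the `1` in `A` and the constant `k₂`.
    set Θ : ℝ → ℝ := fun z => (1 / 2) * (‖u z - ub z‖ ^ 2 + ‖B z - Bb z‖ ^ 2 +
      (c ^ 2)⁻¹ * ((1 + (z - t)) * ‖c • E z - layer c F z - limitE ub Bb t‖ ^ 2 +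
        ((z - t) + (z - t) ^ 2) * K ^ 2)) with hΘ
    have hεt : c • E t - layer c F t - limitE ub Bb t = ε t := by simp only [hε]; abel
    have hz : HasDerivAt (fun z => z - t) 1 t := (hasDerivAt_id t).sub_const t
    have hΘd : HasDerivAt Θ ((1 / 2) * (2 * inner ℝ (u t - ub t) U' +
        2 * inner ℝ (B t - Bb t) b' + (c ^ 2)⁻¹ *
        ((1 * ‖c • E t - layer c F t - limitE ub Bb t‖ ^ 2 + (1 + (t - t)) *
          (2 * inner ℝ (c • E t - layer c F t - limitE ub Bb t) (c ^ 2 • w'))) +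
          (1 + ((2 : ℕ) : ℝ) * (t - t) ^ (2 - 1) * 1) * K ^ 2))) t :=
      ((hU'.norm_sq.add hb'.norm_sq).add ((((hz.const_add 1).mul
        (hw'.sub_const (limitE ub Bb t)).norm_sq).add
        ((hz.add (hz.pow 2)).mul_const (K ^ 2))).const_mul _)).const_mul _
    have hΘt : Θ t = Φ t := by
      simp only [hΘ, hΦ, hεt, sub_self]
      ring
    generalize hd : (1 / 2) * (2 * inner ℝ (u t - ub t) U' +
        2 * inner ℝ (B t - Bb t) b' + (c ^ 2)⁻¹ *
        ((1 * ‖c • E t - layer c F t - limitE ub Bb t‖ ^ 2 + (1 + (t - t)) *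
          (2 * inner ℝ (c • E t - layer c F t - limitE ub Bb t) (c ^ 2 • w'))) +
          (1 + ((2 : ℕ) : ℝ) * (t - t) ^ (2 - 1) * 1) * K ^ 2)) = d at hΘd
    have hdeq : d = inner ℝ (u t - ub t) U' + inner ℝ (B t - Bb t) b' + inner ℝ (ε t) w' +
        (1 / 2) * ((c ^ 2)⁻¹ * ‖ε t‖ ^ 2) + k₂ := by
      rw [← hd, hεt, inner_smul_right]
      simp only [sub_self]
      field_simp
      simp only [hk₂]
      field_simp
      ring
    have hdle : d ≤ -(1 / 2) * ‖J t‖ ^ 2 + (A + (R + 1) * ℓ) * Φ t + ℓ * k₁ + k₂ := by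
      rw [hdeq]
      have e1 : 0 ≤ (K ^ 2 + 7 * K + ℓ * (R + 1)) * ((1 / 2) * ((c ^ 2)⁻¹ * ‖ε t‖ ^ 2)) := by
        positivity
      have e2 : 0 ≤ (1 / 2) * (‖u t - ub t‖ ^ 2 + ‖B t - Bb t‖ ^ 2) := by positivity
      have e3 : inner ℝ (u t - ub t) U' + inner ℝ (B t - Bb t) b' + inner ℝ (ε t) w' ≤
        -(1 / 2) * ‖J t‖ ^ 2 + (K ^ 2 + 7 * K + ℓ * (R + 1)) *
          ((1 / 2) * (‖u t - ub t‖ ^ 2 + ‖B t - Bb t‖ ^ 2)) + ℓ * k₁ := hle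
      have e4 : (A + (R + 1) * ℓ) * Φ t = (K ^ 2 + 7 * K + ℓ * (R + 1) + 1) *
          ((1 / 2) * (‖u t - ub t‖ ^ 2 + ‖B t - Bb t‖ ^ 2) +
            (1 / 2) * ((c ^ 2)⁻¹ * ‖ε t‖ ^ 2)) := by
        simp only [hA, hΦ]
        ring
      rw [e4]
      linarith
    refine ⟨fun z => Real.exp (-G z) * Θ z - k₁ * L z - k₂ * z + Real.exp (-g) * ((1 / 2) * I z),
      Real.exp (-G t) * -(A * 1 + (R + 1) * ℓ) * Θ t + Real.exp (-G t) * d - k₁ * ℓ - k₂ * 1 +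
        Real.exp (-g) * ((1 / 2) * ‖J t‖ ^ 2), ?_, ?_, (((((hGd t).neg.exp).mul hΘd).sub ((hLd t).const_mul k₁)).sub
        ((hasDerivAt_id t).const_mul k₂)).add (((hId t ht).const_mul _).const_mul _), ?_⟩
    · simp only [hf, hΘt]
    · filter_upwards [self_mem_nhdsWithin, Ioo_mem_nhdsGT ht.2] with z hz1 hz2
      have hz3 : z ∈ Ioo 0 T := ⟨ht.1.trans hz1, hz2.2⟩
      have hz0 : 0 < z - t := sub_pos.2 hz1
      simp only [hf]
      gcongr
      simp only [hΦ, hΘ]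
      gcongr
      have e1 := hK.lipschitz t ht z hz3
      rw [abs_of_pos hz0] at e1
      have e2 : ‖ε z‖ ≤ ‖c • E z - layer c F z - limitE ub Bb t‖ + K * (z - t) := by
        have : ε z = (c • E z - layer c F z - limitE ub Bb t) -
            (limitE ub Bb z - limitE ub Bb t) := by simp only [hε]; abel
        rw [this]
        exact (norm_sub_le _ _).trans (by linarith)
      have e3 : 0 ≤ ‖ε z‖ := norm_nonneg _
      set x := ‖c • E z - layer c F z - limitE ub Bb t‖
      calc ‖ε z‖ ^ 2 ≤ (x + K * (z - t)) ^ 2 := by gcongr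
        _ ≤ _ := by nlinarith [mul_nonneg hz0.le (sq_nonneg (x - K))]
    · have p1 : Real.exp (-g) ≤ Real.exp (-G t) :=
        Real.exp_le_exp.2 (neg_le_neg (hGle t ht'))
      have p2 : Real.exp (-G t) ≤ 1 := Real.exp_le_one_iff.2 (neg_nonpos.2 (hG0 t ht'))
      have p3 := Real.exp_pos (-G t)
      have hk : 0 ≤ ℓ * k₁ + k₂ := by positivity
      have := weighted_deriv_nonpos p3.le p1 p2 (sq_nonneg ‖J t‖) hk (hdle.trans_eq (add_assoc _ _ _))
      rw [hΘt]
      linarith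
  have hI0 : I 0 = 0 := intervalIntegral.integral_same
  have hLz : L 0 = 0 := by simp [hL]
  have hGz : G 0 = 0 := by simp [hG, hLz]
  have hf0 : f 0 = Φ 0 := by simp [hf, hI0, hLz, hGz]
  have hIt : 0 ≤ I t := intervalIntegral.integral_nonneg ht.1 fun _ _ => by positivity
  -- At time zero the layer equals `c F`, so the error is `c (E₀ - F) - Ē(0)`; the weight `c⁻²`
  -- compensates the factor `c²`.
  have hε0 : (c ^ 2)⁻¹ * ‖ε 0‖ ^ 2 ≤ 2 * ‖E₀ - F‖ ^ 2 + 2 * K ^ 2 * (c ^ 2)⁻¹ := by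
    have e1 : ε 0 = c • (E₀ - F) - limitE ub Bb 0 := by
      simp only [hε, layer, h.initial_E, mul_zero, neg_zero, Real.exp_zero, mul_one, smul_sub]
      abel
    have e2 : ‖ε 0‖ ≤ c * ‖E₀ - F‖ + K := by
      rw [e1]
      refine (norm_sub_le _ _).trans (add_le_add ?_ (hK.norm_limitE 0 ⟨le_rfl, hT⟩))
      rw [norm_smul, Real.norm_of_nonneg hc0.le]
    have e3 : ‖ε 0‖ ^ 2 ≤ c ^ 2 * (2 * ‖E₀ - F‖ ^ 2) + 2 * K ^ 2 := by
      nlinarith [norm_nonneg (ε 0), sq_nonneg (c * ‖E₀ - F‖ - K)]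
    have e4 := mul_le_mul_of_nonneg_left e3 (by positivity : 0 ≤ (c ^ 2)⁻¹)
    rw [mul_add, inv_mul_cancel_left₀ (by positivity)] at e4
    linarith
  have hΦz : Φ 0 = (1 / 2) * (‖u₀ - ub₀‖ ^ 2 + ‖B₀ - Bb₀‖ ^ 2 + (c ^ 2)⁻¹ * ‖ε 0‖ ^ 2) := by
    simp only [hΦ, h.initial_u, h.initial_B, hb.initial_u, hb.initial_B]
  set X := ‖u₀ - ub₀‖ ^ 2 + ‖B₀ - Bb₀‖ ^ 2 + ‖E₀ - F‖ ^ 2 + a ^ 2 / c + (c ^ 2)⁻¹ with hX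
  have hfin : Real.exp (-g) * (Φ t + (1 / 2) * I t) ≤ 2 * ((1 + K ^ 2) * (1 + T) * X) := by
    have p1 : Real.exp (-g) * Φ t ≤ Real.exp (-G t) * Φ t :=
      mul_le_mul_of_nonneg_right (Real.exp_le_exp.2 (neg_le_neg (hGle t ht))) (hΦ0 t)
    have p2 : k₁ * L t ≤ (1 / 2) * (K ^ 2 + 1) * (a ^ 2 / c) := by
      refine (mul_le_mul_of_nonneg_left (hL1 t) (by positivity)).trans (le_of_eq ?_)
      simp only [hk₁]
      ring
    have p3 : k₂ * t ≤ (1 / 2) * ((c ^ 2)⁻¹ * K ^ 2) * T :=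
      mul_le_mul_of_nonneg_left ht.2 (by positivity)
    simp only [hf] at key
    have hf0' : f 0 = Real.exp (-G 0) * Φ 0 - k₁ * L 0 - k₂ * 0 +
      Real.exp (-g) * ((1 / 2) * I 0) := rfl
    rw [← hf0', hf0, hΦz] at key
    have hx1 : 0 ≤ ‖u₀ - ub₀‖ ^ 2 := by positivity
    have hx2 : 0 ≤ ‖B₀ - Bb₀‖ ^ 2 := by positivity
    have hx3 : 0 ≤ ‖E₀ - F‖ ^ 2 := by positivity
    have hx4 : 0 ≤ a ^ 2 / c := by positivity
    have hx5 : 0 ≤ (c ^ 2)⁻¹ := by positivity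
    have hX0 : 0 ≤ X := by positivity
    have r1 : X + K ^ 2 * X + T * K ^ 2 * X ≤ (1 + K ^ 2) * (1 + T) * X := by
      have := mul_nonneg hT hX0
      nlinarith
    have r2 : K ^ 2 * (a ^ 2 / c + (c ^ 2)⁻¹) ≤ K ^ 2 * X := by
      gcongr
      simp only [hX]
      linarith
    have r3 : T * K ^ 2 * (c ^ 2)⁻¹ ≤ T * K ^ 2 * X := by
      gcongr
      simp only [hX]
      linarith
    have r4 : 0 ≤ K ^ 2 * (a ^ 2 / c) := by positivity
    have r5 : 0 ≤ K ^ 2 * (c ^ 2)⁻¹ := by positivity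
    have r6 : 0 ≤ T * K ^ 2 * (c ^ 2)⁻¹ := by positivity
    simp only [hX] at r1 r2 r3 ⊢
    linarith
  have hexp : Real.exp g * Real.exp (-g) = 1 := by rw [← Real.exp_add]; simp
  have hmul := mul_le_mul_of_nonneg_left hfin (Real.exp_pos g).le
  rw [← mul_assoc, hexp, one_mul] at hmul
  have : Φ t + (1 / 2) * I t = (1 / 2) * ((‖u t - ub t‖ ^ 2 + ‖B t - Bb t‖ ^ 2 +
    (c ^ 2)⁻¹ * ‖ε t‖ ^ 2) + I t) := by simp only [hΦ]; ring
  rw [this] at hmul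
  linarith

end energy

/-! ### Norms on space-time -/

theorem eLpNorm_timeMeasure {p T : ℝ} (hp : 0 < p) (f : ℝ → L2Field) :
    eLpNorm f (ENNReal.ofReal p) (timeMeasure T) =
      (∫⁻ t, ‖f t‖ₑ ^ p ∂timeMeasure T) ^ (1 / p) := by
  rw [eLpNorm_eq_lintegral_rpow_enorm_toReal (ENNReal.ofReal_pos.2 hp).ne' ENNReal.ofReal_ne_top,
    ENNReal.toReal_ofReal hp.le]

theorem timeMeasure_univ (T : ℝ) : timeMeasure T univ = ENNReal.ofReal T := by
  simp [timeMeasure]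

theorem ae_timeMeasure {T : ℝ} {P : ℝ → Prop} (h : ∀ t ∈ Ioo 0 T, P t) :
    ∀ᵐ t ∂timeMeasure T, P t :=
  (ae_restrict_iff' measurableSet_Ioo).2 (Eventually.of_forall h)

theorem aestronglyMeasurable_of_continuousOn {E : Type*} [NormedAddCommGroup E] {f : ℝ → E} {T : ℝ}
    (hf : ContinuousOn f (Icc 0 T)) : AEStronglyMeasurable f (timeMeasure T) :=
  (hf.aestronglyMeasurable_of_isCompact isCompact_Icc measurableSet_Icc).mono_measure
    (Measure.restrict_mono Ioo_subset_Icc_self le_rfl)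

theorem eLpNorm_timeMeasure_le_of_bound {p T C : ℝ} (hp : 0 < p) {f : ℝ → L2Field}
    (h : ∀ t ∈ Ioo 0 T, ‖f t‖ ≤ C) :
    eLpNorm f (ENNReal.ofReal p) (timeMeasure T) ≤
      ENNReal.ofReal C * ENNReal.ofReal T ^ (1 / p) := by
  refine (eLpNorm_le_of_ae_bound (ae_timeMeasure h)).trans_eq ?_
  rw [timeMeasure_univ, ENNReal.toReal_ofReal hp.le, mul_comm, one_div]

/-- The constant `C` only guarantees finiteness. The bound itself must carry `supNorm g`, the
quantity that is controlled after integration in time. -/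
theorem enorm_crossField_le {f g : L2Field} {C : ℝ} (hg : EssBdd g C) :
    ‖crossField f g‖ₑ ≤ ‖f‖ₑ * supNorm g := by
  have hfin : supNorm g ≠ ∞ := by
    refine ((eLpNorm_le_of_ae_bound hg).trans_lt ?_).ne
    simp
  have hg' : EssBdd g (supNorm g).toReal := by
    refine (enorm_ae_le_eLpNormEssSup g volume).mono fun x hx => ?_
    rw [← toReal_enorm]
    exact ENNReal.toReal_mono hfin (by simpa [supNorm] using hx)
  have h := norm_crossField_le_right hg' f
  rw [← ofReal_norm, ← ofReal_norm, ← ENNReal.ofReal_toReal hfin,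
    ← ENNReal.ofReal_mul (norm_nonneg _), mul_comm]
  exact ENNReal.ofReal_le_ofReal h

/-- The constant in the energy bounds. -/
def energyConst (K T : ℝ) : ℝ :=
  Real.sqrt (4 * Real.exp ((K ^ 2 + 7 * K + 1) * T + 1) * (1 + K ^ 2) * (1 + T))

theorem energyConst_nonneg (K T : ℝ) : 0 ≤ energyConst K T := Real.sqrt_nonneg _

section bounds

variable {m : ℕ} {c T K R a : ℝ} {u E B ub Bb : ℝ → L2Field} {u₀ E₀ B₀ ub₀ Bb₀ F : L2Field}

/-- Square roots of the energy estimate. The weight `c⁻²` leaves only `c S` for the electric error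
at fixed time, while the dissipation controls the current error by `S` itself, in `L²` in time. -/
theorem energy_bounds (hm : 3 ≤ m) (hT : 0 ≤ T) (hR : 0 ≤ R) (hc : R + 1 ≤ c)
    (h : IsEulerMaxwellSolution m c T u E B u₀ E₀ B₀) (hb : IsMHDSolution m T ub Bb ub₀ Bb₀)
    (hK : MHDBounds T ub Bb K) (hF : MemH 1 F) (sF : F ∈ solenoidal) (bF : EssBdd F R)
    (nF : ‖F‖ ≤ a) (nF' : ‖curl F‖ ≤ a) {S : ℝ}
    (hS : S = energyConst K T *
      (‖u₀ - ub₀‖ + ‖B₀ - Bb₀‖ + ‖E₀ - F‖ + a / Real.sqrt c + 1 / c)) :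
    (∀ t ∈ Icc 0 T, ‖u t - ub t‖ ≤ S ∧ ‖B t - Bb t‖ ≤ S ∧
        ‖c • E t - limitE ub Bb t - layer c F t‖ ≤ c * S) ∧
      eLpNorm (fun t => current c (u t) (E t) (B t) - curl (Bb t) - layer c F t)
        (ENNReal.ofReal 2) (timeMeasure T) ≤ ENNReal.ofReal S := by
  have hc0 : 0 < c := by linarith
  have ha : 0 ≤ a := (norm_nonneg _).trans nF
  have hS0 : 0 ≤ S := by
    rw [hS]
    exact mul_nonneg (energyConst_nonneg _ _) (by positivity)
  have hD : 4 * Real.exp ((K ^ 2 + 7 * K + 1) * T + 1) * (1 + K ^ 2) * (1 + T) *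
      (‖u₀ - ub₀‖ ^ 2 + ‖B₀ - Bb₀‖ ^ 2 + ‖E₀ - F‖ ^ 2 + a ^ 2 / c + (c ^ 2)⁻¹) ≤ S ^ 2 := by
    rw [hS, mul_pow, energyConst, Real.sq_sqrt (by positivity)]
    gcongr
    have e1 : a ^ 2 / c = (a / Real.sqrt c) ^ 2 := by rw [div_pow, Real.sq_sqrt hc0.le]
    have e2 : (c ^ 2)⁻¹ = (1 / c) ^ 2 := by rw [div_pow, one_pow, one_div]
    rw [e1, e2]
    have x1 := norm_nonneg (u₀ - ub₀)
    have x2 := norm_nonneg (B₀ - Bb₀)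
    have x3 := norm_nonneg (E₀ - F)
    have x4 : 0 ≤ a / Real.sqrt c := by positivity
    have x5 : 0 ≤ 1 / c := by positivity
    have sq_add : ∀ {x y : ℝ}, 0 ≤ x → 0 ≤ y → x ^ 2 + y ^ 2 ≤ (x + y) ^ 2 := fun hx hy => by
      nlinarith [mul_nonneg hx hy]
    have y1 := sq_add x1 x2
    have y2 := sq_add (add_nonneg x1 x2) x3
    have y3 := sq_add (add_nonneg (add_nonneg x1 x2) x3) x4
    have y4 := sq_add (add_nonneg (add_nonneg (add_nonneg x1 x2) x3) x4) x5
    linarith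
  have key : ∀ t ∈ Icc 0 T, _ := fun t ht =>
    (energy_estimate hm hT hR hc h hb hK hF sF bF nF nF' ht).trans hD
  have hJc : ContinuousOn (fun t => current c (u t) (E t) (B t) - curl (Bb t) - layer c F t)
      (Icc 0 T) :=
    ((h.continuousOn_current hm).sub (hb.continuous_B.mono (by omega)).curl).sub
      (continuous_layer c F).continuousOn
  refine ⟨fun t ht => ?_, ?_⟩
  · have k := key t ht
    have i0 : 0 ≤ ∫ s in (0 : ℝ)..t,
        ‖current c (u s) (E s) (B s) - curl (Bb s) - layer c F s‖ ^ 2 :=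
      intervalIntegral.integral_nonneg ht.1 fun _ _ => by positivity
    have i1 := sq_nonneg ‖u t - ub t‖
    have i2 := sq_nonneg ‖B t - Bb t‖
    have i3 : 0 ≤ (c ^ 2)⁻¹ * ‖c • E t - limitE ub Bb t - layer c F t‖ ^ 2 := by positivity
    refine ⟨abs_le_of_sq_le_sq' (by linarith) hS0 |>.2, abs_le_of_sq_le_sq' (by linarith) hS0 |>.2,
      abs_le_of_sq_le_sq' ?_ (by positivity) |>.2⟩
    have i4 : (c ^ 2)⁻¹ * ‖c • E t - limitE ub Bb t - layer c F t‖ ^ 2 ≤ S ^ 2 := by linarith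
    rw [inv_mul_le_iff₀ (by positivity)] at i4
    rwa [mul_pow]
  · have k := key T ⟨hT, le_rfl⟩
    have i1 := sq_nonneg ‖u T - ub T‖
    have i2 := sq_nonneg ‖B T - Bb T‖
    have i3 : 0 ≤ (c ^ 2)⁻¹ * ‖c • E T - limitE ub Bb T - layer c F T‖ ^ 2 := by positivity
    have k' : ∫ s in (0 : ℝ)..T, ‖current c (u s) (E s) (B s) - curl (Bb s) - layer c F s‖ ^ 2 ≤
        S ^ 2 := by linarith
    rw [intervalIntegral.integral_of_le hT, integral_Ioc_eq_integral_Ioo] at k'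
    rw [eLpNorm_timeMeasure two_pos]
    have hi : IntegrableOn (fun s => ‖current c (u s) (E s) (B s) - curl (Bb s) - layer c F s‖ ^ 2)
        (Ioo 0 T) := ((hJc.norm.pow 2).integrableOn_Icc).mono_set Ioo_subset_Icc_self
    have e1 := ofReal_integral_eq_lintegral_ofReal hi (Eventually.of_forall fun s => by positivity)
    have e2 : ∫⁻ t, ‖current c (u t) (E t) (B t) - curl (Bb t) - layer c F t‖ₑ ^ (2 : ℝ)
        ∂timeMeasure T ≤ ENNReal.ofReal (S ^ 2) := by
      refine le_trans (le_of_eq ?_) (ENNReal.ofReal_le_ofReal k')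
      rw [e1]
      refine lintegral_congr fun t => ?_
      rw [← ofReal_norm, ENNReal.rpow_ofNat, ENNReal.ofReal_pow (norm_nonneg _)]
    calc _ ≤ ENNReal.ofReal (S ^ 2) ^ (1 / 2 : ℝ) := by gcongr
      _ = _ := by
        rw [ENNReal.ofReal_pow hS0, ← ENNReal.rpow_ofNat, ← ENNReal.rpow_mul]
        norm_num

/-- This is the difference between electric and current errors. The first product puts `B` in
`L^p(0,T; L^∞)` and `u - ub` in `L^∞(0,T; L²)`; the second uses the uniform bound on `ub`. -/
theorem eLpNorm_products_le (hm : 3 ≤ m)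
    (h : IsEulerMaxwellSolution m c T u E B u₀ E₀ B₀) (hb : IsMHDSolution m T ub Bb ub₀ Bb₀)
    (hK : MHDBounds T ub Bb K) {S p : ℝ} (hp : 1 ≤ p) {N : ℝ≥0∞}
    (hU : ∀ t ∈ Icc 0 T, ‖u t - ub t‖ ≤ S) (hB : ∀ t ∈ Icc 0 T, ‖B t - Bb t‖ ≤ S)
    (hN : (∫⁻ t, supNorm (B t) ^ p ∂timeMeasure T) ^ (1 / p) ≤ N) :
    eLpNorm (fun t => leray (crossField (u t - ub t) (B t) + crossField (ub t) (B t - Bb t)))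
      (ENNReal.ofReal p) (timeMeasure T) ≤
      ENNReal.ofReal S * (N + ENNReal.ofReal K * ENNReal.ofReal T ^ (1 / p)) := by
  have hp0 : 0 < p := one_pos.trans_le hp
  have Bm : ∀ t ∈ Icc 0 T, MemH 2 (B t) := fun t ht => (h.continuous_B.1 t ht).mono (by omega)
  have Bbm : ∀ t ∈ Icc 0 T, MemH 2 (Bb t) := fun t ht => (hK.memH_B t ht).of_succ
  have u2 : ContinuousInH 2 T u := h.continuous_u.mono (by omega)
  have B2 : ContinuousInH 2 T B := h.continuous_B.mono (by omega)
  have ub2 : ContinuousInH 2 T ub := hb.continuous_u.mono (by omega)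
  have Bb2 : ContinuousInH 2 T Bb := hb.continuous_B.mono (by omega)
  have c1 : ContinuousOn (fun t => crossField (u t - ub t) (B t)) (Icc 0 T) :=
    ((u2.crossField B2).sub (ub2.crossField B2)).congr fun t ht => crossField_sub_left (Bm t ht)
  have c2 : ContinuousOn (fun t => crossField (ub t) (B t - Bb t)) (Icc 0 T) :=
    ((ub2.crossField B2).sub (ub2.crossField Bb2)).congr fun t ht =>
      crossField_sub_right (Bm t ht) (Bbm t ht)
  refine (eLpNorm_mono (g := fun t => crossField (u t - ub t) (B t) +
    crossField (ub t) (B t - Bb t)) fun t => norm_leray_le _).trans ?_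
  refine (eLpNorm_add_le (aestronglyMeasurable_of_continuousOn c1)
    (aestronglyMeasurable_of_continuousOn c2) (by simpa using hp)).trans ?_
  rw [mul_add]
  refine add_le_add ?_ ?_
  · rw [eLpNorm_timeMeasure hp0]
    have e1 : ∫⁻ t, ‖crossField (u t - ub t) (B t)‖ₑ ^ p ∂timeMeasure T ≤
        ENNReal.ofReal S ^ p * ∫⁻ t, supNorm (B t) ^ p ∂timeMeasure T := by
      rw [← lintegral_const_mul' _ _ (ENNReal.rpow_ne_top_of_nonneg hp0.le ENNReal.ofReal_ne_top)]
      refine lintegral_mono_ae (ae_timeMeasure fun t ht => ?_)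
      have ht' := Ioo_subset_Icc_self ht
      rw [← ENNReal.mul_rpow_of_nonneg _ _ hp0.le]
      have := hU t ht'
      gcongr
      refine (enorm_crossField_le (Bm t ht').essBdd).trans ?_
      gcongr
      rw [← ofReal_norm]
      gcongr
    calc _ ≤ (ENNReal.ofReal S ^ p * ∫⁻ t, supNorm (B t) ^ p ∂timeMeasure T) ^ (1 / p) := by
          gcongr
      _ = ENNReal.ofReal S * (∫⁻ t, supNorm (B t) ^ p ∂timeMeasure T) ^ (1 / p) := by
          rw [ENNReal.mul_rpow_of_nonneg _ _ (by positivity), ← ENNReal.rpow_mul,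
            mul_one_div_cancel hp0.ne', ENNReal.rpow_one]
      _ ≤ _ := by gcongr
  · have hS : 0 ≤ K := hK.nonneg
    refine (eLpNorm_timeMeasure_le_of_bound (C := K * S) hp0 fun t ht => ?_).trans_eq ?_
    · have ht' := Ioo_subset_Icc_self ht
      exact (norm_crossField_le_left (hK.bdd_u t ht') _).trans (by gcongr; exact hB t ht')
    · rw [ENNReal.ofReal_mul hS]
      ring

theorem aestronglyMeasurable_products (hm : 3 ≤ m)
    (h : IsEulerMaxwellSolution m c T u E B u₀ E₀ B₀) (hb : IsMHDSolution m T ub Bb ub₀ Bb₀) :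
    AEStronglyMeasurable (fun t => leray (crossField (u t - ub t) (B t) +
      crossField (ub t) (B t - Bb t))) (timeMeasure T) := by
  have u2 : ContinuousInH 2 T u := h.continuous_u.mono (by omega)
  have B2 : ContinuousInH 2 T B := h.continuous_B.mono (by omega)
  have ub2 : ContinuousInH 2 T ub := hb.continuous_u.mono (by omega)
  have Bb2 : ContinuousInH 2 T Bb := hb.continuous_B.mono (by omega)
  have := leray.continuous.comp_continuousOn ((u2.crossField B2).sub (ub2.crossField Bb2))
  refine aestronglyMeasurable_of_continuousOn (this.congr fun t ht => ?_)
  rw [← crossField_sub_crossField (B2.1 t ht) (ub2.1 t ht)]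
  rfl

end bounds

/-! ### Mollification of the initial electric field -/

/-- The order of quantifiers matters: `R` and `a` depend on the `H¹` bound and on `η` only, hence
not on `c` when applied to the initial electric fields. -/
theorem exists_mollified (Q : ℝ) (hQ : 0 ≤ Q) {η : ℝ} (hη : 0 < η) : ∃ R a : ℝ, 0 ≤ R ∧
    ∀ f : L2Field, MemH 1 f → f ∈ solenoidal → sobolevNorm 1 f ≤ Q →
      ∃ F : L2Field, MemH 1 F ∧ F ∈ solenoidal ∧ EssBdd F R ∧ ‖F‖ ≤ a ∧ ‖curl F‖ ≤ a ∧
        ‖f - F‖ ≤ η := by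
  have hg := gaussMass_pos
  set q := gaussMass⁻¹ * Q with hq
  have hq0 : 0 ≤ q := by positivity
  set μ₁ := ∫ z, ‖z‖ * gauss z with hμ₁
  have hμ0 : 0 ≤ μ₁ := integral_nonneg fun z => by
    have := gauss_pos z
    positivity
  -- The approximation error is at most `δ μ₁ (3q)`, hence at most `η`; the summand `1` keeps the
  -- denominator positive.
  set δ := η / (μ₁ * (3 * q) + 1) with hδ
  have hδ0 : 0 < δ := by positivity
  set G := ∫ z, ‖gauss z‖ with hG
  have hG0 : 0 ≤ G := integral_nonneg fun z => norm_nonneg _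
  refine ⟨(eLpNorm gauss 2 volume).toReal * (Real.sqrt (δ ^ 3))⁻¹ * q, 3 * (G * q),
    by positivity, fun f hf sf hfQ => ?_⟩
  have hfn : ‖f‖ ≤ Q := (norm_le_sobolevNorm 1 f).trans hfQ
  set g : L2Field := gaussMass⁻¹ • f with hgf
  have hgn : ‖g‖ ≤ q := by
    rw [hgf, norm_smul, Real.norm_of_nonneg (by positivity)]
    exact mul_le_mul_of_nonneg_left hfn (by positivity)
  have hd : ∀ i, IsWeakDeriv (basisVec i) g (gaussMass⁻¹ • weakPartial i f) := fun i =>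
    (hf.isWeakDeriv i).smul _
  have hdn : ∀ i, ‖gaussMass⁻¹ • weakPartial i f‖ ≤ q := fun i => by
    rw [norm_smul, Real.norm_of_nonneg (by positivity)]
    exact mul_le_mul_of_nonneg_left ((norm_weakPartial_le i f).trans hfQ) (by positivity)
  have hd' := fun i => (hd i).avg integrable_gauss δ
  refine ⟨avg gauss δ g, memH_succ_of hd' fun _ => trivial,
    avg_mem_solenoidal integrable_gauss δ (solenoidal.smul_mem _ sf),
    (essBdd_avg_gauss hδ0 g).mono (by gcongr), ?_, ?_, ?_⟩
  · refine (norm_avg_le integrable_gauss δ g).trans ?_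
    have : G * ‖g‖ ≤ G * q := by gcongr
    have : 0 ≤ G * q := by positivity
    linarith
  · rw [curl_eq]
    have : ‖∑ i, mapField (crossL (basisVec i)) (weakPartial i (avg gauss δ g))‖ ≤
        ∑ _i : Fin 3, G * q := by
      refine (norm_sum_le _ _).trans (Finset.sum_le_sum fun i _ =>
        (norm_mapField_cross_le i _).trans ?_)
      rw [weakPartial_eq (hd' i)]
      exact (norm_avg_le integrable_gauss δ _).trans (by gcongr; exact hdn i)
    simpa using this
  · have h1 := norm_avg_gauss_sub_le hd hδ0.le
    rw [hgf, smul_smul, mul_inv_cancel₀ hg.ne', one_smul, ← hgf] at h1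
    rw [norm_sub_rev]
    refine h1.trans ?_
    have h2 : ∑ i, ‖gaussMass⁻¹ • weakPartial i f‖ ≤ 3 * q := by
      simpa using Finset.sum_le_sum fun i (_ : i ∈ Finset.univ) => hdn i
    calc δ * μ₁ * ∑ i, ‖gaussMass⁻¹ • weakPartial i f‖ ≤ δ * μ₁ * (3 * q) := by gcongr
      _ ≤ δ * (μ₁ * (3 * q) + 1) := by rw [mul_assoc]; gcongr; linarith
      _ = η := div_mul_cancel₀ _ (by positivity)

/-! ### The initial layer -/

/-- The integral of `(c a)^p exp(-p c² t)` over the half line is `a^p c^(p-2) / p`, which makes `p =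
2` the critical exponent. -/
theorem eLpNorm_layer_le {p T c a : ℝ} (hp : 0 < p) (hc : 0 < c) {F : L2Field} (hF : ‖F‖ ≤ a) :
    eLpNorm (layer c F) (ENNReal.ofReal p) (timeMeasure T) ≤
      ENNReal.ofReal ((a ^ p / p * c ^ (p - 2)) ^ (1 / p)) := by
  have ha : 0 ≤ a := (norm_nonneg _).trans hF
  have hpc : -(p * c ^ 2) < 0 := by
    have := mul_pos hp (pow_pos hc 2)
    linarith
  rw [eLpNorm_timeMeasure hp, ← ENNReal.ofReal_rpow_of_nonneg (by positivity) (by positivity)]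
  gcongr
  have e1 : ∀ t, ‖layer c F t‖ₑ ^ p ≤
      ENNReal.ofReal ((c * a) ^ p * Real.exp (-(p * c ^ 2) * t)) := by
    intro t
    have e2 : ‖layer c F t‖ ≤ c * a * Real.exp (-(c ^ 2 * t)) := by
      rw [layer, norm_smul, Real.norm_of_nonneg (by positivity), mul_right_comm]
      gcongr
    rw [← ofReal_norm, ENNReal.ofReal_rpow_of_nonneg (norm_nonneg _) hp.le]
    refine ENNReal.ofReal_le_ofReal ((Real.rpow_le_rpow (norm_nonneg _) e2 hp.le).trans_eq ?_)
    rw [Real.mul_rpow (by positivity) (by positivity), ← Real.exp_mul]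
    congr 2
    ring
  have hint : IntegrableOn (fun t => (c * a) ^ p * Real.exp (-(p * c ^ 2) * t)) (Ioi 0) :=
    (integrableOn_exp_mul_Ioi hpc 0).const_mul _
  calc ∫⁻ t, ‖layer c F t‖ₑ ^ p ∂timeMeasure T
      ≤ ∫⁻ t, ENNReal.ofReal ((c * a) ^ p * Real.exp (-(p * c ^ 2) * t)) ∂timeMeasure T :=
        lintegral_mono e1
    _ ≤ ∫⁻ t in Ioi 0, ENNReal.ofReal ((c * a) ^ p * Real.exp (-(p * c ^ 2) * t)) :=
        lintegral_mono_set Ioo_subset_Ioi_self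
    _ = ENNReal.ofReal (a ^ p / p * c ^ (p - 2)) := by
        rw [← ofReal_integral_eq_lintegral_ofReal hint
          (Eventually.of_forall fun t => by positivity), integral_const_mul,
          integral_exp_mul_Ioi hpc]
        congr 1
        rw [mul_zero, Real.exp_zero, Real.mul_rpow hc.le ha, Real.rpow_sub hc, Real.rpow_two]
        field_simp

theorem tendsto_layer_bound {p : ℝ} (a : ℝ) (hp : 0 < p) (hp2 : p < 2) :
    Tendsto (fun c : ℝ => ENNReal.ofReal ((a ^ p / p * c ^ (p - 2)) ^ (1 / p))) atTop (𝓝 0) := by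
  have h1 : Tendsto (fun c : ℝ => c ^ (p - 2)) atTop (𝓝 0) := by
    simpa using tendsto_rpow_neg_atTop (sub_pos.2 hp2)
  have h2 := ((h1.const_mul (a ^ p / p)).rpow_const (p := 1 / p) (Or.inr (by positivity)))
  rw [mul_zero, Real.zero_rpow (by positivity)] at h2
  simpa using ENNReal.tendsto_ofReal h2

theorem layer_zero (c : ℝ) : layer c 0 = 0 := by
  funext t
  simp [layer]

/-! ### Families of solutions -/

/-- A family of solutions of the Euler–Maxwell system, indexed by the speed of light, for which the
magnetic field is bounded in `L²(0,T; L^∞)`, together with a solution of the MHD system. -/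
structure SolutionFamily (m : ℕ) (c₀ T M K : ℝ) (u E B : ℝ → ℝ → L2Field)
    (u₀c E₀c B₀c : ℝ → L2Field) (ub Bb : ℝ → L2Field) (u₀ B₀ : L2Field) : Prop where
  three_le : 3 ≤ m
  pos_T : 0 < T
  pos_M : 0 < M
  sol : ∀ c, c₀ ≤ c → IsEulerMaxwellSolution m c T (u c) (E c) (B c) (u₀c c) (E₀c c) (B₀c c)
  lim : IsMHDSolution m T ub Bb u₀ B₀
  bounds : MHDBounds T ub Bb K
  bdd_B : ∀ c, c₀ ≤ c → ∫⁻ t, supNorm (B c t) ^ 2 ∂timeMeasure T ≤ ENNReal.ofReal M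

/-- The size of the perturbation, the part `F` of the electric field being treated as a layer. -/
def perturbation (K T : ℝ) (u₀c B₀c E₀c : ℝ → L2Field) (u₀ B₀ F : L2Field) (a c : ℝ) : ℝ :=
  energyConst K T *
    (‖u₀c c - u₀‖ + ‖B₀c c - B₀‖ + ‖E₀c c - F‖ + a / Real.sqrt c + 1 / c)

theorem perturbation_nonneg {K T : ℝ} {u₀c B₀c E₀c : ℝ → L2Field} {u₀ B₀ F : L2Field} {a c : ℝ}
    (ha : 0 ≤ a) (hc : 0 ≤ c) : 0 ≤ perturbation K T u₀c B₀c E₀c u₀ B₀ F a c :=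
  mul_nonneg (energyConst_nonneg _ _) (by positivity)

namespace SolutionFamily

variable {m : ℕ} {c₀ T M K : ℝ} {u E B : ℝ → ℝ → L2Field} {u₀c E₀c B₀c : ℝ → L2Field}
  {ub Bb : ℝ → L2Field} {u₀ B₀ F : L2Field} {c R a p : ℝ}

local notation "S" => perturbation K T u₀c B₀c E₀c u₀ B₀

theorem bdd_B_sqrt (h : SolutionFamily m c₀ T M K u E B u₀c E₀c B₀c ub Bb u₀ B₀) (hc : c₀ ≤ c) :
    (∫⁻ t, supNorm (B c t) ^ (2 : ℝ) ∂timeMeasure T) ^ (1 / 2 : ℝ) ≤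
      ENNReal.ofReal (Real.sqrt M) := by
  have := h.bdd_B c hc
  simp only [ENNReal.rpow_ofNat]
  calc _ ≤ ENNReal.ofReal M ^ (1 / 2 : ℝ) := by gcongr
    _ = _ := by
      rw [Real.sqrt_eq_rpow, ENNReal.ofReal_rpow_of_nonneg h.pos_M.le (by norm_num)]

theorem energy (h : SolutionFamily m c₀ T M K u E B u₀c E₀c B₀c ub Bb u₀ B₀) (hc : c₀ ≤ c)
    (hR : 0 ≤ R) (hRc : R + 1 ≤ c) (hF : MemH 1 F) (sF : F ∈ solenoidal) (bF : EssBdd F R)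
    (nF : ‖F‖ ≤ a) (nF' : ‖curl F‖ ≤ a) :
    (∀ t ∈ Icc 0 T, ‖u c t - ub t‖ ≤ S F a c ∧ ‖B c t - Bb t‖ ≤ S F a c ∧
        ‖scaledE E c t - limitE ub Bb t - layer c F t‖ ≤ c * S F a c) ∧
      eLpNorm (fun t => currents u E B c t - limitJ Bb t - layer c F t)
        (ENNReal.ofReal 2) (timeMeasure T) ≤ ENNReal.ofReal (S F a c) :=
  energy_bounds h.three_le h.pos_T.le hR hRc (h.sol c hc) h.lim h.bounds hF sF bF nF nF' rfl

theorem electric_sub_current (h : SolutionFamily m c₀ T M K u E B u₀c E₀c B₀c ub Bb u₀ B₀)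
    (hc : c₀ ≤ c) {t : ℝ} (ht : t ∈ Icc 0 T) :
    scaledE E c t - limitE ub Bb t - layer c F t =
      (currents u E B c t - limitJ Bb t - layer c F t) -
        leray (crossField (u c t - ub t) (B c t) + crossField (ub t) (B c t - Bb t)) :=
  electric_eq (((h.sol c hc).continuous_B.1 t ht).mono (by linarith [h.three_le]))
    (h.bounds.memH_u t ht).of_succ ((h.bounds.memH_B t ht).mono (by norm_num))

theorem aestronglyMeasurable_electric (h : SolutionFamily m c₀ T M K u E B u₀c E₀c B₀c ub Bb u₀ B₀)
    (hc : c₀ ≤ c) : AEStronglyMeasurable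
      (fun t => scaledE E c t - limitE ub Bb t - layer c F t) (timeMeasure T) :=
  aestronglyMeasurable_of_continuousOn
    ((((h.sol c hc).continuous_E.continuousOn.const_smul c).sub
      (MHDBounds.continuousOn_limitE h.three_le h.lim)).sub (continuous_layer c F).continuousOn)

theorem aestronglyMeasurable_current (h : SolutionFamily m c₀ T M K u E B u₀c E₀c B₀c ub Bb u₀ B₀)
    (hc : c₀ ≤ c) : AEStronglyMeasurable
      (fun t => currents u E B c t - limitJ Bb t - layer c F t) (timeMeasure T) :=
  aestronglyMeasurable_of_continuousOn
    ((((h.sol c hc).continuousOn_current h.three_le).sub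
      (h.lim.continuous_B.mono (by linarith [h.three_le])).curl).sub
      (continuous_layer c F).continuousOn)

theorem eLpNorm_products (h : SolutionFamily m c₀ T M K u E B u₀c E₀c B₀c ub Bb u₀ B₀)
    (hc : c₀ ≤ c) (hp : 1 ≤ p) {s : ℝ} {N : ℝ≥0∞}
    (hs : ∀ t ∈ Icc 0 T, ‖u c t - ub t‖ ≤ s ∧ ‖B c t - Bb t‖ ≤ s)
    (hN : (∫⁻ t, supNorm (B c t) ^ p ∂timeMeasure T) ^ (1 / p) ≤ N) :
    eLpNorm (fun t => leray (crossField (u c t - ub t) (B c t) +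
      crossField (ub t) (B c t - Bb t))) (ENNReal.ofReal p) (timeMeasure T) ≤
      ENNReal.ofReal s * (N + ENNReal.ofReal K * ENNReal.ofReal T ^ (1 / p)) :=
  eLpNorm_products_le h.three_le (h.sol c hc) h.lim h.bounds hp (fun t ht => (hs t ht).1)
    (fun t ht => (hs t ht).2) hN

theorem eLpNorm_electric_le (h : SolutionFamily m c₀ T M K u E B u₀c E₀c B₀c ub Bb u₀ B₀)
    (hc : c₀ ≤ c) (hR : 0 ≤ R) (hRc : R + 1 ≤ c) (hF : MemH 1 F) (sF : F ∈ solenoidal)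
    (bF : EssBdd F R) (nF : ‖F‖ ≤ a) (nF' : ‖curl F‖ ≤ a) :
    eLpNorm (fun t => scaledE E c t - limitE ub Bb t - layer c F t)
        (ENNReal.ofReal 2) (timeMeasure T) ≤
      ENNReal.ofReal ((1 + Real.sqrt M + K * Real.sqrt T) * S F a c) := by
  obtain ⟨e1, e2⟩ := h.energy hc hR hRc hF sF bF nF nF'
  have e3 := h.eLpNorm_products hc one_le_two (fun t ht => ⟨(e1 t ht).1, (e1 t ht).2.1⟩)
    (h.bdd_B_sqrt hc)
  have hS : 0 ≤ S F a c :=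
    perturbation_nonneg ((norm_nonneg _).trans nF) (by linarith)
  have hK := h.bounds.nonneg
  have e4 : eLpNorm (fun t => scaledE E c t - limitE ub Bb t - layer c F t)
      (ENNReal.ofReal 2) (timeMeasure T) = eLpNorm (fun t =>
        (currents u E B c t - limitJ Bb t - layer c F t) -
          leray (crossField (u c t - ub t) (B c t) + crossField (ub t) (B c t - Bb t)))
      (ENNReal.ofReal 2) (timeMeasure T) :=
    eLpNorm_congr_ae (ae_timeMeasure fun t ht =>
      h.electric_sub_current hc (Ioo_subset_Icc_self ht))
  rw [e4]
  refine (eLpNorm_sub_le (h.aestronglyMeasurable_current hc)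
    (aestronglyMeasurable_products h.three_le (h.sol c hc) h.lim) (by simp)).trans ?_
  refine (add_le_add e2 e3).trans_eq ?_
  rw [ENNReal.ofReal_rpow_of_nonneg h.pos_T.le (by norm_num), ← Real.sqrt_eq_rpow,
    ← ENNReal.ofReal_mul hK, ← ENNReal.ofReal_add (by positivity) (by positivity),
    ← ENNReal.ofReal_mul hS, ← ENNReal.ofReal_add hS (by positivity)]
  congr 1
  ring

/-- Hölder's inequality on the bounded time interval reduces the corrected errors to `p = 2`, and
the layer is added back in `L^p`, where its own bound applies. -/
theorem eLpNorm_le_of_le_two (h : SolutionFamily m c₀ T M K u E B u₀c E₀c B₀c ub Bb u₀ B₀)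
    (hc : c₀ ≤ c) (hR : 0 ≤ R) (hRc : R + 1 ≤ c) (hF : MemH 1 F) (sF : F ∈ solenoidal)
    (bF : EssBdd F R) (nF : ‖F‖ ≤ a) (nF' : ‖curl F‖ ≤ a) (hp : 1 ≤ p) (hp2 : p ≤ 2) :
    eLpNorm (fun t => scaledE E c t - limitE ub Bb t) (ENNReal.ofReal p) (timeMeasure T) ≤
        ENNReal.ofReal ((1 + Real.sqrt M + K * Real.sqrt T) * T ^ (1 / p - 1 / 2) * S F a c) +
          eLpNorm (layer c F) (ENNReal.ofReal p) (timeMeasure T) ∧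
      eLpNorm (fun t => currents u E B c t - limitJ Bb t) (ENNReal.ofReal p) (timeMeasure T) ≤
        ENNReal.ofReal ((1 + Real.sqrt M + K * Real.sqrt T) * T ^ (1 / p - 1 / 2) * S F a c) +
          eLpNorm (layer c F) (ENNReal.ofReal p) (timeMeasure T) := by
  have hS : 0 ≤ S F a c :=
    perturbation_nonneg ((norm_nonneg _).trans nF) (by linarith)
  have hK := h.bounds.nonneg
  have hT := h.pos_T
  have hp0 : 0 < p := by linarith
  have main : ∀ {f : ℝ → L2Field}, AEStronglyMeasurable (fun t => f t - layer c F t)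
      (timeMeasure T) → eLpNorm (fun t => f t - layer c F t) (ENNReal.ofReal 2) (timeMeasure T) ≤
        ENNReal.ofReal ((1 + Real.sqrt M + K * Real.sqrt T) * S F a c) →
      eLpNorm f (ENNReal.ofReal p) (timeMeasure T) ≤
        ENNReal.ofReal ((1 + Real.sqrt M + K * Real.sqrt T) * T ^ (1 / p - 1 / 2) * S F a c) +
          eLpNorm (layer c F) (ENNReal.ofReal p) (timeMeasure T) := by
    intro f hf hle
    have e1 : f = (fun t => f t - layer c F t) + layer c F := by funext t; simp
    have e2 := eLpNorm_add_le (p := ENNReal.ofReal p) hf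
      (aestronglyMeasurable_of_continuousOn (T := T) (continuous_layer c F).continuousOn)
      (by simpa using hp)
    rw [← e1] at e2
    refine e2.trans (add_le_add_left ?_ _)
    refine (eLpNorm_le_eLpNorm_mul_rpow_measure_univ (ENNReal.ofReal_le_ofReal hp2) hf).trans ?_
    rw [ENNReal.toReal_ofReal hp0.le, ENNReal.toReal_ofReal zero_le_two, timeMeasure_univ,
      ENNReal.ofReal_rpow_of_pos hT, mul_right_comm, ENNReal.ofReal_mul (by positivity)]
    gcongr
  refine ⟨main (h.aestronglyMeasurable_electric hc) (h.eLpNorm_electric_le hc hR hRc hF sF bF nF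
    nF'), main (h.aestronglyMeasurable_current hc) ((h.energy hc hR hRc hF sF bF nF nF').2.trans
    (ENNReal.ofReal_le_ofReal ?_))⟩
  refine le_mul_of_one_le_left hS ?_
  have := Real.sqrt_nonneg M
  have : 0 ≤ K * Real.sqrt T := by positivity
  linarith

end SolutionFamily

/-! ### Convergence in the three ranges of the exponent -/

theorem tendsto_zero_of_eventually_le {f : ℝ → ℝ≥0∞} (C : ℝ)
    (h : ∀ η : ℝ, 0 < η → ∀ᶠ c in atTop, f c ≤ ENNReal.ofReal (C * η)) :
    Tendsto f atTop (𝓝 0) := by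
  refine ENNReal.tendsto_nhds_zero.2 fun ε hε => ?_
  have hm : 0 < (min ε 1).toReal :=
    ENNReal.toReal_pos (by simp [hε.ne']) (min_lt_of_right_lt ENNReal.one_lt_top).ne
  filter_upwards [h ((min ε 1).toReal / (|C| + 1)) (by positivity)] with c hc
  refine hc.trans ?_
  have : C * ((min ε 1).toReal / (|C| + 1)) ≤ (min ε 1).toReal := by
    rw [← mul_div_assoc, div_le_iff₀ (by positivity), mul_comm]
    gcongr
    linarith [le_abs_self C]
  refine (ENNReal.ofReal_le_ofReal this).trans ?_
  rw [ENNReal.ofReal_toReal (min_lt_of_right_lt ENNReal.one_lt_top).ne]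
  exact min_le_left _ _

/-- Interpolation between `L^∞` and `L²` in time. -/
theorem eLpNorm_le_interpolate {f : ℝ → L2Field} {p T s : ℝ} (hp : 2 < p)
    (hs : ∀ t ∈ Ioo 0 T, ‖f t‖ ≤ s) :
    eLpNorm f (ENNReal.ofReal p) (timeMeasure T) ≤
      ENNReal.ofReal s ^ (1 - 2 / p) *
        eLpNorm f (ENNReal.ofReal 2) (timeMeasure T) ^ (2 / p) := by
  have hp0 : 0 < p := by linarith
  rw [eLpNorm_timeMeasure hp0, eLpNorm_timeMeasure two_pos]
  have e1 : ∫⁻ t, ‖f t‖ₑ ^ p ∂timeMeasure T ≤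
      ENNReal.ofReal s ^ (p - 2) * ∫⁻ t, ‖f t‖ₑ ^ (2 : ℝ) ∂timeMeasure T := by
    rw [← lintegral_const_mul' _ _
      (ENNReal.rpow_ne_top_of_nonneg (by linarith) ENNReal.ofReal_ne_top)]
    refine lintegral_mono_ae (ae_timeMeasure fun t ht => ?_)
    have e2 : ‖f t‖ₑ ^ p = ‖f t‖ₑ ^ (p - 2) * ‖f t‖ₑ ^ (2 : ℝ) := by
      rw [← ENNReal.rpow_add_of_nonneg _ _ (by linarith) (by norm_num)]
      congr 1
      ring
    rw [e2]
    have e3 : ‖f t‖ₑ ≤ ENNReal.ofReal s := by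
      rw [← ofReal_norm]
      exact ENNReal.ofReal_le_ofReal (hs t ht)
    have : 0 ≤ p - 2 := by linarith
    gcongr
  calc _ ≤ (ENNReal.ofReal s ^ (p - 2) * ∫⁻ t, ‖f t‖ₑ ^ (2 : ℝ) ∂timeMeasure T) ^ (1 / p) := by
        gcongr
    _ = _ := by
      rw [ENNReal.mul_rpow_of_nonneg _ _ (by positivity), ← ENNReal.rpow_mul, ← ENNReal.rpow_mul]
      congr 2
      · field_simp
      · field_simp

namespace SolutionFamily

variable {m : ℕ} {c₀ T M K : ℝ} {u E B : ℝ → ℝ → L2Field} {u₀c E₀c B₀c : ℝ → L2Field}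
  {ub Bb : ℝ → L2Field} {u₀ B₀ F : L2Field} {c R a p : ℝ}

local notation "S" => perturbation K T u₀c B₀c E₀c u₀ B₀

theorem memH_initial (h : SolutionFamily m c₀ T M K u E B u₀c E₀c B₀c ub Bb u₀ B₀) (hc : c₀ ≤ c) :
    MemH 1 (E₀c c) ∧ E₀c c ∈ solenoidal := by
  have h0 : (0 : ℝ) ∈ Icc 0 T := ⟨le_rfl, h.pos_T.le⟩
  have h1 := (h.sol c hc).continuous_E.1 0 h0
  have h2 := (h.sol c hc).div_E 0 h0
  rw [(h.sol c hc).initial_E] at h1 h2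
  exact ⟨h1.mono (by linarith [h.three_le]), h2⟩

theorem convergesInLpL2_of_lt_two (h : SolutionFamily m c₀ T M K u E B u₀c E₀c B₀c ub Bb u₀ B₀)
    (hu : Tendsto (fun c => ‖u₀c c - u₀‖) atTop (𝓝 0))
    (hB : Tendsto (fun c => ‖B₀c c - B₀‖) atTop (𝓝 0))
    (hE : ∃ Q : ℝ, ∀ c, c₀ ≤ c → sobolevNorm 1 (E₀c c) ≤ Q) (hp : 1 ≤ p) (hp2 : p < 2) :
    ConvergesInLpL2 p T (scaledE E) (limitE ub Bb) ∧
      ConvergesInLpL2 p T (currents u E B) (limitJ Bb) := by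
  obtain ⟨Q, hQ⟩ := hE
  have hQ0 : 0 ≤ Q := (sobolevNorm_nonneg 1 _).trans (hQ c₀ le_rfl)
  have hK := h.bounds.nonneg
  have hT := h.pos_T
  set C := (1 + Real.sqrt M + K * Real.sqrt T) * T ^ (1 / p - 1 / 2) with hC
  have hC0 : 0 ≤ C := by positivity
  have hκ := energyConst_nonneg K T
  have main : ∀ η : ℝ, 0 < η → ∀ᶠ c in atTop,
      eLpNorm (fun t => scaledE E c t - limitE ub Bb t) (ENNReal.ofReal p) (timeMeasure T) ≤
        ENNReal.ofReal ((C * energyConst K T * 5 + 1) * η) ∧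
      eLpNorm (fun t => currents u E B c t - limitJ Bb t) (ENNReal.ofReal p) (timeMeasure T) ≤
        ENNReal.ofReal ((C * energyConst K T * 5 + 1) * η) := by
    intro η hη
    -- `η` fixes `R` and `a` before `c` grows, so `a/√c` and the norm of the layer become smaller
    -- than `η`, although `F` itself varies with `c`. The five summands of the perturbation are then
    -- each at most `η`.
    obtain ⟨R, a, hR, hF⟩ := exists_mollified Q hQ0 hη
    have t1 : Tendsto (fun c : ℝ => a / Real.sqrt c) atTop (𝓝 0) :=
      tendsto_const_nhds.div_atTop Real.tendsto_sqrt_atTop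
    have t2 : Tendsto (fun c : ℝ => 1 / c) atTop (𝓝 0) :=
      tendsto_const_nhds.div_atTop tendsto_id
    have t3 := ENNReal.tendsto_nhds_zero.1 (tendsto_layer_bound a (one_pos.trans_le hp) hp2)
      (ENNReal.ofReal η) (ENNReal.ofReal_pos.2 hη)
    filter_upwards [eventually_ge_atTop c₀, eventually_ge_atTop (R + 1),
      hu.eventually_le_const hη, hB.eventually_le_const hη, t1.eventually_le_const hη,
      t2.eventually_le_const hη, t3] with c hc hRc x1 x2 x3 x4 x5
    obtain ⟨m1, m2⟩ := h.memH_initial hc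
    obtain ⟨F, hF1, sF, bF, nF, nF', hη'⟩ := hF _ m1 m2 (hQ c hc)
    have hS : S F a c ≤ energyConst K T * (5 * η) := by
      rw [perturbation]
      gcongr
      linarith
    have hle := h.eLpNorm_le_of_le_two hc hR hRc hF1 sF bF nF nF' hp hp2.le
    have hl := (eLpNorm_layer_le (T := T) (one_pos.trans_le hp) (by linarith : 0 < c) nF).trans x5
    have hb : ENNReal.ofReal (C * S F a c) + eLpNorm (layer c F) (ENNReal.ofReal p)
        (timeMeasure T) ≤ ENNReal.ofReal ((C * energyConst K T * 5 + 1) * η) := by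
      have e1 : (C * energyConst K T * 5 + 1) * η =
        C * (energyConst K T * (5 * η)) + η := by ring
      rw [e1, ENNReal.ofReal_add (by positivity) hη.le]
      gcongr
    exact ⟨hle.1.trans hb, hle.2.trans hb⟩
  exact ⟨tendsto_zero_of_eventually_le _ fun η hη => (main η hη).mono fun c hc => hc.1,
    tendsto_zero_of_eventually_le _ fun η hη => (main η hη).mono fun c hc => hc.2⟩

theorem zero_field : MemH 1 (0 : L2Field) ∧ (0 : L2Field) ∈ solenoidal ∧
    EssBdd (0 : L2Field) 0 ∧ ‖(0 : L2Field)‖ ≤ 0 ∧ ‖curl (0 : L2Field)‖ ≤ 0 := by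
  refine ⟨memH_zero 1, solenoidal.zero_mem, ?_, by simp, ?_⟩
  · filter_upwards [Lp.coeFn_zero R3 2 (volume : Measure R3)] with x hx
    rw [hx, Pi.zero_apply, norm_zero]
  · have := curl_smul (memH_zero 1) 0
    rw [smul_zero, zero_smul] at this
    simp [this]

/-- With `‖E₀‖` tending to zero no layer has to be removed: the energy bounds with `F = 0` tend to
zero. -/
theorem convergesInLpL2_two (h : SolutionFamily m c₀ T M K u E B u₀c E₀c B₀c ub Bb u₀ B₀)
    (hu : Tendsto (fun c => ‖u₀c c - u₀‖) atTop (𝓝 0))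
    (hB : Tendsto (fun c => ‖B₀c c - B₀‖) atTop (𝓝 0))
    (hE : Tendsto (fun c => ‖E₀c c‖) atTop (𝓝 0)) :
    ConvergesInLpL2 2 T (scaledE E) (limitE ub Bb) ∧
      ConvergesInLpL2 2 T (currents u E B) (limitJ Bb) := by
  obtain ⟨z1, z2, z3, z4, z5⟩ := zero_field
  have hS : Tendsto (fun c => S 0 0 c) atTop (𝓝 0) := by
    have t2 : Tendsto (fun c : ℝ => 1 / c) atTop (𝓝 0) :=
      tendsto_const_nhds.div_atTop tendsto_id
    simpa [perturbation] using (((hu.add hB).add hE).add t2).const_mul (energyConst K T)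
  set C := (1 + Real.sqrt M + K * Real.sqrt T) * T ^ ((1 : ℝ) / 2 - 1 / 2) with hC
  have hlim : Tendsto (fun c => ENNReal.ofReal (C * S 0 0 c)) atTop (𝓝 0) := by
    simpa using ENNReal.tendsto_ofReal (hS.const_mul C)
  have main := ((eventually_ge_atTop c₀).and (eventually_ge_atTop ((0 : ℝ) + 1))).mono
    fun c hc => h.eLpNorm_le_of_le_two hc.1 le_rfl hc.2 z1 z2 z3 z4 z5 one_le_two le_rfl
  simp only [layer_zero, eLpNorm_zero, add_zero] at main
  exact ⟨tendsto_of_tendsto_of_tendsto_of_le_of_le' tendsto_const_nhds hlim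
    (Eventually.of_forall fun _ => bot_le) (main.mono fun c hc => hc.1),
    tendsto_of_tendsto_of_tendsto_of_le_of_le' tendsto_const_nhds hlim
    (Eventually.of_forall fun _ => bot_le) (main.mono fun c hc => hc.2)⟩

/-- Besides the data, the perturbation contains `1/c`, due to the electric part of the relative
energy; multiplied by `c^(1-2/p)` it becomes `c^(-2/p)`, which tends to zero. -/
theorem tendsto_rpow_mul_perturbation (hp : 2 < p)
    (hE : Tendsto (fun c : ℝ => c ^ (1 - 2 / p) *
      (‖E₀c c‖ + ‖u₀c c - u₀‖ + ‖B₀c c - B₀‖)) atTop (𝓝 0)) :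
    Tendsto (fun c => c ^ (1 - 2 / p) * S 0 0 c) atTop (𝓝 0) := by
  have t2 : Tendsto (fun c : ℝ => c ^ (-(2 / p))) atTop (𝓝 0) :=
    tendsto_rpow_neg_atTop (by positivity)
  have t3 := (hE.add t2).const_mul (energyConst K T)
  rw [add_zero, mul_zero] at t3
  refine t3.congr' ?_
  filter_upwards [eventually_gt_atTop 0] with c hc
  have : c ^ (-(2 / p)) = c ^ (1 - 2 / p) * (1 / c) := by
    rw [mul_one_div, sub_eq_add_neg, Real.rpow_add hc, Real.rpow_one]
    field_simp
  rw [this, perturbation, sub_zero, zero_div]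
  ring

/-- Interpolating the uniform bound `c S` with the `L²` bound `C S` gives `(c S)^(1-2/p) (C S)^(2/p)
= C^(2/p) c^(1-2/p) S`, precisely the rate in the hypothesis. -/
theorem convergesInLpL2_of_two_lt (h : SolutionFamily m c₀ T M K u E B u₀c E₀c B₀c ub Bb u₀ B₀)
    (hp : 2 < p) (hE : Tendsto (fun c : ℝ => c ^ (1 - 2 / p) *
      (‖E₀c c‖ + ‖u₀c c - u₀‖ + ‖B₀c c - B₀‖)) atTop (𝓝 0)) :
    ConvergesInLpL2 p T (scaledE E) (limitE ub Bb) := by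
  obtain ⟨z1, z2, z3, z4, z5⟩ := zero_field
  have hK := h.bounds.nonneg
  set C := 1 + Real.sqrt M + K * Real.sqrt T with hC
  have hC0 : 0 ≤ C := by positivity
  have hlim : Tendsto (fun c => ENNReal.ofReal (C ^ (2 / p) * (c ^ (1 - 2 / p) * S 0 0 c))) atTop
      (𝓝 0) := by
    simpa using ENNReal.tendsto_ofReal
      ((tendsto_rpow_mul_perturbation (K := K) (T := T) hp hE).const_mul (C ^ (2 / p)))
  refine tendsto_of_tendsto_of_tendsto_of_le_of_le' tendsto_const_nhds hlim
    (Eventually.of_forall fun _ => bot_le) ?_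
  filter_upwards [eventually_ge_atTop c₀, eventually_ge_atTop ((0 : ℝ) + 1)] with c hc hRc
  have hc0 : 0 < c := by linarith
  have hS : 0 ≤ S 0 0 c := perturbation_nonneg le_rfl hc0.le
  have e1 := h.eLpNorm_electric_le hc le_rfl hRc z1 z2 z3 z4 z5
  have e2 := (h.energy hc le_rfl hRc z1 z2 z3 z4 z5).1
  simp only [layer_zero, Pi.zero_apply, sub_zero] at e1 e2
  have q1 : 0 ≤ 1 - 2 / p := by
    rw [sub_nonneg, div_le_one (by linarith)]
    exact hp.le
  have q2 : 0 ≤ 2 / p := by positivity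
  refine (eLpNorm_le_interpolate hp fun t ht => (e2 t (Ioo_subset_Icc_self ht)).2.2).trans ?_
  calc _ ≤ ENNReal.ofReal (c * S 0 0 c) ^ (1 - 2 / p) *
        ENNReal.ofReal (C * S 0 0 c) ^ (2 / p) := by gcongr
    _ = _ := by
      rw [ENNReal.ofReal_rpow_of_nonneg (by positivity) q1,
        ENNReal.ofReal_rpow_of_nonneg (by positivity) q2, ← ENNReal.ofReal_mul (by positivity),
        Real.mul_rpow hc0.le hS, Real.mul_rpow hC0 hS]
      congr 1
      rcases hS.eq_or_lt with h0 | h0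
      · rw [← h0, Real.zero_rpow (by positivity : 2 / p ≠ 0)]
        simp
      · have : S 0 0 c = (S 0 0 c) ^ (1 - 2 / p) * (S 0 0 c) ^ (2 / p) := by
          rw [← Real.rpow_add h0]
          simp
        conv_rhs => rw [this]
        ring

/-- The current error is the electric error plus the products in Ohm's law. For these `S` alone
suffices, and `S ≤ c^(1-2/p) S`, but `B` must be bounded in `L^p(0,T; L^∞)`. -/
theorem convergesInLpL2_current (h : SolutionFamily m c₀ T M K u E B u₀c E₀c B₀c ub Bb u₀ B₀)
    (hp : 2 < p) (hE : Tendsto (fun c : ℝ => c ^ (1 - 2 / p) *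
      (‖E₀c c‖ + ‖u₀c c - u₀‖ + ‖B₀c c - B₀‖)) atTop (𝓝 0)) {M' : ℝ}
    (hM : ∀ c, c₀ ≤ c →
      (∫⁻ t, supNorm (B c t) ^ p ∂timeMeasure T) ^ (1 / p) ≤ ENNReal.ofReal M') :
    ConvergesInLpL2 p T (currents u E B) (limitJ Bb) := by
  obtain ⟨z1, z2, z3, z4, z5⟩ := zero_field
  have hS' := tendsto_rpow_mul_perturbation (K := K) (T := T) hp hE
  have q1 : 0 ≤ 1 - 2 / p := by
    rw [sub_nonneg, div_le_one (by linarith)]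
    exact hp.le
  have hlim : Tendsto (fun c => ENNReal.ofReal (c ^ (1 - 2 / p) * S 0 0 c) *
      (ENNReal.ofReal M' + ENNReal.ofReal K * ENNReal.ofReal T ^ (1 / p))) atTop (𝓝 0) := by
    have h1 := ENNReal.tendsto_ofReal hS'
    rw [ENNReal.ofReal_zero] at h1
    have h2 := ENNReal.Tendsto.mul_const (b := ENNReal.ofReal M' +
      ENNReal.ofReal K * ENNReal.ofReal T ^ (1 / p)) h1 (Or.inr (ENNReal.add_ne_top.2
      ⟨ENNReal.ofReal_ne_top, ENNReal.mul_ne_top ENNReal.ofReal_ne_top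
        (ENNReal.rpow_ne_top_of_nonneg (by positivity) ENNReal.ofReal_ne_top)⟩))
    rwa [zero_mul] at h2
  have h3 := (h.convergesInLpL2_of_two_lt hp hE).add hlim
  rw [add_zero] at h3
  refine tendsto_of_tendsto_of_tendsto_of_le_of_le' tendsto_const_nhds h3
    (Eventually.of_forall fun _ => bot_le) ?_
  filter_upwards [eventually_ge_atTop c₀, eventually_ge_atTop ((0 : ℝ) + 1)] with c hc hRc
  have hc1 : 1 ≤ c := by linarith
  have hS : 0 ≤ S 0 0 c := perturbation_nonneg le_rfl (by linarith)
  have e2 := (h.energy hc le_rfl hRc z1 z2 z3 z4 z5).1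
  have e3 := h.eLpNorm_products hc (by linarith : 1 ≤ p)
    (fun t ht => ⟨(e2 t ht).1, (e2 t ht).2.1⟩) (hM c hc)
  have e4 : eLpNorm (fun t => currents u E B c t - limitJ Bb t) (ENNReal.ofReal p)
      (timeMeasure T) = eLpNorm ((fun t => scaledE E c t - limitE ub Bb t) +
        fun t => leray (crossField (u c t - ub t) (B c t) + crossField (ub t) (B c t - Bb t)))
      (ENNReal.ofReal p) (timeMeasure T) := by
    refine eLpNorm_congr_ae (ae_timeMeasure fun t ht => ?_)
    have := h.electric_sub_current (F := 0) hc (Ioo_subset_Icc_self ht)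
    simp only [layer_zero, Pi.zero_apply, sub_zero] at this
    rw [Pi.add_apply, this, sub_add_cancel]
  rw [e4]
  have e5 := h.aestronglyMeasurable_electric (F := 0) hc
  simp only [layer_zero, Pi.zero_apply, sub_zero] at e5
  refine (eLpNorm_add_le e5 (aestronglyMeasurable_products h.three_le (h.sol c hc) h.lim)
    (by simpa using (by linarith : 1 ≤ p))).trans ?_
  refine add_le_add_right (e3.trans ?_) _
  gcongr
  exact le_mul_of_one_le_left hS (Real.one_le_rpow hc1 q1)

end SolutionFamily

/-! ### Short time integrals -/

section shortTime

variable {T t₁ : ℝ}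

theorem timeMeasure_eq_restrict (h : t₁ ≤ T) :
    timeMeasure t₁ = (timeMeasure T).restrict (Ioo 0 t₁) := by
  rw [timeMeasure, timeMeasure, Measure.restrict_restrict measurableSet_Ioo,
    inter_eq_self_of_subset_left (Ioo_subset_Ioo_right h)]

theorem timeMeasure_mono (h : t₁ ≤ T) : timeMeasure t₁ ≤ timeMeasure T := by
  rw [timeMeasure_eq_restrict h]
  exact Measure.restrict_le_self

theorem ofReal_integral_norm_eq {f : ℝ → L2Field} (hf : ContinuousOn f (Icc 0 t₁)) (ht : 0 ≤ t₁) :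
    ENNReal.ofReal (∫ t in (0 : ℝ)..t₁, ‖f t‖) = eLpNorm f 1 (timeMeasure t₁) := by
  have hi : IntegrableOn (fun s => ‖f s‖) (Ioo 0 t₁) :=
    hf.norm.integrableOn_Icc.mono_set Ioo_subset_Icc_self
  rw [intervalIntegral.integral_of_le ht, integral_Ioc_eq_integral_Ioo,
    ofReal_integral_eq_lintegral_ofReal hi (Eventually.of_forall fun _ => norm_nonneg _),
    eLpNorm_one_eq_lintegral_enorm]
  simp only [ofReal_norm]
  rfl

theorem integral_norm_le_of_eLpNorm_le {f : ℝ → L2Field} {p θ : ℝ} (hp : 1 ≤ p) (hθ : 0 ≤ θ)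
    (ht : 0 < t₁) (hf : ContinuousOn f (Icc 0 t₁))
    (h : eLpNorm f (ENNReal.ofReal p) (timeMeasure t₁) ≤ ENNReal.ofReal θ) :
    ∫ t in (0 : ℝ)..t₁, ‖f t‖ ≤ θ * t₁ ^ (1 - 1 / p) := by
  have h1 : eLpNorm f 1 (timeMeasure t₁) ≤ ENNReal.ofReal (θ * t₁ ^ (1 - 1 / p)) := by
    refine (eLpNorm_le_eLpNorm_mul_rpow_measure_univ (q := ENNReal.ofReal p) (by simpa using hp)
      (aestronglyMeasurable_of_continuousOn hf)).trans ?_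
    rw [ENNReal.toReal_ofReal (by linarith), timeMeasure_univ, ENNReal.toReal_one, div_one,
      ENNReal.ofReal_rpow_of_pos ht, ENNReal.ofReal_mul hθ]
    gcongr
  rw [← ofReal_integral_norm_eq hf ht.le] at h1
  exact (ENNReal.ofReal_le_ofReal_iff (by positivity)).1 h1

/-- A convergent family cannot concentrate at time zero: the limit has small norm on a shrinking
window by absolute continuity of the integral, and the difference is small on the whole interval. -/
theorem HasLimitInLpL2.eventually_eLpNorm_le {f : ℝ → ℝ → L2Field} {p c₀ : ℝ} (hT : 0 < T)
    (hp : 1 ≤ p) (h : HasLimitInLpL2 p T f) (hf : ∀ c, c₀ ≤ c → ContinuousOn (f c) (Icc 0 T))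
    (τ : ℝ) {θ : ℝ} (hθ : 0 < θ) :
    ∀ᶠ c : ℝ in atTop, eLpNorm (f c) (ENNReal.ofReal p) (timeMeasure (τ / c ^ 2)) ≤
      ENNReal.ofReal θ := by
  obtain ⟨F, hF, hlim⟩ := h
  have hp0 : 0 < p := by linarith
  have ht : Tendsto (fun c : ℝ => τ / c ^ 2) atTop (𝓝 0) :=
    tendsto_const_nhds.div_atTop (tendsto_pow_atTop two_ne_zero)
  have hFfin : ∫⁻ t, ‖F t‖ₑ ^ p ∂timeMeasure T ≠ ∞ := by
    have := hF.2
    rw [eLpNorm_timeMeasure hp0] at this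
    exact ((ENNReal.rpow_lt_top_iff_of_pos (by positivity)).1 this).ne
  have h0 : Tendsto (fun c : ℝ => timeMeasure T (Ioo 0 (τ / c ^ 2))) atTop (𝓝 0) := by
    have h1 : Tendsto (fun c : ℝ => ENNReal.ofReal (τ / c ^ 2)) atTop (𝓝 0) := by
      simpa using ENNReal.tendsto_ofReal ht
    refine tendsto_of_tendsto_of_tendsto_of_le_of_le tendsto_const_nhds h1 (fun _ => bot_le)
      fun c => ?_
    refine (Measure.restrict_apply_le _ _).trans ?_
    simp
  have h2 := (tendsto_setLIntegral_zero hFfin h0).ennrpow_const (1 / p)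
  rw [ENNReal.zero_rpow_of_pos (by positivity)] at h2
  have h3 := hlim.add h2
  rw [add_zero] at h3
  filter_upwards [ENNReal.tendsto_nhds_zero.1 h3 _ (ENNReal.ofReal_pos.2 hθ),
    ht.eventually_le_const hT, eventually_ge_atTop c₀] with c hc htc hcc
  refine le_trans ?_ hc
  have e1 : f c = (fun t => f c t - F t) + F := by funext t; simp
  have m1 : AEStronglyMeasurable (f c) (timeMeasure T) :=
    aestronglyMeasurable_of_continuousOn (hf c hcc)
  have hmono := timeMeasure_mono htc
  have e2 := eLpNorm_add_le (p := ENNReal.ofReal p) ((m1.sub hF.1).mono_measure hmono)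
    (hF.1.mono_measure hmono) (by simpa using hp)
  have e3 : (f c - F) + F = f c := by funext t; simp
  rw [e3] at e2
  refine e2.trans (add_le_add (eLpNorm_mono_measure _ hmono) ?_)
  rw [eLpNorm_timeMeasure hp0, timeMeasure_eq_restrict htc]

end shortTime

/-! ### The initial layer of the electric field -/

namespace SolutionFamily

variable {m : ℕ} {c₀ T M K : ℝ} {u E B : ℝ → ℝ → L2Field} {u₀c E₀c B₀c : ℝ → L2Field}
  {ub Bb : ℝ → L2Field} {u₀ B₀ F : L2Field} {c A Q t₁ p : ℝ}

local notation "S" => perturbation K T u₀c B₀c E₀c u₀ B₀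

theorem continuousOn_scaledE (h : SolutionFamily m c₀ T M K u E B u₀c E₀c B₀c ub Bb u₀ B₀)
    (hc : c₀ ≤ c) : ContinuousOn (scaledE E c) (Icc 0 T) :=
  (h.sol c hc).continuous_E.continuousOn.const_smul c

theorem continuousOn_currents (h : SolutionFamily m c₀ T M K u E B u₀c E₀c B₀c ub Bb u₀ B₀)
    (hc : c₀ ≤ c) : ContinuousOn (currents u E B c) (Icc 0 T) :=
  (h.sol c hc).continuousOn_current h.three_le

theorem continuousOn_product (h : SolutionFamily m c₀ T M K u E B u₀c E₀c B₀c ub Bb u₀ B₀)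
    (hc : c₀ ≤ c) : ContinuousOn (fun t => leray (crossField (u c t) (B c t))) (Icc 0 T) :=
  leray.continuous.comp_continuousOn
    (((h.sol c hc).continuous_u.mono (by linarith [h.three_le])).crossField
      ((h.sol c hc).continuous_B.mono (by linarith [h.three_le])))

theorem energy_zero (h : SolutionFamily m c₀ T M K u E B u₀c E₀c B₀c ub Bb u₀ B₀) (hc : c₀ ≤ c)
    (hc1 : 1 ≤ c) {t : ℝ} (ht : t ∈ Icc 0 T) :
    ‖u c t - ub t‖ ≤ S 0 0 c ∧ ‖B c t - Bb t‖ ≤ S 0 0 c := by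
  obtain ⟨z1, z2, z3, z4, z5⟩ := zero_field
  have := (h.energy hc le_rfl (by linarith) z1 z2 z3 z4 z5).1 t ht
  exact ⟨this.1, this.2.1⟩

/-- Ampère's law is tested with `E₀`. The curl of `B - B̄` is moved onto `E₀`, where the `H¹` bound
`Q` controls it, and `∇ × B̄` is bounded by `K`. The assumption that the perturbation is at most `A
‖E₀‖` makes every term proportional to `‖E₀‖`, which is then divided out. -/
theorem norm_initial_le (h : SolutionFamily m c₀ T M K u E B u₀c E₀c B₀c ub Bb u₀ B₀)
    (hc : c₀ ≤ c) (hc1 : 1 ≤ c) (hQ : sobolevNorm 1 (E₀c c) ≤ Q) (hn : 0 < ‖E₀c c‖)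
    (hS : S 0 0 c ≤ A * ‖E₀c c‖) {t : ℝ} (ht : t ∈ Icc 0 T) :
    ‖E₀c c‖ ≤ ‖E c t‖ + c * (3 * Q * A + K) * t +
      c * ∫ s in (0 : ℝ)..t, ‖currents u E B c s‖ := by
  set n := ‖E₀c c‖ with hn'
  have hc0 : 0 < c := by linarith
  obtain ⟨m1, -⟩ := h.memH_initial hc
  have hQ0 : 0 ≤ Q := (sobolevNorm_nonneg _ _).trans hQ
  have hsol := h.sol c hc
  obtain ⟨hIc, hId⟩ := hasDerivAt_integral_of_continuousOn (h.continuousOn_currents hc).norm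
  set g : ℝ → ℝ := fun t => -(inner ℝ (E c t) (E₀c c) + n * (c * (3 * Q * A + K)) * t +
    n * c * ∫ s in (0 : ℝ)..t, ‖currents u E B c s‖) with hg
  have hgc : ContinuousOn g (Icc 0 T) :=
    (((hsol.continuous_E.continuousOn.inner continuousOn_const).add
      (continuous_id.const_mul _).continuousOn).add (hIc.const_mul _)).neg
  have key : g t ≤ g 0 := by
    refine le_of_touching_above hgc (fun t ht => ?_) ht
    have ht' := Ioo_subset_Icc_self ht
    obtain ⟨E', hE', h3⟩ := hsol.ampere t ht
    have e3 : E' = c • (curl (B c t) - currents u E B c t) := by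
      have : E' = c • ((1 / c) • E' - curl (B c t)) + c • curl (B c t) := by
        rw [smul_sub, smul_smul, mul_one_div_cancel hc0.ne', one_smul]; abel
      rw [this, h3, smul_sub, smul_neg, currents]; abel
    refine ⟨g, _, rfl, Eventually.of_forall fun _ => le_rfl,
      (((hE'.inner ℝ (hasDerivAt_const t (E₀c c))).add
        ((hasDerivAt_id t).const_mul _)).add ((hId t ht).const_mul _)).neg, ?_⟩
    have B1 : MemH 1 (B c t) := (hsol.continuous_B.1 t ht').mono (by linarith [h.three_le])
    have Bb1 : MemH 1 (Bb t) := (h.bounds.memH_B t ht').mono (by norm_num)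
    have e4 : inner ℝ (curl (B c t)) (E₀c c) =
        inner ℝ (B c t - Bb t) (curl (E₀c c)) + inner ℝ (curl (Bb t)) (E₀c c) := by
      rw [← inner_curl_left (B1.sub Bb1) m1, curl_sub B1 Bb1, inner_sub_left]
      ring
    have e5 : -inner ℝ (B c t - Bb t) (curl (E₀c c)) ≤ A * n * (3 * Q) :=
      (neg_le_abs _).trans ((abs_real_inner_le_norm _ _).trans (mul_le_mul
        ((h.energy_zero hc hc1 ht').2.trans hS)
        ((norm_curl_le _).trans (by gcongr)) (norm_nonneg _)
        ((norm_nonneg _).trans ((h.energy_zero hc hc1 ht').2.trans hS))))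
    have e6 : -inner ℝ (curl (Bb t)) (E₀c c) ≤ K * n :=
      (neg_le_abs _).trans ((abs_real_inner_le_norm _ _).trans
        (by gcongr; exact h.bounds.norm_curl t ht'))
    have e7 : inner ℝ (currents u E B c t) (E₀c c) ≤ ‖currents u E B c t‖ * n :=
      real_inner_le_norm _ _
    rw [e3, inner_zero_right, inner_smul_left, inner_sub_left, e4]
    have e8 : -(inner ℝ (B c t - Bb t) (curl (E₀c c)) + inner ℝ (curl (Bb t)) (E₀c c) -
        inner ℝ (currents u E B c t) (E₀c c)) ≤
        n * (3 * Q * A + K) + n * ‖currents u E B c t‖ := by linarith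
    have e9 := mul_le_mul_of_nonneg_left e8 hc0.le
    simp only [conj_trivial]
    linarith
  have k0 : g 0 = -(n * n) := by
    simp only [hg, hsol.initial_E, real_inner_self_eq_norm_mul_norm, intervalIntegral.integral_same]
    ring
  rw [k0] at key
  have k1 : inner ℝ (E c t) (E₀c c) ≤ ‖E c t‖ * n := real_inner_le_norm _ _
  simp only [hg] at key
  refine le_of_mul_le_mul_left ?_ hn
  linarith

/-- The preceding bound integrated over `(0, t₁)`, so that the electric field also enters only
through an integral, as convergence in `L^p` requires. -/
theorem mul_norm_initial_le (h : SolutionFamily m c₀ T M K u E B u₀c E₀c B₀c ub Bb u₀ B₀)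
    (hc : c₀ ≤ c) (hc1 : 1 ≤ c) (hQ : sobolevNorm 1 (E₀c c) ≤ Q) (hn : 0 < ‖E₀c c‖)
    (hA : 0 ≤ A) (hS : S 0 0 c ≤ A * ‖E₀c c‖) (ht₁ : 0 < t₁) (htT : t₁ ≤ T) :
    ‖E₀c c‖ * t₁ ≤ (∫ t in (0 : ℝ)..t₁, ‖scaledE E c t‖) / c + c * (3 * Q * A + K) * t₁ * t₁ +
      c * (∫ t in (0 : ℝ)..t₁, ‖currents u E B c t‖) * t₁ := by
  have hc0 : 0 < c := by linarith
  have hQ0 : 0 ≤ Q := (sobolevNorm_nonneg _ _).trans hQ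
  have hK := h.bounds.nonneg
  have hsub : Icc 0 t₁ ⊆ Icc 0 T := Icc_subset_Icc_right htT
  have hEc : ContinuousOn (fun t => ‖scaledE E c t‖) (Icc 0 t₁) :=
    (h.continuousOn_scaledE hc).norm.mono hsub
  have hjc : ContinuousOn (fun t => ‖currents u E B c t‖) (Icc 0 t₁) :=
    (h.continuousOn_currents hc).norm.mono hsub
  set I := ∫ t in (0 : ℝ)..t₁, ‖currents u E B c t‖ with hI
  have h1 : ∀ t ∈ Icc 0 t₁, ‖E₀c c‖ ≤ ‖scaledE E c t‖ / c +
      (c * (3 * Q * A + K) * t₁ + c * I) := by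
    intro t ht
    have e1 := h.norm_initial_le hc hc1 hQ hn hS (hsub ht)
    have e2 : ‖scaledE E c t‖ / c = ‖E c t‖ := by
      rw [scaledE, norm_smul, Real.norm_of_nonneg hc0.le, mul_div_cancel_left₀ _ hc0.ne']
    have e3 : c * (3 * Q * A + K) * t ≤ c * (3 * Q * A + K) * t₁ := by
      gcongr
      exact ht.2
    have e4 : ∫ s in (0 : ℝ)..t, ‖currents u E B c s‖ ≤ I :=
      intervalIntegral.integral_mono_interval le_rfl ht.1 ht.2
        (Eventually.of_forall fun _ => norm_nonneg _) (hjc.intervalIntegrable_of_Icc ht₁.le)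
    have e5 := mul_le_mul_of_nonneg_left e4 hc0.le
    rw [e2]
    linarith
  have hint : IntervalIntegrable (fun t => ‖scaledE E c t‖) volume 0 t₁ :=
    hEc.intervalIntegrable_of_Icc ht₁.le
  have h2 := intervalIntegral.integral_mono_on ht₁.le
    (intervalIntegrable_const (c := ‖E₀c c‖)) ((hint.div_const c).add intervalIntegrable_const) h1
  rw [intervalIntegral.integral_add (hint.div_const c) intervalIntegrable_const,
    intervalIntegral.integral_div, intervalIntegral.integral_const,
    intervalIntegral.integral_const, sub_zero, smul_eq_mul, smul_eq_mul] at h2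
  linarith

/-- The part `ū × B̄` is bounded and contributes `O(t₁)`. The rest is controlled only in `L²` in
time and contributes `√t₁`; on the window `t₁ = q²/c²` this is `q/c`, the borderline size. -/
theorem integral_product_le (h : SolutionFamily m c₀ T M K u E B u₀c E₀c B₀c ub Bb u₀ B₀)
    (hc : c₀ ≤ c) (hc1 : 1 ≤ c) (ht₁ : 0 < t₁) (htT : t₁ ≤ T) :
    ∫ t in (0 : ℝ)..t₁, ‖leray (crossField (u c t) (B c t))‖ ≤
      (Real.sqrt M + K * Real.sqrt T) * S 0 0 c * Real.sqrt t₁ + K * K * t₁ := by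
  have hK := h.bounds.nonneg
  have hsub : Icc 0 t₁ ⊆ Icc 0 T := Icc_subset_Icc_right htT
  have hS : 0 ≤ S 0 0 c := perturbation_nonneg le_rfl (by linarith)
  set X : ℝ → L2Field := fun t => leray (crossField (u c t - ub t) (B c t) +
    crossField (ub t) (B c t - Bb t)) with hX
  set Y : ℝ → L2Field := fun t => leray (crossField (ub t) (Bb t)) with hY
  have hXY : ∀ t ∈ Icc 0 T, X t = leray (crossField (u c t) (B c t)) - Y t := fun t ht => by
    simp only [hX, hY]
    rw [← map_sub, ← crossField_sub_crossField
      (((h.sol c hc).continuous_B.1 t ht).mono (by linarith [h.three_le]))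
      (h.bounds.memH_u t ht).of_succ]
  have hYc : ContinuousOn Y (Icc 0 T) :=
    leray.continuous.comp_continuousOn
      ((h.lim.continuous_u.mono (by linarith [h.three_le])).crossField
        (h.lim.continuous_B.mono (by linarith [h.three_le])))
  have hXc : ContinuousOn X (Icc 0 T) := ((h.continuousOn_product hc).sub hYc).congr hXY
  have e1 := h.eLpNorm_products hc one_le_two (fun t ht => h.energy_zero hc hc1 ht)
    (h.bdd_B_sqrt hc)
  have e2 : eLpNorm X (ENNReal.ofReal 2) (timeMeasure t₁) ≤
      ENNReal.ofReal ((Real.sqrt M + K * Real.sqrt T) * S 0 0 c) := by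
    refine ((eLpNorm_mono_measure _ (timeMeasure_mono htT)).trans e1).trans_eq ?_
    rw [ENNReal.ofReal_rpow_of_nonneg h.pos_T.le (by norm_num), ← Real.sqrt_eq_rpow,
      ← ENNReal.ofReal_mul hK, ← ENNReal.ofReal_add (by positivity) (by positivity),
      ← ENNReal.ofReal_mul hS, mul_comm]
  have e3 := integral_norm_le_of_eLpNorm_le one_le_two (by positivity) ht₁ (hXc.mono hsub) e2
  have e4 : t₁ ^ ((1 : ℝ) - 1 / 2) = Real.sqrt t₁ := by
    rw [Real.sqrt_eq_rpow]
    norm_num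
  rw [e4] at e3
  have i1 : IntervalIntegrable (fun t => ‖X t‖) volume 0 t₁ :=
    (hXc.mono hsub).norm.intervalIntegrable_of_Icc ht₁.le
  have e5 := intervalIntegral.integral_mono_on ht₁.le
    (((h.continuousOn_product hc).mono hsub).norm.intervalIntegrable_of_Icc ht₁.le)
    (i1.add (intervalIntegrable_const (c := K * K))) fun t ht => by
      have k1 := hXY t (hsub ht)
      have k2 : ‖Y t‖ ≤ K * K := (norm_leray_le _).trans
        ((norm_crossField_le_left (h.bounds.bdd_u t (hsub ht)) _).trans
          (by gcongr; exact h.bounds.norm_B t (hsub ht)))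
      have k3 : leray (crossField (u c t) (B c t)) = X t + Y t := by rw [k1]; abel
      rw [k3]
      exact (norm_add_le _ _).trans (by linarith)
  rw [intervalIntegral.integral_add i1 intervalIntegrable_const, intervalIntegral.integral_const,
    sub_zero, smul_eq_mul] at e5
  linarith

theorem integral_norm_comparison (h : SolutionFamily m c₀ T M K u E B u₀c E₀c B₀c ub Bb u₀ B₀)
    (hc : c₀ ≤ c) (ht₁ : 0 < t₁) (htT : t₁ ≤ T) :
    (∫ t in (0 : ℝ)..t₁, ‖scaledE E c t‖) ≤ (∫ t in (0 : ℝ)..t₁, ‖currents u E B c t‖) +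
        ∫ t in (0 : ℝ)..t₁, ‖leray (crossField (u c t) (B c t))‖ ∧
      (∫ t in (0 : ℝ)..t₁, ‖currents u E B c t‖) ≤ (∫ t in (0 : ℝ)..t₁, ‖scaledE E c t‖) +
        ∫ t in (0 : ℝ)..t₁, ‖leray (crossField (u c t) (B c t))‖ := by
  have hsub : Icc 0 t₁ ⊆ Icc 0 T := Icc_subset_Icc_right htT
  have i1 := ((h.continuousOn_scaledE hc).mono hsub).norm.intervalIntegrable_of_Icc
    (μ := volume) ht₁.le
  have i2 := ((h.continuousOn_currents hc).mono hsub).norm.intervalIntegrable_of_Icc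
    (μ := volume) ht₁.le
  have i3 := ((h.continuousOn_product hc).mono hsub).norm.intervalIntegrable_of_Icc
    (μ := volume) ht₁.le
  rw [← intervalIntegral.integral_add i2 i3, ← intervalIntegral.integral_add i1 i3]
  refine ⟨intervalIntegral.integral_mono_on ht₁.le i1 (i2.add i3) fun t _ => ?_,
    intervalIntegral.integral_mono_on ht₁.le i2 (i1.add i3) fun t _ => norm_add_le _ _⟩
  have : scaledE E c t = currents u E B c t - leray (crossField (u c t) (B c t)) := by
    simp [scaledE, currents, current]
  rw [this]
  exact norm_sub_le _ _

/-- Positivity of the bracket makes `‖E₀‖` dominate the errors of `u₀` and `B₀`, which accounts for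
the constant `2`. Since `c^(1-2/p) ≤ c`, the lower bound also gives `1/c ≤ ‖E₀‖/α`. -/
theorem perturbation_le_of_large {α : ℝ} (hα : 0 < α) (hc : 1 ≤ c) (hp : 2 ≤ p)
    (h : α ≤ c ^ (1 - 2 / p) * (‖E₀c c‖ - ‖u₀c c - u₀‖ - ‖B₀c c - B₀‖)) :
    0 < ‖E₀c c‖ ∧ α ≤ c ^ (1 - 2 / p) * ‖E₀c c‖ ∧
      S 0 0 c ≤ energyConst K T * (2 + 1 / α) * ‖E₀c c‖ := by
  have hc0 : 0 < c := by linarith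
  have x1 := norm_nonneg (u₀c c - u₀)
  have x2 := norm_nonneg (B₀c c - B₀)
  have hr : 0 < c ^ (1 - 2 / p) := Real.rpow_pos_of_pos hc0 _
  have h1 : α ≤ c ^ (1 - 2 / p) * ‖E₀c c‖ := h.trans (by gcongr; linarith)
  have h2 : 0 < ‖E₀c c‖ := by
    by_contra hcon
    have : ‖E₀c c‖ = 0 := le_antisymm (not_lt.1 hcon) (norm_nonneg _)
    rw [this, mul_zero] at h1
    linarith
  have h3 : 0 < ‖E₀c c‖ - ‖u₀c c - u₀‖ - ‖B₀c c - B₀‖ :=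
    pos_of_mul_pos_right (hα.trans_le h) hr.le
  have h4 : c ^ (1 - 2 / p) ≤ c := by
    have := Real.rpow_le_rpow_of_exponent_le hc
      (by have : 0 ≤ 2 / p := by positivity
          linarith : 1 - 2 / p ≤ 1)
    rwa [Real.rpow_one] at this
  have h5 : 1 / c ≤ 1 / α * ‖E₀c c‖ := by
    rw [div_le_iff₀ hc0, mul_assoc, one_div, ← div_eq_inv_mul, le_div_iff₀ hα, one_mul]
    calc α ≤ c ^ (1 - 2 / p) * ‖E₀c c‖ := h1
      _ ≤ c * ‖E₀c c‖ := by gcongr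
      _ = _ := mul_comm _ _
  refine ⟨h2, h1, ?_⟩
  rw [perturbation, mul_assoc, sub_zero, zero_div]
  refine mul_le_mul_of_nonneg_left ?_ (energyConst_nonneg K T)
  linarith

/-- If the initial electric field is too large, then neither the electric field nor the current
has a limit. -/
theorem not_hasLimitInLpL2 (h : SolutionFamily m c₀ T M K u E B u₀c E₀c B₀c ub Bb u₀ B₀)
    (hE : ∃ Q : ℝ, ∀ c, c₀ ≤ c → sobolevNorm 1 (E₀c c) ≤ Q) (hp : 2 ≤ p) {α : ℝ} (hα : 0 < α)
    (hfreq : ∃ᶠ c : ℝ in atTop,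
      α ≤ c ^ (1 - 2 / p) * (‖E₀c c‖ - ‖u₀c c - u₀‖ - ‖B₀c c - B₀‖)) :
    ¬ HasLimitInLpL2 p T (scaledE E) ∧ ¬ HasLimitInLpL2 p T (currents u E B) := by
  obtain ⟨Q, hQ⟩ := hE
  have hQ0 : 0 ≤ Q := (sobolevNorm_nonneg 1 _).trans (hQ c₀ le_rfl)
  have hK := h.bounds.nonneg
  have hp0 : 0 < p := by linarith
  set A := energyConst K T * (2 + 1 / α) with hA
  have hA0 : 0 ≤ A := mul_nonneg (energyConst_nonneg _ _) (by positivity)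
  set L := (Real.sqrt M + K * Real.sqrt T) * A with hL
  have hL0 : 0 ≤ L := by positivity
  have hC₁ : 0 ≤ 3 * Q * A + K := by positivity
  -- The part common to both families. The premise bounds `‖E₀‖` by the mean of `‖f‖` over the
  -- window times `(1 + q²)/c`, a term `O(1/c)`, and half of itself. Multiplied by `c^(1-2/p)`, the
  -- first two become small if `f` has a limit, whereas the left side is at least `α`.
  have main : ∀ (f : ℝ → ℝ → L2Field) (q : ℝ), 0 < q → HasLimitInLpL2 p T f →
      (∀ c, c₀ ≤ c → ContinuousOn (f c) (Icc 0 T)) →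
      (∀ c, c₀ ≤ c → 1 ≤ c → q ^ 2 / c ^ 2 ≤ T → 0 < ‖E₀c c‖ → S 0 0 c ≤ A * ‖E₀c c‖ →
        ‖E₀c c‖ ≤ (∫ t in (0 : ℝ)..(q ^ 2 / c ^ 2), ‖f c t‖) / (q ^ 2 / c ^ 2) * ((1 + q ^ 2) / c) +
          (3 * Q * A + K + K * K) * (1 + q ^ 2) / c + (1 / 2) * ‖E₀c c‖) → False := by
    intro f q hq hlim hfc hest
    set σ := (q ^ 2) ^ (-(1 / p)) with hσ
    have hσ0 : 0 < σ := by positivity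
    -- Chosen so that the contribution of `f` after multiplication is exactly `α/8`. With `α/8` for
    -- the remainder this gives `c^(1-2/p) ‖E₀‖ ≤ α/2`, a contradiction.
    set θ := α / (8 * (σ * (1 + q ^ 2))) with hθ
    have hθ0 : 0 < θ := by positivity
    have t1 : Tendsto (fun c : ℝ => q ^ 2 / c ^ 2) atTop (𝓝 0) :=
      tendsto_const_nhds.div_atTop (tendsto_pow_atTop two_ne_zero)
    have t2 : Tendsto (fun c : ℝ => (3 * Q * A + K + K * K) * (1 + q ^ 2) * c ^ (-(2 / p))) atTop
        (𝓝 0) := by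
      simpa using (tendsto_rpow_neg_atTop (by positivity : 0 < 2 / p)).const_mul
        ((3 * Q * A + K + K * K) * (1 + q ^ 2))
    have hev := hlim.eventually_eLpNorm_le h.pos_T (by linarith) hfc (q ^ 2) hθ0
    obtain ⟨c, hcα, hcθ, hcT, hc, hc1, hcρ⟩ := (hfreq.and_eventually (hev.and
      ((t1.eventually_le_const h.pos_T).and ((eventually_ge_atTop c₀).and
        ((eventually_ge_atTop 1).and (t2.eventually_le_const
          (by positivity : 0 < α / 8))))))).exists
    have hc0 : 0 < c := by linarith
    obtain ⟨n0, n1, n2⟩ := perturbation_le_of_large (K := K) (T := T) hα hc1 hp hcα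
    set τ := q ^ 2 / c ^ 2 with hτ
    have hτ0 : 0 < τ := by positivity
    have e1 := integral_norm_le_of_eLpNorm_le (by linarith : 1 ≤ p) hθ0.le hτ0
      ((hfc c hc).mono (Icc_subset_Icc_right hcT)) hcθ
    have e2 : τ ^ (1 - 1 / p) = τ * (σ * c ^ (2 / p)) := by
      rw [sub_eq_add_neg, Real.rpow_add hτ0, Real.rpow_one]
      congr 1
      rw [hτ, Real.div_rpow (by positivity) (by positivity), hσ, div_eq_mul_inv]
      congr 1
      rw [← Real.rpow_neg (by positivity), neg_neg, ← Real.rpow_natCast, ← Real.rpow_mul hc0.le]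
      congr 1
      push_cast
      ring
    rw [e2] at e1
    have e3 : (∫ t in (0 : ℝ)..τ, ‖f c t‖) / τ ≤ θ * (σ * c ^ (2 / p)) := by
      rw [div_le_iff₀ hτ0]
      linarith
    have e4 := hest c hc hc1 hcT n0 n2
    rw [← hτ] at e4
    set ρ := c ^ (2 / p) with hρ
    have hρ0 : 0 < ρ := by positivity
    have e5 : c ^ (1 - 2 / p) = c / ρ := by rw [Real.rpow_sub hc0, Real.rpow_one]
    have e6 : c ^ (-(2 / p)) = 1 / ρ := by rw [Real.rpow_neg hc0.le, one_div]
    have e7 : (∫ t in (0 : ℝ)..τ, ‖f c t‖) / τ * ((1 + q ^ 2) / c) ≤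
        θ * (σ * ρ) * ((1 + q ^ 2) / c) := by gcongr
    have e8 : ‖E₀c c‖ ≤ θ * (σ * ρ) * ((1 + q ^ 2) / c) +
          (3 * Q * A + K + K * K) * (1 + q ^ 2) / c + (1 / 2) * ‖E₀c c‖ := by linarith
    have e9 := mul_le_mul_of_nonneg_left e8 (by positivity : 0 ≤ c / ρ)
    have e10 : c / ρ * (θ * (σ * ρ) * ((1 + q ^ 2) / c) +
          (3 * Q * A + K + K * K) * (1 + q ^ 2) / c + (1 / 2) * ‖E₀c c‖) =
        θ * (σ * (1 + q ^ 2)) + (3 * Q * A + K + K * K) * (1 + q ^ 2) * (1 / ρ) +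
          (1 / 2) * (c / ρ * ‖E₀c c‖) := by field_simp
    have e11 : θ * (σ * (1 + q ^ 2)) = α / 8 := by rw [hθ]; field_simp
    rw [e10, e11] at e9
    rw [e6] at hcρ
    rw [e5] at n1
    linarith
  have hroot : ∀ q c : ℝ, 0 < q → 0 < c → Real.sqrt (q ^ 2 / c ^ 2) = q / c := fun q c hq hc => by
    rw [← div_pow, Real.sqrt_sq (by positivity)]
  refine ⟨fun hlim => ?_, fun hlim => ?_⟩
  -- For the electric field the current is eliminated from Ampère's law. The product then
  -- contributes `L q ‖E₀‖`, which a small `q` makes at most half of `‖E₀‖`.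
  · set q := 1 / (2 * (L + 1)) with hq
    have hq0 : 0 < q := by positivity
    refine main _ q hq0 hlim (fun c hc => h.continuousOn_scaledE hc) ?_
    intro c hc hc1 hcT hn hS
    have hc0 : 0 < c := by linarith
    set τ := q ^ 2 / c ^ 2 with hτ
    have hτ0 : 0 < τ := by positivity
    have e1 := h.mul_norm_initial_le hc hc1 (hQ c hc) hn hA0 hS hτ0 hcT
    have e2 := h.integral_product_le hc hc1 hτ0 hcT
    have e3 := (h.integral_norm_comparison hc hτ0 hcT).2
    rw [hτ, hroot q c hq0 hc0, ← hτ] at e2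
    set n := ‖E₀c c‖ with hn'
    set I := ∫ t in (0 : ℝ)..τ, ‖scaledE E c t‖
    have e4 : (Real.sqrt M + K * Real.sqrt T) * S 0 0 c * (q / c) ≤ L * n * (q / c) := by
      rw [hL, mul_assoc _ A]
      gcongr
    have e5 : n * τ ≤ I / c + c * (3 * Q * A + K) * τ * τ +
        c * (I + (L * n * (q / c) + K * K * τ)) * τ := by
      refine e1.trans ?_
      gcongr
      linarith
    have e6 : n ≤ I / τ * (1 / c) + c * (3 * Q * A + K) * τ + c * I + L * q * n +
        c * (K * K * τ) := by
      refine le_of_mul_le_mul_right (e5.trans_eq ?_) hτ0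
      field_simp
      ring
    have e7 : c * I = I / τ * (q ^ 2 / c) := by rw [hτ]; field_simp
    have e8 : c * τ = q ^ 2 / c := by rw [hτ]; field_simp
    have e9 : L * q ≤ 1 / 2 := by
      rw [hq, mul_one_div, div_le_iff₀ (by positivity)]
      linarith
    have e10 := mul_le_mul_of_nonneg_right e9 hn.le
    have e11 : (3 * Q * A + K + K * K) * (q ^ 2 / c) ≤
        (3 * Q * A + K + K * K) * (1 + q ^ 2) / c := by
      rw [mul_div_assoc]
      gcongr
      linarith
    have e12 : c * (3 * Q * A + K) * τ + c * (K * K * τ) =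
        (3 * Q * A + K + K * K) * (q ^ 2 / c) := by rw [← e8]; ring
    have e13 : I / τ * (1 / c) + I / τ * (q ^ 2 / c) = I / τ * ((1 + q ^ 2) / c) := by ring
    linarith
  -- For the current it is the electric field that is eliminated. The product then contributes
  -- `(L/q) ‖E₀‖`, and `q` has to be large instead.
  · set q := 2 * (L + 1) with hq
    have hq0 : 0 < q := by positivity
    refine main _ q hq0 hlim (fun c hc => h.continuousOn_currents hc) ?_
    intro c hc hc1 hcT hn hS
    have hc0 : 0 < c := by linarith
    set τ := q ^ 2 / c ^ 2 with hτ
    have hτ0 : 0 < τ := by positivity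
    have e1 := h.mul_norm_initial_le hc hc1 (hQ c hc) hn hA0 hS hτ0 hcT
    have e2 := h.integral_product_le hc hc1 hτ0 hcT
    have e3 := (h.integral_norm_comparison hc hτ0 hcT).1
    rw [hτ, hroot q c hq0 hc0, ← hτ] at e2
    set n := ‖E₀c c‖ with hn'
    set I := ∫ t in (0 : ℝ)..τ, ‖currents u E B c t‖
    have e4 : (Real.sqrt M + K * Real.sqrt T) * S 0 0 c * (q / c) ≤ L * n * (q / c) := by
      rw [hL, mul_assoc _ A]
      gcongr
    have e5 : n * τ ≤ (I + (L * n * (q / c) + K * K * τ)) / c + c * (3 * Q * A + K) * τ * τ +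
        c * I * τ := by
      refine e1.trans ?_
      gcongr
      linarith
    have e6 : n ≤ I / τ * (1 / c) + L / q * n + K * K * (1 / c) + c * (3 * Q * A + K) * τ +
        c * I := by
      refine le_of_mul_le_mul_right (e5.trans_eq ?_) hτ0
      have : L * n * (q / c) / c = L / q * n * τ := by rw [hτ]; field_simp
      rw [add_div, add_div, this]
      field_simp
      ring
    have e7 : c * I = I / τ * (q ^ 2 / c) := by rw [hτ]; field_simp
    have e8 : c * τ = q ^ 2 / c := by rw [hτ]; field_simp
    have e9 : L / q ≤ 1 / 2 := by
      rw [hq, div_le_iff₀ (by positivity)]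
      linarith
    have e10 := mul_le_mul_of_nonneg_right e9 hn.le
    have e11 : (3 * Q * A + K) * (q ^ 2 / c) + K * K * (1 / c) ≤
        (3 * Q * A + K + K * K) * (1 + q ^ 2) / c := by
      have : (3 * Q * A + K + K * K) * (1 + q ^ 2) / c = ((3 * Q * A + K) * (q ^ 2 / c) +
        K * K * (1 / c)) + ((3 * Q * A + K) * (1 / c) + K * K * (q ^ 2 / c)) := by ring
      rw [this]
      have : 0 ≤ (3 * Q * A + K) * (1 / c) + K * K * (q ^ 2 / c) := by positivity
      linarith
    have e12 : c * (3 * Q * A + K) * τ = (3 * Q * A + K) * (q ^ 2 / c) := by rw [← e8]; ring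
    have e13 : I / τ * (1 / c) + I / τ * (q ^ 2 / c) = I / τ * ((1 + q ^ 2) / c) := by ring
    linarith

end SolutionFamily

/-! ### Quantitative forms of the hypotheses for non-convergence -/

theorem frequently_le_of_not_tendsto {x y z : ℝ → ℝ} (hx : ∀ c, 0 ≤ x c)
    (hxt : ¬ Tendsto x atTop (𝓝 0)) (hy : Tendsto y atTop (𝓝 0)) (hz : Tendsto z atTop (𝓝 0)) :
    ∃ α : ℝ, 0 < α ∧ ∃ᶠ c in atTop, α ≤ x c - y c - z c := by
  have h1 : ∃ β : ℝ, 0 < β ∧ ∃ᶠ c in atTop, β ≤ x c := by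
    by_contra hcon
    push Not at hcon
    refine hxt (tendsto_order.2 ⟨fun a ha => Eventually.of_forall fun c => ha.trans_le (hx c),
      fun a ha => ?_⟩)
    exact hcon a ha
  obtain ⟨β, hβ, hf⟩ := h1
  refine ⟨β / 2, by positivity, (hf.and_eventually ((hy.eventually_le_const
    (by positivity : 0 < β / 4)).and (hz.eventually_le_const (by positivity : 0 < β / 4)))).mono
    fun c hc => ?_⟩
  linarith [hc.1, hc.2.1, hc.2.2]

/-- With the limsup taken in the extended reals no boundedness of `x` is required, and the case of
an infinite limsup is included. -/
theorem frequently_le_of_limsup_pos {x : ℝ → ℝ}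
    (h : 0 < limsup (fun c => ((x c : ℝ) : EReal)) atTop) :
    ∃ α : ℝ, 0 < α ∧ ∃ᶠ c in atTop, α ≤ x c := by
  obtain ⟨α, h0, h1⟩ := EReal.lt_iff_exists_real_btwn.1 h
  refine ⟨α, by exact_mod_cast h0, (frequently_lt_of_lt_limsup (by isBoundedDefault) h1).mono
    fun c hc => ?_⟩
  exact_mod_cast hc.le

end EulerMaxwell

end

/-! ### The theorem -/

open EulerMaxwell


theorem corollary1p3
    (m : ℕ) (hm : (5 / 2 : ℝ) < m) (c₀ : ℝ) (hc₀ : 0 < c₀) (T : ℝ) (hT : 0 < T)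
    -- initial data
    (u₀c E₀c B₀c : ℝ → L2Field) (u₀ B₀ : L2Field)
    (hdata : ∀ c, c₀ ≤ c → MemH m (u₀c c) ∧ MemH m (E₀c c) ∧ MemH m (B₀c c) ∧
      u₀c c ∈ solenoidal ∧ E₀c c ∈ solenoidal ∧ B₀c c ∈ solenoidal)
    (hu₀ : MemH m u₀) (hB₀ : MemH m B₀)
    (hu₀_lim : Tendsto (fun c => ‖u₀c c - u₀‖) atTop (𝓝 0))
    (hB₀_lim : Tendsto (fun c => ‖B₀c c - B₀‖) atTop (𝓝 0))
    (hE₀_bdd : ∃ K : ℝ, ∀ c, c₀ ≤ c → sobolevNorm 1 (E₀c c) ≤ K)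
    -- the solutions
    (u E B : ℝ → ℝ → L2Field)
    (hEM : ∀ c, c₀ ≤ c → IsEulerMaxwellSolution m c T (u c) (E c) (B c) (u₀c c) (E₀c c) (B₀c c))
    (ub Bb : ℝ → L2Field)
    (hMHD : IsMHDSolution m T ub Bb u₀ B₀)
    -- the uniform bounds
    (M Mb : ℝ) (hM : 0 < M) (hMb : 0 < Mb)
    (hEM_bdd : ∀ c, c₀ ≤ c →
      (∫⁻ t, supNorm (B c t) ^ 2 ∂timeMeasure T) +
        (∫⁻ t, supNorm (currents u E B c t) ∂timeMeasure T) ≤ ENNReal.ofReal M)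
    (hMHD_reg : ∀ᵐ t ∂timeMeasure T, MemH (m + 1) (Bb t))
    (hMHD_bdd : ∀ t ∈ Icc 0 T,
      ENNReal.ofReal (sobolevNorm m (ub t) + sobolevNorm m (Bb t)) +
        (∫⁻ s, ENNReal.ofReal (gradSobolevNormSq m (Bb s)) ∂timeMeasure T) ^ (1 / 2 : ℝ)
          ≤ ENNReal.ofReal Mb) :
    -- (i)
    (∀ p : ℝ, 1 ≤ p → p < 2 →
      ConvergesInLpL2 p T (scaledE E) (limitE ub Bb) ∧
        ConvergesInLpL2 p T (currents u E B) (limitJ Bb)) ∧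
    -- (ii)
    (Tendsto (fun c => ‖E₀c c‖) atTop (𝓝 0) →
      ConvergesInLpL2 2 T (scaledE E) (limitE ub Bb) ∧
        ConvergesInLpL2 2 T (currents u E B) (limitJ Bb)) ∧
    (¬ Tendsto (fun c => ‖E₀c c‖) atTop (𝓝 0) →
      ¬ HasLimitInLpL2 2 T (scaledE E) ∧ ¬ HasLimitInLpL2 2 T (currents u E B)) ∧
    -- (iii)
    (∀ p : ℝ, 2 < p →
      (Tendsto (fun c : ℝ => c ^ (1 - 2 / p) *
          (‖E₀c c‖ + ‖u₀c c - u₀‖ + ‖B₀c c - B₀‖)) atTop (𝓝 0) →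
        ConvergesInLpL2 p T (scaledE E) (limitE ub Bb) ∧
        -- for the current, `B^c` is in addition bounded in `L^p(0,T; L^∞)` uniformly in `c`
        ((∃ M' : ℝ, ∀ c, c₀ ≤ c →
            (∫⁻ t, supNorm (B c t) ^ p ∂timeMeasure T) ^ (1 / p) ≤ ENNReal.ofReal M') →
          ConvergesInLpL2 p T (currents u E B) (limitJ Bb))) ∧
      (0 < limsup (fun c : ℝ => ((c ^ (1 - 2 / p) *
          (‖E₀c c‖ - ‖u₀c c - u₀‖ - ‖B₀c c - B₀‖) : ℝ) : EReal)) atTop →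
        ¬ HasLimitInLpL2 p T (scaledE E) ∧ ¬ HasLimitInLpL2 p T (currents u E B))) := by
  have hm3 : 3 ≤ m := by
    by_contra hcon
    have : (m : ℝ) ≤ 2 := by exact_mod_cast (by omega : m ≤ 2)
    linarith
  have hsum : ∀ t ∈ Icc 0 T, sobolevNorm m (ub t) + sobolevNorm m (Bb t) ≤ Mb := fun t ht =>
    (ENNReal.ofReal_le_ofReal_iff hMb.le).1 (le_self_add.trans (hMHD_bdd t ht))
  obtain ⟨K, hK⟩ := hMHD.exists_bounds hm3
    (fun t ht => (le_add_of_nonneg_right (sobolevNorm_nonneg _ _)).trans (hsum t ht))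
    (fun t ht => (le_add_of_nonneg_left (sobolevNorm_nonneg _ _)).trans (hsum t ht))
  have h : SolutionFamily m c₀ T M K u E B u₀c E₀c B₀c ub Bb u₀ B₀ :=
    ⟨hm3, hT, hM, hEM, hMHD, hK, fun c hc => le_self_add.trans (hEM_bdd c hc)⟩
  refine ⟨fun p hp hp2 => h.convergesInLpL2_of_lt_two hu₀_lim hB₀_lim hE₀_bdd hp hp2,
    fun hE => h.convergesInLpL2_two hu₀_lim hB₀_lim hE, fun hE => ?_, fun p hp =>
    ⟨fun hE => ⟨h.convergesInLpL2_of_two_lt hp hE, fun ⟨M', hM'⟩ =>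
      h.convergesInLpL2_current hp hE hM'⟩, fun hE => ?_⟩⟩
  -- For `p = 2` the weight `c^(1-2/p)` equals `1`, and the errors of `u₀` and `B₀` tend to zero, so
  -- failure of `‖E₀‖` to vanish is all that is needed.
  · obtain ⟨α, hα, hf⟩ := frequently_le_of_not_tendsto (fun c => norm_nonneg _) hE hu₀_lim hB₀_lim
    exact h.not_hasLimitInLpL2 hE₀_bdd le_rfl hα (hf.mono fun c hc => by simpa using hc)
  · obtain ⟨α, hα, hf⟩ := frequently_le_of_limsup_pos hE
    exact h.not_hasLimitInLpL2 hE₀_bdd hp.le hα hf
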